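/- Let $X$ be a finite-dimensional complex Banach space and $[0,1]\ni s\mapsto L(s)\in\mathcal B(X)$ (with the operator norm). For an isolated point $e$ of $\mathrm{sp}\,L(s)$, the spectral projector on $e$ is $\frac1{2\pi i}\oint(z-L(s))^{-1}dz$ over a small positively oriented circle around $e$. Let $P(s)$ be the sum of the spectral projectors of $L(s)$ on its peripheral eigenvalues, i.e. the points of $\mathrm{sp}\,L(s)\cap S^1$, and $Q(s)=\mathrm{Id}-P(s)$. Assume: (H1) $\|L(s)\|\le 1$ for all $s\in[0,1]$; (H2) there is $\epsilon>0$ such that, for all $s\in[0,1]$, every peripheral eigenvalue of $L(s)$ is simple and any two distinct ones are at distance $>2\epsilon$; (H3) $s\mapsto L(s)P(s)$ is $C^2$ on $[0,1]$; (H4) $\ell:=\sup_{s\in[0,1]}\|L(s)Q(s)\|<1$. Let $N$ be the maximum over $s\in[0,1]$ of the number of peripheral eigenvalues of $L(s)$. Then the peripheral eigenvalues of $L(s)$, $s\in[0,1]$, can be labelled without repetition as $e^1(s),\dots,e^N(s)$ with each $e^j$ continuous on $[0,1]$. For every such labelling, with $P^j(s)$ the spectral projector of $L(s)$ on $e^j(s)$,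 the functions $e^j$ and $P^j$ are $C^2$ on $[0,1]$; in particular there is $c\ge0$ that bounds $|\frac{d^\alpha e^j}{ds^\alpha}(s)|$ and $\|\frac{d^\alpha P^j}{ds^\alpha}(s)\|$ for all $s\in[0,1]$, all $j$ and $\alpha=1,2$. Fix such a $c$. For $T\in\mathbb N$, $T\ge1$, and $0\le k\le T$ write $L_k=L(k/T)$, $P_k=P(k/T)$, $Q_k=Q(k/T)$, $P^j_k=P^j(k/T)$, $e^j_k=e^j(k/T)$, $L^P_k=L_kP_k$, $L^Q_k=L_kQ_k$, and put $$\kappa_{k}=\sum_jP^j_{k}P^j_{k-1}\big(\mathrm{Id}-(P^j_{k}-P^j_{k-1})^2\big)^{-1/2},\qquad \kappa_{k}^\dagger=\sum_jP^j_{k-1}P^j_{k}\big(\mathrm{Id}-(P^j_{k}-P^j_{k-1})^2\big)^{-1/2}\qquad(1\le k\le T),$$ where $(\mathrm{Id}-B)^{-1/2}=\sum_n\binom{2n}{n}4^{-n}B^n$ for $\|B\|<1$, and, for $0\le k\le T$ (empty products being the identity), $$A_{k,T}=\kappa_k\cdots\kappa_1\sum_j\Big(\prod_{n=1}^ke^j_n\Big)P^j_0,\qquad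 A_{k,T}^\dagger=\Big(\sum_j\Big(\prod_{n=1}^k\overline{e^j_n}\Big)P^j_0\Big)\kappa_1^\dagger\cdots\kappa_k^\dagger .$$ There are constants $T_0>c$, $T_0>0$, and $C_0>0$, depending only on $c$ and $N$, and $C>0$, depending only on $c$, $N$ and $\epsilon$, such that for all integers $T\ge T_0$ one has $\|P^j_{k}-P^j_{k-1}\|<1$ for $1\le k\le T$ and all $j$ (so that the maps above are well defined), and for all $0\le k\le T$: $$\max(\|A_{k,T}\|,\|A_{k,T}^\dagger\|)\le N\Big(1-\frac{c^2}{T_0^2}\Big)^{-T_0/2},$$ $$A_{k,T}^\dagger A_{k,T}=P_0,\quad A_{k,T}A_{k,T}^\dagger=P_k,\quad A_{k,T}P^j_0=P^j_kA_{k,T},\quad A_{k,T}^\dagger P^j_k=P^j_0A_{k,T}^\dagger,\quad A_{k,T}Q_0=Q_0A_{k,T}^\dagger=0,$$ $$\|L_k\cdots L_1-A_{k,T}\|\le\frac{C}{T(1-\ell)}+2\ell^k,\qquad \|L^P_k\cdots L^P_1P_0-A_{k,T}\|\le\frac CT,$$ $$\|L_k\cdots L_1-L^P_k\cdots L^P_1P_0-L^Q_k\cdots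 L^Q_1Q_0\|\le\frac{C_0}{T(1-\ell)},\qquad \|L^Q_k\cdots L^Q_1Q_0\|\le2\ell^k,$$ $$\|L_k\cdots L_1P_0-L^P_k\cdots L^P_1P_0\|\le\frac{C_0}{T(1-\ell)},\qquad \|L_k\cdots L_1Q_0\|\le\frac{C_0}{T(1-\ell)}+2\ell^k,$$ where $\ell^0=1$. -/

import Mathlib

open Set

noncomputable section

namespace Adiabatic

variable {X : Type*} [NormedAddCommGroup X] [NormedSpace ℂ X]

/-- The peripheral spectrum `sp A ∩ S¹`. -/
def peripheralSpectrum (A : X →L[ℂ] X) : Set ℂ :=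
  spectrum ℂ A ∩ Metric.sphere 0 1

/-- Half the distance from `μ` to the rest of the spectrum of `A`, capped at `1 / 2`
(the distance is `⊤` when there is no other point): the circle of this radius around an isolated
point `μ` of the spectrum encircles `μ` and no other point of the spectrum. -/
def isolatingRadius (A : X →L[ℂ] X) (μ : ℂ) : ℝ :=
  (min 1 (Metric.infEDist μ (spectrum ℂ A \ {μ}))).toReal / 2

/-- The spectral projector of `A` on `{μ}`: `(2πi)⁻¹ ∮ (z - A)⁻¹ dz` over a positively oriented
circle encircling `μ` and no other point of the spectrum. -/
def spectralProj (A : X →L[ℂ] X) (μ : ℂ) : X →L[ℂ] X :=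
  (2 * Real.pi * Complex.I : ℂ)⁻¹ • ∮ z in C(μ, isolatingRadius A μ), resolvent A z

/-- The peripheral spectral projector `P = ∑_j P^j`. -/
def peripheralProj (A : X →L[ℂ] X) : X →L[ℂ] X :=
  ∑ᶠ μ ∈ peripheralSpectrum A, spectralProj A μ

/-- The complementary projector `Q = Id - P`. -/
def stableProj (A : X →L[ℂ] X) : X →L[ℂ] X :=
  1 - peripheralProj A

/-- The hypotheses on `s ↦ L s`, `s ∈ [0,1]`, with gap `ε` and contraction constant `ℓ`. -/
structure Hypotheses (L : ℝ → X →L[ℂ] X) (ε ℓ : ℝ) : Prop where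
  contraction : ∀ s ∈ Icc (0 : ℝ) 1, ‖L s‖ ≤ 1
  gap_pos : 0 < ε
  /-- each peripheral eigenvalue has algebraic multiplicity one -/
  simple : ∀ s ∈ Icc (0 : ℝ) 1, ∀ μ ∈ peripheralSpectrum (L s),
    Module.finrank ℂ (Module.End.maxGenEigenspace (L s : X →ₗ[ℂ] X) μ) = 1
  gap : ∀ s ∈ Icc (0 : ℝ) 1, ∀ μ ∈ peripheralSpectrum (L s), ∀ ν ∈ peripheralSpectrum (L s),
    μ ≠ ν → 2 * ε < ‖μ - ν‖
  contDiffOn : ContDiffOn ℝ 2 (fun s => L s * peripheralProj (L s)) (Icc 0 1)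
  isLUB : IsLUB ((fun s => ‖L s * stableProj (L s)‖) '' Icc (0 : ℝ) 1) ℓ
  lt_one : ℓ < 1

/-- `N_max = sup_s N(s)`, with `N(s)` the number of peripheral eigenvalues of `L s`
(at most `dim X`). -/
def maxCount (L : ℝ → X →L[ℂ] X) : ℕ :=
  ⨆ s : Icc (0 : ℝ) 1, (peripheralSpectrum (L s)).ncard

/-- A continuous labelling `e^1(s), …, e^N(s)`, without repetition, of the peripheral eigenvalues
of `L s` for `s ∈ [0,1]`. -/
structure IsLabelling (L : ℝ → X →L[ℂ] X) {N : ℕ} (e : Fin N → ℝ → ℂ) : Prop where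
  continuousOn : ∀ j, ContinuousOn (e j) (Icc 0 1)
  injective : ∀ s ∈ Icc (0 : ℝ) 1, Function.Injective fun j => e j s
  range_eq : ∀ s ∈ Icc (0 : ℝ) 1, range (fun j => e j s) = peripheralSpectrum (L s)

/-- The spectral projector `P^j(s)` of `L s` on the eigenvalue `e^j(s)`. -/
def eigProj (L : ℝ → X →L[ℂ] X) {N : ℕ} (e : Fin N → ℝ → ℂ) (j : Fin N) (s : ℝ) : X →L[ℂ] X :=
  spectralProj (L s) (e j s)

/-- `c` bounds the first and second derivatives of all `P^j` and `e^j` on `[0,1]`. -/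
def DerivBound (L : ℝ → X →L[ℂ] X) {N : ℕ} (e : Fin N → ℝ → ℂ) (c : ℝ) : Prop :=
  ∀ s ∈ Icc (0 : ℝ) 1, ∀ j, ∀ α ∈ Icc 1 2,
    ‖iteratedDerivWithin α (eigProj L e j) (Icc 0 1) s‖ ≤ c ∧
    ‖iteratedDerivWithin α (e j) (Icc 0 1) s‖ ≤ c

/-- `(Id - B)^(-1/2)` through its power series `∑ (2n choose n) 4⁻ⁿ Bⁿ`, which converges
absolutely for `‖B‖ < 1`. -/
def invSqrtOneSub (B : X →L[ℂ] X) : X →L[ℂ] X :=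
  ∑' n : ℕ, ((Nat.centralBinom n : ℂ) / 4 ^ n) • B ^ n

/-- The ordered product `M k * M (k - 1) * ⋯ * M 1`. -/
def orderedProd (M : ℕ → X →L[ℂ] X) : ℕ → X →L[ℂ] X
  | 0 => 1
  | k + 1 => M (k + 1) * orderedProd M k

/-- The ordered product `M 1 * M 2 * ⋯ * M k`. -/
def revOrderedProd (M : ℕ → X →L[ℂ] X) : ℕ → X →L[ℂ] X
  | 0 => 1
  | k + 1 => revOrderedProd M k * M (k + 1)

section Families

variable (L : ℝ → X →L[ℂ] X) {N : ℕ} (e : Fin N → ℝ → ℂ) (T : ℕ)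

/-- `P^j_{k,T} = P^j(k/T)`. -/
def eigProjAt (j : Fin N) (k : ℕ) : X →L[ℂ] X := eigProj L e j (k / T : ℝ)

/-- The one-step Kato map from step `k - 1` to step `k` (used for `1 ≤ k`):
`∑_j P^j_k P^j_{k-1} (Id - (P^j_k - P^j_{k-1})²)^(-1/2)`. -/
def katoStep (k : ℕ) : X →L[ℂ] X :=
  ∑ j, eigProjAt L e T j k * eigProjAt L e T j (k - 1) *
    invSqrtOneSub ((eigProjAt L e T j k - eigProjAt L e T j (k - 1)) ^ 2)

/-- The one-step Kato map back from step `k` to step `k - 1`. -/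
def katoStepDagger (k : ℕ) : X →L[ℂ] X :=
  ∑ j, eigProjAt L e T j (k - 1) * eigProjAt L e T j k *
    invSqrtOneSub ((eigProjAt L e T j k - eigProjAt L e T j (k - 1)) ^ 2)

/-- The accumulated phases `∑_j (∏_{n=1}^k e^j_{n,T}) P^j_0`. -/
def phase (k : ℕ) : X →L[ℂ] X :=
  ∑ j, (∏ n ∈ Finset.Icc 1 k, e j (n / T : ℝ)) • eigProjAt L e T j 0

/-- The conjugate phases `∑_j (∏_{n=1}^k conj e^j_{n,T}) P^j_0`. -/
def phaseDagger (k : ℕ) : X →L[ℂ] X :=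
  ∑ j, (∏ n ∈ Finset.Icc 1 k, (starRingEnd ℂ) (e j (n / T : ℝ))) • eigProjAt L e T j 0

/-- The adiabatic approximation `A_{k,T}`. -/
def adiabaticMap (k : ℕ) : X →L[ℂ] X :=
  orderedProd (katoStep L e T) k * phase L e T k

/-- The pseudo-inverse `A†_{k,T}`. -/
def adiabaticMapDagger (k : ℕ) : X →L[ℂ] X :=
  phaseDagger L e T k * revOrderedProd (katoStepDagger L e T) k

/-- `L_{k,T} = L(k/T)`. -/
def mapAt (k : ℕ) : X →L[ℂ] X := L (k / T : ℝ)

/-- `P_{k,T} = P(k/T)`. -/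
def projAt (k : ℕ) : X →L[ℂ] X := peripheralProj (mapAt L T k)

/-- `Q_{k,T} = Id - P(k/T)`. -/
def stableAt (k : ℕ) : X →L[ℂ] X := stableProj (mapAt L T k)

/-- `L_{k,T} ⋯ L_{1,T}`. -/
def evolution (k : ℕ) : X →L[ℂ] X := orderedProd (mapAt L T) k

/-- `L^P_{k,T} ⋯ L^P_{1,T}` with `L^P = L P`. -/
def evolutionP (k : ℕ) : X →L[ℂ] X := orderedProd (fun n => mapAt L T n * projAt L T n) k

/-- `L^Q_{k,T} ⋯ L^Q_{1,T}` with `L^Q = L Q`. -/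
def evolutionQ (k : ℕ) : X →L[ℂ] X := orderedProd (fun n => mapAt L T n * stableAt L T n) k

end Families

end Adiabatic

end

/-! The peripheral part of a contraction is rigid. Each `P^j`, and by recurrence on the torus also
`P`, has norm at most one, so the products of `L P` never amplify errors. The peripheral spectrum
moves uniformly continuously because `L P` does and because the resolvent of `L P` at distance `δ`
from its nonzero spectrum is bounded in terms of `δ` and the norm of the trace alone. Together with
the uniform gap this gives the labelling. Lagrange interpolation expresses `P^j` through `L P` and
the eigenvalues, and `(e^j)' = tr (P^j (L P)' P^j)`; alternating the two lifts continuity to `C^2`.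

The operators `κ_k` are Kato's maps. Since `(p - q)^2` commutes with both projections and `q p q = q
(1 - (p - q)^2)`, the maps for `(p, q)` and `(q, p)` are mutually inverse between the ranges. This
yields all the algebraic relations for `A` and `A†`, while the norms follow from the scalar series
of `(1 - x)^(-1/2)`.

Two errors remain. Passing between the ranges of `P` and `Q` costs `O(1/T)` per step. What leaks
into the range of `Q` is damped by `ℓ`, hence stays of size `1/(T(1 - ℓ))`, and leaking back costs
another `1/T`, so `T` steps accumulate only `O(1/(T(1 - ℓ)))` (`IsLeaky`). Within the range of `P`,
one step of `L P` and one step of `A` differ at first order in `1/T` by terms mixing different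
eigenvalues. These are a commutator of `L P` with an explicit corrector `Z`, whose denominators `e^i
- e^j` are controlled by the gap. Replacing `A_k` by `(1 + Z_k/T) A_k` leaves a defect `O(1/T^2)`
per step (`norm_defect_le`), which sums to `O(1/T)`. Only this second error involves `ε`. -/

section AdiabaticTheory

open Filter Topology
open Finset.HasAntidiagonal (antidiagonal)

/-! ### The power series of the inverse square root. -/

theorem Nat.sum_antidiagonal_centralBinom_mul (n : ℕ) :
    ∑ p ∈ antidiagonal n, p.1.centralBinom * p.2.centralBinom = 4 ^ n := by
  induction n with
  | zero => simp
  | succ n ih =>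
    have hswap : ∀ (m : ℕ) (f : ℕ → ℕ → ℕ),
        ∑ p ∈ antidiagonal m, f p.1 p.2 = ∑ p ∈ antidiagonal m, f p.2 p.1 :=
      fun m f => (Finset.Nat.sum_antidiagonal_swap (n := m) (f := fun p => f p.1 p.2)).symm
    -- The factor `n + 1 = p.1 + p.2` symmetrises to `2 * p.1`. The term `p.1 = 0` drops out, the
    -- recursion `(m + 1) C(m + 1) = 2 (2 m + 1) C(m)` lowers the index, and a second symmetrisation
    -- turns the weight into the constant `4 (n + 1)`.
    have key : (n + 1) * ∑ p ∈ antidiagonal (n + 1), p.1.centralBinom * p.2.centralBinom =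
        (n + 1) * 4 ^ (n + 1) := by
      calc (n + 1) * ∑ p ∈ antidiagonal (n + 1), p.1.centralBinom * p.2.centralBinom
          = ∑ p ∈ antidiagonal (n + 1), (p.1 * (p.1.centralBinom * p.2.centralBinom) +
              p.2 * (p.1.centralBinom * p.2.centralBinom)) := by
            rw [Finset.mul_sum]
            refine Finset.sum_congr rfl fun p hp => ?_
            rw [← Finset.HasAntidiagonal.mem_antidiagonal.1 hp]; ring
        _ = 2 * ∑ p ∈ antidiagonal (n + 1), p.1 * (p.1.centralBinom * p.2.centralBinom) := by
            rw [Finset.sum_add_distrib,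
              hswap (n + 1) fun a b => b * (a.centralBinom * b.centralBinom), two_mul]
            congr 1
            exact Finset.sum_congr rfl fun p _ => by ring
        _ = 2 * ∑ p ∈ antidiagonal n,
              2 * (2 * p.1 + 1) * (p.1.centralBinom * p.2.centralBinom) := by
            rw [Finset.Nat.sum_antidiagonal_succ]
            simp only [zero_mul, zero_add]
            congr 1
            refine Finset.sum_congr rfl fun p _ => ?_
            rw [← mul_assoc, Nat.succ_mul_centralBinom_succ]; ring
        _ = ∑ p ∈ antidiagonal n, 2 * (2 * p.1 + 1) * (p.1.centralBinom * p.2.centralBinom) +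
            ∑ p ∈ antidiagonal n,
              2 * (2 * p.2 + 1) * (p.2.centralBinom * p.1.centralBinom) := by
            rw [two_mul]
            congr 1
            exact hswap n fun a b => 2 * (2 * a + 1) * (a.centralBinom * b.centralBinom)
        _ = 4 * (n + 1) * ∑ p ∈ antidiagonal n, p.1.centralBinom * p.2.centralBinom := by
            rw [← Finset.sum_add_distrib, Finset.mul_sum]
            refine Finset.sum_congr rfl fun p hp => ?_
            rw [← Finset.HasAntidiagonal.mem_antidiagonal.1 hp]; ring
        _ = (n + 1) * 4 ^ (n + 1) := by rw [ih]; ring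
    exact Nat.eq_of_mul_eq_mul_left n.succ_pos key

section InvSqrtSeries

variable {𝕜 R : Type*} [RCLike 𝕜] [NormedRing R] [NormedAlgebra 𝕜 R]

/-- The assumption `‖1‖ ≤ 1` replaces `‖1‖ = 1` so that the zero space is covered, where the
identity has norm zero. -/
theorem norm_centralBinom_smul_pow_le (h1 : ‖(1 : R)‖ ≤ 1) (B : R) (n : ℕ) :
    ‖((n.centralBinom : 𝕜) / 4 ^ n) • B ^ n‖ ≤ ((n.centralBinom : ℝ) / 4 ^ n) * ‖B‖ ^ n := by
  have hB : ‖B ^ n‖ ≤ ‖B‖ ^ n := by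
    rcases n.eq_zero_or_pos with rfl | hn
    · simpa using h1
    · exact norm_pow_le' B hn
  refine (norm_smul_le _ _).trans ?_
  have : ‖((n.centralBinom : 𝕜) / 4 ^ n)‖ = (n.centralBinom : ℝ) / 4 ^ n := by
    simp
  rw [this]
  gcongr

theorem centralBinom_div_four_pow_le_one (n : ℕ) : (n.centralBinom : ℝ) / 4 ^ n ≤ 1 := by
  rw [div_le_one (by positivity)]
  exact_mod_cast n.centralBinom_le_four_pow

theorem summable_centralBinom_mul_pow {x : ℝ} (hx0 : 0 ≤ x) (hx : x < 1) :
    Summable fun n : ℕ => ((n.centralBinom : ℝ) / 4 ^ n) * x ^ n := by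
  refine Summable.of_nonneg_of_le (fun n => by positivity) (fun n => ?_)
    (summable_geometric_of_lt_one hx0 hx)
  exact mul_le_of_le_one_left (by positivity) (centralBinom_div_four_pow_le_one n)

theorem summable_norm_centralBinom_smul_pow (h1 : ‖(1 : R)‖ ≤ 1) {B : R} (hB : ‖B‖ < 1) :
    Summable fun n : ℕ => ‖((n.centralBinom : 𝕜) / 4 ^ n) • B ^ n‖ :=
  Summable.of_nonneg_of_le (fun _ => norm_nonneg _) (norm_centralBinom_smul_pow_le h1 B)
    (summable_centralBinom_mul_pow (norm_nonneg B) hB)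

/-- In the Cauchy product the coefficient of `B ^ n` is `4⁻ⁿ` times the convolution of central
binomials, that is, one. -/
theorem tsum_centralBinom_smul_pow_mul_self [CompleteSpace R] (h1 : ‖(1 : R)‖ ≤ 1) {B : R}
    (hB : ‖B‖ < 1) :
    (∑' n : ℕ, ((n.centralBinom : 𝕜) / 4 ^ n) • B ^ n) *
      (∑' n : ℕ, ((n.centralBinom : 𝕜) / 4 ^ n) • B ^ n) = ∑' n : ℕ, B ^ n := by
  have hs := summable_norm_centralBinom_smul_pow (𝕜 := 𝕜) h1 hB
  rw [tsum_mul_tsum_eq_tsum_sum_antidiagonal_of_summable_norm hs hs]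
  refine tsum_congr fun n => ?_
  have h4 : (4 : 𝕜) ≠ 0 := by norm_num
  calc ∑ p ∈ antidiagonal n, ((p.1.centralBinom : 𝕜) / 4 ^ p.1) • B ^ p.1 *
          ((p.2.centralBinom : 𝕜) / 4 ^ p.2) • B ^ p.2
      = ∑ p ∈ antidiagonal n,
          (((p.1.centralBinom * p.2.centralBinom : ℕ) : 𝕜) / 4 ^ n) • B ^ n := by
        refine Finset.sum_congr rfl fun p hp => ?_
        rw [smul_mul_smul_comm, ← pow_add, ← Finset.HasAntidiagonal.mem_antidiagonal.1 hp]
        push_cast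
        rw [div_mul_div_comm, ← pow_add 4]
    _ = B ^ n := by
        rw [← Finset.sum_smul, ← Finset.sum_div, ← Nat.cast_sum,
          Nat.sum_antidiagonal_centralBinom_mul]
        push_cast
        rw [div_self (pow_ne_zero _ h4), one_smul]

end InvSqrtSeries

theorem tsum_centralBinom_mul_pow {x : ℝ} (hx0 : 0 ≤ x) (hx : x < 1) :
    ∑' n : ℕ, ((n.centralBinom : ℝ) / 4 ^ n) * x ^ n = (1 - x) ^ (-(1 / 2) : ℝ) := by
  have hn : ‖x‖ < 1 := by rwa [Real.norm_of_nonneg hx0]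
  have h := tsum_centralBinom_smul_pow_mul_self (𝕜 := ℝ) (R := ℝ) (by simp) hn
  rw [tsum_geometric_of_lt_one hx0 hx] at h
  simp only [smul_eq_mul] at h
  have h0 : 0 ≤ ∑' n : ℕ, ((n.centralBinom : ℝ) / 4 ^ n) * x ^ n :=
    tsum_nonneg fun n => by positivity
  rw [Real.rpow_neg (by linarith), ← Real.sqrt_eq_rpow, ← Real.sqrt_inv, ← h,
    Real.sqrt_mul_self h0]

namespace Adiabatic

variable {X : Type*} [NormedAddCommGroup X] [NormedSpace ℂ X]

theorem norm_one_le : ‖(1 : X →L[ℂ] X)‖ ≤ 1 := ContinuousLinearMap.norm_id_le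

theorem norm_invSqrtOneSub_le {B : X →L[ℂ] X} (hB : ‖B‖ < 1) :
    ‖invSqrtOneSub B‖ ≤ (1 - ‖B‖) ^ (-(1 / 2) : ℝ) := by
  rw [← tsum_centralBinom_mul_pow (norm_nonneg B) hB]
  exact tsum_of_norm_bounded (summable_centralBinom_mul_pow (norm_nonneg B) hB).hasSum
    (norm_centralBinom_smul_pow_le norm_one_le B)

/-- All coefficients are at most one, so the series without its constant term is dominated by a
geometric series. -/
theorem norm_invSqrtOneSub_sub_one_le [CompleteSpace X] {B : X →L[ℂ] X} (hB : ‖B‖ < 1) :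
    ‖invSqrtOneSub B - 1‖ ≤ ‖B‖ / (1 - ‖B‖) := by
  have hs : Summable fun n : ℕ => ((n.centralBinom : ℂ) / 4 ^ n) • B ^ n :=
    (summable_norm_centralBinom_smul_pow norm_one_le hB).of_norm
  have h : invSqrtOneSub B - 1 =
      ∑' n : ℕ, (((n + 1).centralBinom : ℂ) / 4 ^ (n + 1)) • B ^ (n + 1) := by
    rw [invSqrtOneSub, hs.tsum_eq_zero_add]
    simp
  rw [h, div_eq_mul_inv]
  refine tsum_of_norm_bounded
    ((hasSum_geometric_of_lt_one (norm_nonneg B) hB).mul_left ‖B‖) fun n => ?_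
  refine (norm_centralBinom_smul_pow_le norm_one_le B (n + 1)).trans ?_
  rw [← pow_succ']
  exact mul_le_of_le_one_left (by positivity) (centralBinom_div_four_pow_le_one _)

theorem invSqrtOneSub_mul_self_mul [CompleteSpace X] {B : X →L[ℂ] X} (hB : ‖B‖ < 1) :
    invSqrtOneSub B * invSqrtOneSub B * (1 - B) = 1 := by
  rw [invSqrtOneSub, tsum_centralBinom_smul_pow_mul_self norm_one_le hB]
  exact geom_series_mul_neg B hB

theorem commute_invSqrtOneSub [CompleteSpace X] {B D : X →L[ℂ] X} (hB : ‖B‖ < 1)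
    (h : Commute D B) : Commute D (invSqrtOneSub B) := by
  have hs : Summable fun n : ℕ => ((n.centralBinom : ℂ) / 4 ^ n) • B ^ n :=
    (summable_norm_centralBinom_smul_pow norm_one_le hB).of_norm
  show D * _ = _ * D
  rw [invSqrtOneSub, ← hs.tsum_mul_left, ← hs.tsum_mul_right]
  refine tsum_congr fun n => ?_
  rw [mul_smul_comm, smul_mul_assoc, (h.pow_right n).eq]

end Adiabatic

/-! ### Contour integrals and simple eigenvalues. -/

namespace Adiabatic

section SpectralProjector

variable {X : Type*} [NormedAddCommGroup X] [NormedSpace ℂ X]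

/-- `E` is the projection onto the kernel of `A - μ` along its range, of trace one. -/
structure IsSimpleProj (A : X →L[ℂ] X) (μ : ℂ) (E : X →L[ℂ] X) : Prop where
  mul_self : E * E = E
  mul_left : A * E = μ • E
  mul_right : E * A = μ • E
  apply_eq : ∀ x, A x = μ • x → E x = x
  exists_sub : ∀ x, ∃ w, x - E x = A w - μ • w
  trace_eq : LinearMap.trace ℂ X (E : X →ₗ[ℂ] X) = 1

theorem mem_spectrum_of_apply {A : X →L[ℂ] X} {μ : ℂ} {x : X} (hx : x ≠ 0) (h : A x = μ • x) :
    μ ∈ spectrum ℂ A := by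
  rintro ⟨u, hu⟩
  apply hx
  have h0 : (u : X →L[ℂ] X) x = 0 := by
    rw [hu]; simp [Algebra.algebraMap_eq_smul_one, h]
  have : ((↑u⁻¹ : X →L[ℂ] X) * u) x = 0 := by
    rw [mul_apply_eq_comp, h0, map_zero]
  simpa using this

theorem isolatingRadius_lt_one (A : X →L[ℂ] X) (μ : ℂ) : isolatingRadius A μ < 1 := by
  have : (min 1 (Metric.infEDist μ (spectrum ℂ A \ {μ}))).toReal ≤ (1 : ENNReal).toReal :=
    ENNReal.toReal_mono ENNReal.one_ne_top (min_le_left _ _)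
  rw [ENNReal.toReal_one] at this
  unfold isolatingRadius
  linarith

variable [FiniteDimensional ℂ X]

/-- A nonzero kernel inside a one-dimensional generalized eigenspace fills it. Thus `g² y = 0`
forces `g y = 0`, kernel and range of `g = A - μ` meet trivially, and rank-nullity makes them
complementary. -/
theorem exists_isSimpleProj (A : X →L[ℂ] X) (μ : ℂ)
    (h : Module.finrank ℂ (Module.End.maxGenEigenspace (A : X →ₗ[ℂ] X) μ) = 1) :
    ∃ E, IsSimpleProj A μ E := by
  set f : X →ₗ[ℂ] X := (A : X →ₗ[ℂ] X) with hf
  set g : X →ₗ[ℂ] X := f - μ • 1 with hg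
  have hgx : ∀ x, g x = A x - μ • x := fun x => by simp [hg, hf]
  have hle : LinearMap.ker g ≤ Module.End.maxGenEigenspace f μ := by
    intro x hx
    rw [Module.End.mem_maxGenEigenspace]
    exact ⟨1, by simpa [hg] using hx⟩
  have hne : LinearMap.ker g ≠ ⊥ := by
    intro hbot
    have hinj : Function.Injective g := LinearMap.ker_eq_bot.1 hbot
    have : Module.End.maxGenEigenspace f μ = ⊥ := by
      rw [eq_bot_iff]
      intro x hx
      obtain ⟨k, hk⟩ := (Module.End.mem_maxGenEigenspace f μ x).1 hx
      have hk' : (g ^ k) x = (g ^ k) 0 := by rw [map_zero]; exact hk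
      have := (Module.End.iterate_injective hinj k) hk'
      simpa using this
    rw [this] at h
    simp at h
  have hker : LinearMap.ker g = Module.End.maxGenEigenspace f μ := by
    refine Submodule.eq_of_le_of_finrank_le hle ?_
    rw [h]
    exact Submodule.one_le_finrank_iff.2 hne
  have hdisj : Disjoint (LinearMap.ker g) (LinearMap.range g) := by
    rw [Submodule.disjoint_def]
    rintro x hx ⟨y, rfl⟩
    have : y ∈ LinearMap.ker g := by
      rw [hker, Module.End.mem_maxGenEigenspace]
      refine ⟨2, ?_⟩
      change (g ^ 2) y = 0
      rw [pow_two]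
      exact hx
    exact this
  have hc : IsCompl (LinearMap.ker g) (LinearMap.range g) := by
    refine (Submodule.isCompl_iff_disjoint _ _ ?_).2 hdisj
    rw [add_comm]
    exact (LinearMap.finrank_range_add_finrank_ker g).symm.le
  set E₀ := (LinearMap.ker g).projection (LinearMap.range g) hc with hE₀
  have hmem : ∀ x, g (E₀ x) = 0 := fun x => Submodule.projection_apply_mem hc x
  have hzero : ∀ x, E₀ (g x) = 0 := fun x =>
    (Submodule.projection_apply_eq_zero_iff hc).2 ⟨x, rfl⟩
  refine ⟨LinearMap.toContinuousLinearMap E₀, ?_, ?_, ?_, ?_, ?_, ?_⟩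
  · ext x
    exact Submodule.projection_apply_of_mem_left hc (Submodule.projection_apply_mem hc x)
  · ext x
    have := hmem x
    rw [hgx, sub_eq_zero] at this
    simpa using this
  · ext x
    have := hzero x
    rw [hgx, map_sub, map_smul, sub_eq_zero] at this
    simpa using this
  · intro x hx
    refine Submodule.projection_apply_of_mem_left hc ?_
    rw [LinearMap.mem_ker, hgx, hx, sub_self]
  · intro x
    obtain ⟨w, hw⟩ := Submodule.sub_projection_mem hc x
    exact ⟨w, by rw [← hgx, hw]; rfl⟩
  · have hp : LinearMap.IsProj (LinearMap.ker g) E₀ :=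
      ⟨fun x => Submodule.projection_apply_mem hc x,
        fun x hx => Submodule.projection_apply_of_mem_left hc hx⟩
    have := hp.trace
    rw [hker, h] at this
    simpa using this

theorem spectrum_finite (A : X →L[ℂ] X) : (spectrum ℂ A).Finite := by
  have h := Module.End.finite_spectrum (A : X →ₗ[ℂ] X)
  have e := AlgEquiv.spectrum_eq (Module.End.toContinuousLinearMap X (𝕜 := ℂ)) (A : X →ₗ[ℂ] X)
  rw [← e] at h
  exact h

theorem isUnit_of_injective {A : X →L[ℂ] X} (h : ∀ x, A x = 0 → x = 0) : IsUnit A := by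
  have h1 : IsUnit (A : X →ₗ[ℂ] X) :=
    (LinearMap.isUnit_iff_ker_eq_bot _).2 (LinearMap.ker_eq_bot'.2 h)
  exact h1.map (Module.End.toContinuousLinearMap X (𝕜 := ℂ))

theorem isolatingRadius_pos (A : X →L[ℂ] X) (μ : ℂ) : 0 < isolatingRadius A μ := by
  have hcl : IsClosed (spectrum ℂ A \ {μ}) := ((spectrum_finite A).subset sdiff_subset).isClosed
  have h0 : Metric.infEDist μ (spectrum ℂ A \ {μ}) ≠ 0 := by
    intro h
    have := (Metric.mem_iff_infEDist_zero_of_closed hcl).2 h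
    exact this.2 rfl
  refine half_pos (ENNReal.toReal_pos ?_ (ne_top_of_le_ne_top ENNReal.one_ne_top (min_le_left _ _)))
  exact (lt_min one_pos (pos_iff_ne_zero.2 h0)).ne'

theorem eq_of_mem_closedBall_isolatingRadius {A : X →L[ℂ] X} {μ z : ℂ}
    (hz : z ∈ Metric.closedBall μ (isolatingRadius A μ)) (hs : z ∈ spectrum ℂ A) : z = μ := by
  by_contra hne
  have hmem : z ∈ spectrum ℂ A \ {μ} := ⟨hs, hne⟩
  have h1 : min 1 (Metric.infEDist μ (spectrum ℂ A \ {μ})) ≤ edist μ z :=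
    (min_le_right _ _).trans (Metric.infEDist_le_edist_of_mem hmem)
  have h2 := ENNReal.toReal_mono (edist_ne_top _ _) h1
  rw [← dist_edist, dist_comm] at h2
  have h3 := isolatingRadius_pos A μ
  have h4 := Metric.mem_closedBall.1 hz
  have h5 : (min 1 (Metric.infEDist μ (spectrum ℂ A \ {μ}))).toReal = 2 * isolatingRadius A μ := by
    unfold isolatingRadius; ring
  linarith

/-- On the circle the resolvent splits into `(z - μ)⁻¹ • E` and a part holomorphic on the closed
disc. Cauchy's theorem kills the latter, and the former integrates to `2πi • E`. -/
theorem IsSimpleProj.spectralProj_eq {A : X →L[ℂ] X} {μ : ℂ} {E : X →L[ℂ] X}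
    (h : IsSimpleProj A μ E) : spectralProj A μ = E := by
  set r := isolatingRadius A μ with hr
  have hr0 : 0 < r := isolatingRadius_pos A μ
  have hr1 : r < 1 := isolatingRadius_lt_one A μ
  have hcomm : E * A = A * E := by rw [h.mul_left, h.mul_right]
  -- The eigenvalue `μ` is moved to `μ + 2`, outside the disc since its radius is less than one.
  -- Then `A'` has no spectrum in the closed disc and agrees with `A` on the kernel of `E`.
  set A' : X →L[ℂ] X := A * (1 - E) + (μ + 2) • E with hA'
  have hA'E : A' * (1 - E) = A * (1 - E) := by
    have : (1 - E) * (1 - E) = 1 - E := by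
      simp only [mul_sub, sub_mul, one_mul, mul_one, h.mul_self]; abel
    rw [hA', add_mul, mul_assoc, this, smul_mul_assoc, mul_sub E, mul_one, h.mul_self, sub_self,
      smul_zero, add_zero]
  have hEA' : E * A' = (μ + 2) • E := by
    rw [hA', mul_add, ← mul_assoc, hcomm, mul_assoc, mul_sub, mul_one, h.mul_self, sub_self,
      mul_zero, zero_add, mul_smul_comm, h.mul_self]
  have hres : ∀ z ∈ Metric.closedBall μ r, z ∈ resolventSet ℂ A' := by
    intro z hz
    have hz2 : z ≠ μ + 2 := by
      rintro rfl
      rw [Metric.mem_closedBall, dist_eq_norm] at hz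
      norm_num at hz
      linarith
    refine isUnit_of_injective fun x hx => ?_
    have hx' : A' x = z • x := by
      have : z • x - A' x = 0 := by simpa [Algebra.algebraMap_eq_smul_one] using hx
      exact (sub_eq_zero.1 this).symm
    have hEx : E x = 0 := by
      have h1 : (E * A') x = (μ + 2) • E x := by rw [hEA']; rfl
      rw [mul_apply_eq_comp, hx', map_smul] at h1
      have h2 : (z - (μ + 2)) • E x = 0 := by rw [sub_smul, h1, sub_self]
      exact (smul_eq_zero.1 h2).resolve_left (sub_ne_zero.2 hz2)
    have hAx : A x = z • x := by
      rw [← hx', hA']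
      simp [hEx]
    by_contra hne
    have hzs := mem_spectrum_of_apply hne hAx
    have := eq_of_mem_closedBall_isolatingRadius hz hzs
    subst this
    exact hne ((h.apply_eq x hAx).symm.trans hEx)
  have hsplit : ∀ z ∈ Metric.sphere μ r,
      resolvent A z = (z - μ)⁻¹ • E + resolvent A' z * (1 - E) := by
    intro z hz
    have hzb : z ∈ Metric.closedBall μ r := Metric.sphere_subset_closedBall hz
    have hzμ : z - μ ≠ 0 := by
      intro h0
      rw [Metric.mem_sphere, dist_eq_norm, h0, norm_zero] at hz
      linarith
    have hu' : IsUnit (algebraMap ℂ (X →L[ℂ] X) z - A') := hres z hzb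
    have hinv : resolvent A' z * (algebraMap ℂ (X →L[ℂ] X) z - A') = 1 :=
      Ring.inverse_mul_cancel _ hu'
    have hleft : ((z - μ)⁻¹ • E + resolvent A' z * (1 - E)) * (algebraMap ℂ (X →L[ℂ] X) z - A) =
        1 := by
      have e1 : (1 - E) * (algebraMap ℂ (X →L[ℂ] X) z - A) =
          (algebraMap ℂ (X →L[ℂ] X) z - A') * (1 - E) := by
        rw [sub_mul _ A', hA'E]
        simp only [Algebra.algebraMap_eq_smul_one, sub_mul, mul_sub, one_mul, mul_one,
          smul_mul_assoc, mul_smul_comm, hcomm, smul_sub]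
      have e2 : E * (algebraMap ℂ (X →L[ℂ] X) z - A) = (z - μ) • E := by
        rw [mul_sub, h.mul_right, Algebra.algebraMap_eq_smul_one, mul_smul_comm, mul_one, sub_smul]
      rw [add_mul, mul_assoc (resolvent A' z), e1, ← mul_assoc, hinv, one_mul, smul_mul_assoc, e2,
        smul_smul, inv_mul_cancel₀ hzμ, one_smul]
      abel
    have hu : IsUnit (algebraMap ℂ (X →L[ℂ] X) z - A) := by
      by_contra hns
      exact hzμ (sub_eq_zero.2 (eq_of_mem_closedBall_isolatingRadius hzb hns))
    have hR : (algebraMap ℂ (X →L[ℂ] X) z - A) * resolvent A z = 1 :=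
      Ring.mul_inverse_cancel _ hu
    exact (left_inv_eq_right_inv hleft hR).symm
  have hdiff : ∀ z ∈ Metric.closedBall μ r,
      DifferentiableAt ℂ (fun z => resolvent A' z * (1 - E)) z := fun z hz =>
    ((spectrum.hasDerivAt_resolvent_const_left (hres z hz)).differentiableAt).mul_const _
  have hcont : ContinuousOn (fun z => resolvent A' z * (1 - E)) (Metric.closedBall μ r) :=
    fun z hz => (hdiff z hz).continuousAt.continuousWithinAt
  have hzero : ∮ z in C(μ, r), resolvent A' z * (1 - E) = 0 :=
    Complex.circleIntegral_eq_zero_of_differentiable_on_off_countable hr0.le countable_empty hcont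
      fun z hz => hdiff z (Metric.ball_subset_closedBall hz.1)
  have hi1 : CircleIntegrable (fun z => (z - μ)⁻¹ • E) μ r := by
    refine ContinuousOn.circleIntegrable hr0.le ?_
    have hsub : ContinuousOn (fun z : ℂ => z - μ) (Metric.sphere μ r) := by fun_prop
    refine ContinuousOn.smul (hsub.inv₀ fun z hz h0 => ?_) continuousOn_const
    rw [Metric.mem_sphere, dist_eq_norm, h0, norm_zero] at hz
    linarith
  have hi2 : CircleIntegrable (fun z => resolvent A' z * (1 - E)) μ r :=
    (hcont.mono Metric.sphere_subset_closedBall).circleIntegrable hr0.le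
  have hint : ∮ z in C(μ, r), resolvent A z = (2 * Real.pi * Complex.I : ℂ) • E := by
    rw [circleIntegral.integral_congr hr0.le hsplit, circleIntegral.integral_add hi1 hi2, hzero,
      add_zero, circleIntegral.integral_smul_const, circleIntegral.integral_sub_center_inv μ hr0.ne']
  rw [spectralProj, ← hr, hint, smul_smul, inv_mul_cancel₀ Complex.two_pi_I_ne_zero, one_smul]

end SpectralProjector

end Adiabatic

/-! ### Peripheral projectors of a contraction have norm at most one. -/

namespace Adiabatic

variable {X : Type*} [NormedAddCommGroup X] [NormedSpace ℂ X]

theorem norm_pow_le_one {A : X →L[ℂ] X} (hA : ‖A‖ ≤ 1) (n : ℕ) : ‖A ^ n‖ ≤ 1 := by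
  rcases n.eq_zero_or_pos with rfl | hn
  · simpa using norm_one_le (X := X)
  · exact (norm_pow_le' A hn).trans (pow_le_one₀ (norm_nonneg _) hA)

/-- Mean ergodic argument: with `B = μ⁻¹ • A` and `x = E x + B v - v`, the sum of `B ^ i x` over `i
< n` equals `n • E x + B ^ n v - v` and has norm at most `n * ‖x‖`. Dividing by `n` and letting it
grow gives `‖E x‖ ≤ ‖x‖`. -/
theorem IsSimpleProj.norm_le_one {A : X →L[ℂ] X} {μ : ℂ} {E : X →L[ℂ] X}
    (h : IsSimpleProj A μ E) (hA : ‖A‖ ≤ 1) (hμ : ‖μ‖ = 1) : ‖E‖ ≤ 1 := by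
  have hμ0 : μ ≠ 0 := norm_ne_zero_iff.1 (by rw [hμ]; exact one_ne_zero)
  set B := μ⁻¹ • A with hB
  have hB1 : ‖B‖ ≤ 1 := by
    rw [hB, norm_smul, norm_inv, hμ, inv_one, one_mul]; exact hA
  have hBE : ∀ x, B (E x) = E x := fun x => by
    have h1 : A (E x) = μ • E x := by
      rw [← mul_apply_eq_comp, h.mul_left]; rfl
    rw [hB, smul_apply, h1, smul_smul, inv_mul_cancel₀ hμ0, one_smul]
  refine ContinuousLinearMap.opNorm_le_bound _ zero_le_one fun x => ?_
  rw [one_mul]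
  obtain ⟨v, hx⟩ : ∃ v, x = E x + B v - v := by
    obtain ⟨w, hw⟩ := h.exists_sub x
    refine ⟨μ • w, ?_⟩
    have : B (μ • w) = A w := by
      rw [map_smul, hB, smul_apply, smul_smul, mul_inv_cancel₀ hμ0, one_smul]
    rw [this, add_sub_assoc, ← hw]; abel
  have key : ∀ n : ℕ, ‖(n : ℂ) • E x + (B ^ n) v - v‖ ≤ n * ‖x‖ := by
    intro n
    induction n with
    | zero => simp
    | succ n ih =>
      have e1 : ((n + 1 : ℕ) : ℂ) • E x + (B ^ (n + 1)) v - v =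
          B ((n : ℂ) • E x + (B ^ n) v - v) + x := by
        rw [map_sub, map_add, map_smul, hBE, pow_succ', mul_apply_eq_comp,
          show B v = x - E x + v by nth_rewrite 1 [hx]; abel]
        push_cast
        rw [add_smul, one_smul]
        abel
      rw [e1]
      calc ‖B ((n : ℂ) • E x + (B ^ n) v - v) + x‖
          ≤ ‖B‖ * ‖(n : ℂ) • E x + (B ^ n) v - v‖ + ‖x‖ :=
            (norm_add_le _ _).trans (by gcongr; exact B.le_opNorm _)
        _ ≤ 1 * (n * ‖x‖) + ‖x‖ := by gcongr
        _ = ((n + 1 : ℕ) : ℝ) * ‖x‖ := by push_cast; ring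
  have key2 : ∀ n : ℕ, (n : ℝ) * (‖E x‖ - ‖x‖) ≤ 2 * ‖v‖ := by
    intro n
    have h1 : (n : ℂ) • E x = ((n : ℂ) • E x + (B ^ n) v - v) + (v - (B ^ n) v) := by abel
    have h2 : ‖(B ^ n) v‖ ≤ ‖v‖ := by
      refine ((B ^ n).le_opNorm v).trans ?_
      exact mul_le_of_le_one_left (norm_nonneg _) (norm_pow_le_one hB1 n)
    have h3 : ‖(n : ℂ) • E x‖ = n * ‖E x‖ := by rw [norm_smul]; simp
    have h4 : ‖(n : ℂ) • E x‖ ≤ n * ‖x‖ + (‖v‖ + ‖v‖) := by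
      rw [h1]
      exact (norm_add_le _ _).trans (add_le_add (key n)
        ((norm_sub_le _ _).trans (by gcongr)))
    rw [h3] at h4
    linarith
  by_contra! hlt
  obtain ⟨n, hn⟩ := exists_nat_gt (2 * ‖v‖ / (‖E x‖ - ‖x‖))
  rw [div_lt_iff₀ (by linarith)] at hn
  linarith [key2 n]

/-- The rank one spectral projectors `p i` of a contraction `A` on the points `e i` of the unit
circle, together with the contraction property of their sum. -/
structure IsPeripheralFamily {ι : Type*} [Fintype ι] (A : X →L[ℂ] X) (e : ι → ℂ)
    (p : ι → X →L[ℂ] X) : Prop where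
  norm_eig : ∀ i, ‖e i‖ = 1
  mul_self : ∀ i, p i * p i = p i
  mul_of_ne : ∀ i j, i ≠ j → p i * p j = 0
  mul_left : ∀ i, A * p i = e i • p i
  mul_right : ∀ i, p i * A = e i • p i
  norm_le_one : ∀ i, ‖p i‖ ≤ 1
  trace_eq : ∀ i, LinearMap.trace ℂ X (p i : X →ₗ[ℂ] X) = 1
  norm_sum_le : ‖∑ i, p i‖ ≤ 1

theorem IsSimpleProj.mul_eq_zero {A E F : X →L[ℂ] X} {μ ν : ℂ} (hE : IsSimpleProj A μ E)
    (hF : IsSimpleProj A ν F) (h : μ ≠ ν) : E * F = 0 := by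
  have h1 : μ • (E * F) = ν • (E * F) := by
    rw [← smul_mul_assoc, ← hE.mul_right, mul_assoc, hF.mul_left, mul_smul_comm]
  have h2 : (μ - ν) • (E * F) = 0 := by rw [sub_smul, h1, sub_self]
  exact (smul_eq_zero.1 h2).resolve_left (sub_ne_zero.2 h)

section OrthogonalFamily

variable {ι : Type*} [Fintype ι] {p : ι → X →L[ℂ] X}

theorem mul_sum_of_orthogonal (h1 : ∀ i, p i * p i = p i)
    (h2 : ∀ i j, i ≠ j → p i * p j = 0) (i : ι) (c : ι → ℂ) :
    p i * ∑ j, c j • p j = c i • p i := by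
  classical
  rw [Finset.mul_sum, Finset.sum_eq_single i]
  · rw [mul_smul_comm, h1]
  · intro j _ hj
    rw [mul_smul_comm, h2 i j hj.symm, smul_zero]
  · simp

theorem sum_mul_of_orthogonal (h1 : ∀ i, p i * p i = p i)
    (h2 : ∀ i j, i ≠ j → p i * p j = 0) (i : ι) (c : ι → ℂ) :
    (∑ j, c j • p j) * p i = c i • p i := by
  classical
  rw [Finset.sum_mul, Finset.sum_eq_single i]
  · rw [smul_mul_assoc, h1]
  · intro j _ hj
    rw [smul_mul_assoc, h2 j i hj, smul_zero]
  · simp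

theorem sum_mul_sum_of_orthogonal (h1 : ∀ i, p i * p i = p i)
    (h2 : ∀ i j, i ≠ j → p i * p j = 0) (c d : ι → ℂ) :
    (∑ j, c j • p j) * ∑ j, d j • p j = ∑ j, (c j * d j) • p j := by
  rw [Finset.sum_mul]
  refine Finset.sum_congr rfl fun i _ => ?_
  rw [smul_mul_assoc, mul_sum_of_orthogonal h1 h2, smul_smul]

end OrthogonalFamily

/-- `P` is a limit point of the powers `A ^ n`. Along a suitable sequence all `e i ^ n` approach one
simultaneously, and the complementary part tends to zero. A sum of bounds for the single projectors
would only give their number. -/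
theorem norm_sum_proj_le_one {ι : Type*} [Fintype ι] {A : X →L[ℂ] X} {e : ι → ℂ}
    {p : ι → X →L[ℂ] X} (hA : ‖A‖ ≤ 1) (he : ∀ i, ‖e i‖ = 1) (h1 : ∀ i, p i * p i = p i)
    (h2 : ∀ i j, i ≠ j → p i * p j = 0) (h3 : ∀ i, A * p i = e i • p i)
    (h4 : ∀ i, p i * A = e i • p i) (h5 : ‖A * (1 - ∑ i, p i)‖ < 1) : ‖∑ i, p i‖ ≤ 1 := by
  set P := ∑ i, p i with hP
  have hPP : P * P = P := by
    simpa using sum_mul_sum_of_orthogonal h1 h2 (fun _ => 1) (fun _ => 1)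
  have hcomm : A * P = P * A := by
    rw [hP, Finset.mul_sum, Finset.sum_mul]
    exact Finset.sum_congr rfl fun i _ => by rw [h3, h4]
  have hpow : ∀ n : ℕ, A ^ n * P = ∑ i, (e i ^ n) • p i := by
    intro n
    induction n with
    | zero => simp [hP]
    | succ n ih =>
      rw [pow_succ', mul_assoc, ih, Finset.mul_sum]
      refine Finset.sum_congr rfl fun i _ => ?_
      rw [mul_smul_comm, h3, smul_smul, pow_succ]
  have hQ : (1 - P) * (1 - P) = 1 - P := by
    simp only [mul_sub, sub_mul, one_mul, mul_one, hPP]; abel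
  have hQc : (1 - P) * A = A * (1 - P) := by
    rw [sub_mul, mul_sub, one_mul, mul_one, hcomm]
  have hpowQ : ∀ n : ℕ, A ^ n * (1 - P) = (A * (1 - P)) ^ n * (1 - P) := by
    intro n
    induction n with
    | zero => simp
    | succ n ih =>
      have hc : Commute (1 - P) (A ^ n) := (show Commute (1 - P) A from hQc).pow_right n
      calc A ^ (n + 1) * (1 - P) = A * (A ^ n * ((1 - P) * (1 - P))) := by
            rw [hQ, pow_succ', mul_assoc]
        _ = A * (1 - P) * (A ^ n * (1 - P)) := by
            rw [← mul_assoc (A ^ n), mul_assoc A (1 - P), ← mul_assoc (1 - P) (A ^ n), hc.eq]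
        _ = (A * (1 - P)) ^ (n + 1) * (1 - P) := by rw [ih, pow_succ', mul_assoc, mul_assoc, mul_assoc]
  refine le_of_forall_pos_le_add fun δ hδ => ?_
  have hev : ∀ᶠ n : ℕ in atTop, ‖(A * (1 - P)) ^ n * (1 - P)‖ < δ / 2 := by
    have ht : Tendsto (fun n : ℕ => (A * (1 - P)) ^ n * (1 - P)) atTop (𝓝 (0 * (1 - P))) :=
      (tendsto_pow_atTop_nhds_zero_of_norm_lt_one h5).mul_const _
    rw [zero_mul] at ht
    have := ht.norm
    rw [norm_zero] at this
    exact this.eventually_lt_const (half_pos hδ)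
  -- In the compact group `ι → Circle`, the identity is a cluster point of the powers of any
  -- element.
  set u : ι → Circle := fun i => ⟨e i, mem_sphere_zero_iff_norm.2 (he i)⟩ with hu
  have hcl := mapClusterPt_one_atTop_pow u
  have hcont : Continuous fun x : ι → Circle => ‖∑ i, ((x i : ℂ) - 1) • p i‖ := by fun_prop
  have hnhds : {x : ι → Circle | ‖∑ i, ((x i : ℂ) - 1) • p i‖ < δ / 2} ∈ 𝓝 (1 : ι → Circle) := by
    refine (isOpen_lt hcont continuous_const).mem_nhds ?_
    simp [hδ]
  have hfreq : ∃ᶠ n : ℕ in atTop, ‖∑ i, (((u ^ n) i : ℂ) - 1) • p i‖ < δ / 2 :=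
    hcl.frequently hnhds
  obtain ⟨n, hn1, hn2⟩ := (hfreq.and_eventually hev).exists
  have hsplit : P = A ^ n - (A * (1 - P)) ^ n * (1 - P) - ∑ i, (((u ^ n) i : ℂ) - 1) • p i := by
    have e1 : ∑ i, (((u ^ n) i : ℂ) - 1) • p i = A ^ n * P - P := by
      rw [hpow]
      simp only [sub_smul, one_smul, Finset.sum_sub_distrib, ← hP]
      congr 1
    rw [e1, ← hpowQ, mul_sub, mul_one]; abel
  rw [hsplit]
  refine (norm_sub_le _ _).trans ?_
  refine (add_le_add ((norm_sub_le _ _).trans (add_le_add (norm_pow_le_one hA n) hn2.le))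
    hn1.le).trans ?_
  linarith

theorem peripheralProj_eq_sum {ι : Type*} [Fintype ι] (A : X →L[ℂ] X) {e : ι → ℂ}
    (hinj : Function.Injective e) (hr : range e = peripheralSpectrum A) :
    peripheralProj A = ∑ i, spectralProj A (e i) := by
  rw [peripheralProj, ← hr, finsum_mem_range hinj, finsum_eq_sum_of_fintype]

variable [FiniteDimensional ℂ X]

theorem isPeripheralFamily {ι : Type*} [Fintype ι] {A : X →L[ℂ] X} (hA : ‖A‖ ≤ 1)
    (hs : ∀ μ ∈ peripheralSpectrum A,
      Module.finrank ℂ (Module.End.maxGenEigenspace (A : X →ₗ[ℂ] X) μ) = 1)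
    (hQ : ‖A * stableProj A‖ < 1) {e : ι → ℂ} (hinj : Function.Injective e)
    (hr : range e = peripheralSpectrum A) :
    IsPeripheralFamily A e fun i => spectralProj A (e i) := by
  have hmem : ∀ i, e i ∈ peripheralSpectrum A := fun i => hr ▸ mem_range_self i
  have hnorm : ∀ i, ‖e i‖ = 1 := fun i => by simpa using (hmem i).2
  have hE : ∀ i, IsSimpleProj A (e i) (spectralProj A (e i)) := fun i => by
    obtain ⟨E, hE⟩ := exists_isSimpleProj A (e i) (hs _ (hmem i))
    rwa [hE.spectralProj_eq]
  have hne : ∀ i j, i ≠ j → spectralProj A (e i) * spectralProj A (e j) = 0 := fun i j hij =>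
    (hE i).mul_eq_zero (hE j) (hinj.ne hij)
  rw [stableProj, peripheralProj_eq_sum A hinj hr] at hQ
  exact
    { norm_eig := hnorm
      mul_self := fun i => (hE i).mul_self
      mul_of_ne := hne
      mul_left := fun i => (hE i).mul_left
      mul_right := fun i => (hE i).mul_right
      norm_le_one := fun i => (hE i).norm_le_one hA (hnorm i)
      trace_eq := fun i => (hE i).trace_eq
      norm_sum_le := norm_sum_proj_le_one hA hnorm (fun i => (hE i).mul_self) hne
        (fun i => (hE i).mul_left) (fun i => (hE i).mul_right) hQ }

end Adiabatic

/-! ### Continuous labelling of the peripheral spectrum. -/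

namespace Adiabatic

/-- The sets `S s`, `s ∈ [0,1]`, have uniformly separated points and depend on `s` in a uniformly
continuous way. -/
structure IsSeparatedFamily (S : ℝ → Set ℂ) (ε : ℝ) : Prop where
  pos : 0 < ε
  gap : ∀ s ∈ Icc (0 : ℝ) 1, ∀ z ∈ S s, ∀ w ∈ S s, z ≠ w → 2 * ε < ‖z - w‖
  unif : ∀ δ > 0, ∃ η > 0, ∀ s ∈ Icc (0 : ℝ) 1, ∀ t ∈ Icc (0 : ℝ) 1, |s - t| < η →
    ∀ z ∈ S s, ∃ w ∈ S t, ‖z - w‖ < δ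

namespace IsSeparatedFamily

variable {S : ℝ → Set ℂ} {ε : ℝ}

theorem eq_of_norm_le (h : IsSeparatedFamily S ε) {s : ℝ} (hs : s ∈ Icc (0 : ℝ) 1) {z w : ℂ}
    (hz : z ∈ S s) (hw : w ∈ S s) (hzw : ‖z - w‖ ≤ 2 * ε) : z = w := by
  by_contra hne
  exact absurd hzw (not_le.2 (h.gap s hs z hz w hw hne))

/-- Within `ε` of a given point there is at most one point of `S s`, by the gap, and at least one
when the parameter moves by less than `η`. The branch is continued over `n` intervals of length `1 /
n < η` and glued at the endpoints. -/
theorem exists_branch (h : IsSeparatedFamily S ε) {z₀ : ℂ} (hz₀ : z₀ ∈ S 0) :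
    ∃ f : ℝ → ℂ, ContinuousOn f (Icc 0 1) ∧ f 0 = z₀ ∧ ∀ s ∈ Icc (0 : ℝ) 1, f s ∈ S s := by
  obtain ⟨η, hη, hunif⟩ := h.unif ε h.pos
  obtain ⟨n, hn⟩ := exists_nat_gt (1 / η)
  have hn0 : (0 : ℝ) < n := (by positivity : 0 < 1 / η).trans hn
  have hnη : (1 : ℝ) / n < η := by
    rw [div_lt_iff₀ hη] at hn
    rw [div_lt_iff₀ hn0]; linarith
  have key : ∀ k : ℕ, k ≤ n → ∃ f : ℝ → ℂ, ContinuousOn f (Icc 0 (k / n : ℝ)) ∧ f 0 = z₀ ∧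
      ∀ s ∈ Icc (0 : ℝ) (k / n : ℝ), f s ∈ S s := by
    intro k
    induction k with
    | zero =>
      intro _
      refine ⟨fun _ => z₀, continuousOn_const, rfl, fun s hs => ?_⟩
      have : s = 0 := by simpa using hs
      rwa [this]
    | succ k ih =>
      intro hk
      obtain ⟨f, hfc, hf0, hfS⟩ := ih (by omega)
      set a : ℝ := k / n with ha
      set b : ℝ := ((k + 1 : ℕ) : ℝ) / n with hb
      have hba : b - a = 1 / n := by rw [ha, hb]; push_cast; ring
      have ha0 : 0 ≤ a := by positivity
      have hab : a ≤ b := by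
        have : (0 : ℝ) < 1 / n := by positivity
        linarith
      have hb1 : b ≤ 1 := by rw [hb, div_le_one hn0]; exact_mod_cast hk
      have haI : a ∈ Icc (0 : ℝ) 1 := ⟨ha0, hab.trans hb1⟩
      have hsub : ∀ s ∈ Icc a b, s ∈ Icc (0 : ℝ) 1 := fun s hs =>
        ⟨ha0.trans hs.1, hs.2.trans hb1⟩
      have hfa : f a ∈ S a := hfS a ⟨ha0, le_rfl⟩
      have hex : ∀ s ∈ Icc a b, ∃ w ∈ S s, ‖f a - w‖ < ε := fun s hs =>
        hunif a haI s (hsub s hs) (by rw [abs_lt]; constructor <;> linarith [hs.1, hs.2]) _ hfa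
      choose! g hgS hgε using hex
      have hga : g a = f a :=
        (h.eq_of_norm_le haI hfa (hgS a ⟨le_rfl, hab⟩)
          (by linarith [hgε a ⟨le_rfl, hab⟩, h.pos])).symm
      have hgc : ContinuousOn g (Icc a b) := by
        rw [Metric.continuousOn_iff]
        intro s hs δ hδ
        -- The second entry keeps the point `w` near `g s` within `ε` of `f a`, so that `w` and `g
        -- t` are closer than `2 * ε` and coincide.
        have hδ' : 0 < min δ (ε - ‖f a - g s‖) := lt_min hδ (by linarith [hgε s hs])
        obtain ⟨η', hη', hu⟩ := h.unif _ hδ'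
        refine ⟨η', hη', fun t ht hts => ?_⟩
        rw [dist_comm, Real.dist_eq] at hts
        obtain ⟨w, hw, hgw⟩ := hu s (hsub s hs) t (hsub t ht) hts _ (hgS s hs)
        have h1 : ‖f a - w‖ < ε := by
          have : ‖f a - w‖ ≤ ‖f a - g s‖ + ‖g s - w‖ := norm_sub_le_norm_sub_add_norm_sub _ _ _
          linarith [hgw.trans_le (min_le_right δ _)]
        have h2 : g t = w := by
          refine h.eq_of_norm_le (hsub t ht) (hgS t ht) hw ?_
          have : ‖g t - w‖ ≤ ‖g t - f a‖ + ‖f a - w‖ := norm_sub_le_norm_sub_add_norm_sub _ _ _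
          rw [norm_sub_rev (g t) (f a)] at this
          linarith [hgε t ht]
        rw [h2, dist_comm, dist_eq_norm]
        exact hgw.trans_le (min_le_left _ _)
      refine ⟨fun s => if s ≤ a then f s else g s, ?_, ?_, ?_⟩
      · rw [← Icc_union_Icc_eq_Icc ha0 hab]
        refine ContinuousOn.union_of_isClosed ?_ ?_ isClosed_Icc isClosed_Icc
        · exact hfc.congr fun s hs => if_pos hs.2
        · refine hgc.congr fun s hs => ?_
          by_cases hsa : s ≤ a
          · have : s = a := le_antisymm hsa hs.1
            rw [if_pos hsa, this, hga]
          · exact if_neg hsa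
      · simp only [if_pos ha0, hf0]
      · intro s hs
        by_cases hsa : s ≤ a
        · simp only [if_pos hsa]; exact hfS s ⟨hs.1, hsa⟩
        · simp only [if_neg hsa]; exact hgS s ⟨(not_le.1 hsa).le, hs.2⟩
  have := key n le_rfl
  rwa [div_self hn0.ne'] at this

/-- If two branches met, their distance would pass through the value `ε`, which the gap excludes. -/
theorem branch_ne (h : IsSeparatedFamily S ε) {f g : ℝ → ℂ} (hf : ContinuousOn f (Icc 0 1))
    (hg : ContinuousOn g (Icc 0 1)) (hfS : ∀ s ∈ Icc (0 : ℝ) 1, f s ∈ S s)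
    (hgS : ∀ s ∈ Icc (0 : ℝ) 1, g s ∈ S s) (h0 : f 0 ≠ g 0) {s : ℝ} (hs : s ∈ Icc (0 : ℝ) 1) :
    f s ≠ g s := by
  intro heq
  have hsub : Icc 0 s ⊆ Icc (0 : ℝ) 1 := Icc_subset_Icc le_rfl hs.2
  have hc : ContinuousOn (fun t => ‖f t - g t‖) (Icc 0 s) :=
    ((hf.mono hsub).sub (hg.mono hsub)).norm
  have h0I : (0 : ℝ) ∈ Icc (0 : ℝ) 1 := ⟨le_rfl, zero_le_one⟩
  have hgap := h.gap 0 h0I _ (hfS 0 h0I) _ (hgS 0 h0I) h0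
  have hpos := h.pos
  obtain ⟨t, ht, hte⟩ := intermediate_value_Icc' hs.1 hc
    (show ε ∈ Icc (‖f s - g s‖) (‖f 0 - g 0‖) by
      rw [heq, sub_self, norm_zero]; constructor <;> linarith)
  have hte' : ‖f t - g t‖ = ε := hte
  have := h.eq_of_norm_le (hsub ht) (hfS t (hsub ht)) (hgS t (hsub ht)) (by linarith)
  rw [this, sub_self, norm_zero] at hte'
  linarith

theorem exists_branches (h : IsSeparatedFamily S ε) :
    ∃ f : S 0 → ℝ → ℂ, (∀ z, ContinuousOn (f z) (Icc 0 1)) ∧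
      (∀ s ∈ Icc (0 : ℝ) 1, Function.Injective fun z => f z s) ∧
      ∀ z, ∀ s ∈ Icc (0 : ℝ) 1, f z s ∈ S s := by
  choose f hfc hf0 hfS using fun z : S 0 => h.exists_branch z.2
  refine ⟨f, hfc, fun s hs z w hzw => ?_, hfS⟩
  by_contra hne
  refine h.branch_ne (hfc z) (hfc w) (hfS z) (hfS w) ?_ hs hzw
  rw [hf0, hf0]
  exact fun h => hne (Subtype.ext h)

/-- Reparametrising the segment from `a` to `b`, in either order, reduces comparisons between
arbitrary parameters to `0` and `1`. -/
theorem comp_affine (h : IsSeparatedFamily S ε) {a b : ℝ} (ha : a ∈ Icc (0 : ℝ) 1)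
    (hb : b ∈ Icc (0 : ℝ) 1) : IsSeparatedFamily (fun u => S (a + u * (b - a))) ε := by
  have hmem : ∀ u ∈ Icc (0 : ℝ) 1, a + u * (b - a) ∈ Icc (0 : ℝ) 1 := fun u hu => by
    constructor
    · nlinarith [mul_nonneg hu.1 hb.1, mul_nonneg (sub_nonneg.2 hu.2) ha.1]
    · nlinarith [mul_nonneg hu.1 (sub_nonneg.2 hb.2),
        mul_nonneg (sub_nonneg.2 hu.2) (sub_nonneg.2 ha.2)]
  refine ⟨h.pos, fun s hs => h.gap _ (hmem s hs), fun δ hδ => ?_⟩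
  obtain ⟨η, hη, hu⟩ := h.unif δ hδ
  refine ⟨η, hη, fun s hs t ht hst => hu _ (hmem s hs) _ (hmem t ht) (lt_of_le_of_lt ?_ hst)⟩
  have : a + s * (b - a) - (a + t * (b - a)) = (s - t) * (b - a) := by ring
  rw [this, abs_mul]
  refine mul_le_of_le_one_right (abs_nonneg _) (abs_le.2 ⟨?_, ?_⟩) <;>
    linarith [ha.1, ha.2, hb.1, hb.2]

theorem ncard_zero_le_ncard_one (h : IsSeparatedFamily S ε) (hfin : (S 1).Finite) :
    (S 0).ncard ≤ (S 1).ncard := by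
  obtain ⟨f, -, hinj, hmem⟩ := h.exists_branches
  have h1 : (1 : ℝ) ∈ Icc (0 : ℝ) 1 := ⟨zero_le_one, le_rfl⟩
  have : Finite (S 1) := hfin
  exact Nat.card_le_card_of_injective (fun z => (⟨f z 1, hmem z 1 h1⟩ : S 1)) fun z w hzw =>
    hinj 1 h1 (congrArg Subtype.val hzw)

theorem ncard_le (h : IsSeparatedFamily S ε) {a b : ℝ} (ha : a ∈ Icc (0 : ℝ) 1)
    (hb : b ∈ Icc (0 : ℝ) 1) (hfin : (S b).Finite) : (S a).ncard ≤ (S b).ncard := by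
  simpa using (h.comp_affine ha hb).ncard_zero_le_ncard_one (by simpa using hfin)

/-- Branches from the points of `S 0` stay distinct; they exhaust `S s` because transporting back
from `s` to `0` bounds its cardinality. -/
theorem exists_labelling (h : IsSeparatedFamily S ε)
    (hfin : ∀ s ∈ Icc (0 : ℝ) 1, (S s).Finite) {N : ℕ} (hN : (S 0).ncard = N) :
    ∃ e : Fin N → ℝ → ℂ, (∀ j, ContinuousOn (e j) (Icc 0 1)) ∧
      (∀ s ∈ Icc (0 : ℝ) 1, Function.Injective fun j => e j s) ∧
      ∀ s ∈ Icc (0 : ℝ) 1, range (fun j => e j s) = S s := by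
  obtain ⟨f, hc, hinj, hmem⟩ := h.exists_branches
  have h0 : (0 : ℝ) ∈ Icc (0 : ℝ) 1 := ⟨le_rfl, zero_le_one⟩
  have : Finite (S 0) := hfin 0 h0
  let φ : S 0 ≃ Fin N := Finite.equivFinOfCardEq hN
  have hinj' : ∀ s ∈ Icc (0 : ℝ) 1, Function.Injective fun j => f (φ.symm j) s := fun s hs =>
    (hinj s hs).comp φ.symm.injective
  refine ⟨fun j => f (φ.symm j), fun j => hc _, hinj', fun s hs => ?_⟩
  refine eq_of_subset_of_ncard_le ?_ ?_ (hfin s hs)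
  · rintro _ ⟨j, rfl⟩
    exact hmem _ s hs
  · have : (range fun j => f (φ.symm j) s).ncard = N := by
      rw [← image_univ, ncard_image_of_injective _ (hinj' s hs), ncard_univ, Nat.card_fin]
    rw [this, ← hN]
    exact h.ncard_le hs h0 (hfin 0 h0)

end IsSeparatedFamily

variable {X : Type*} [NormedAddCommGroup X] [NormedSpace ℂ X]

theorem Hypotheses.norm_mul_stableProj_le {L : ℝ → X →L[ℂ] X} {ε ℓ : ℝ} (h : Hypotheses L ε ℓ)
    {s : ℝ} (hs : s ∈ Icc (0 : ℝ) 1) : ‖L s * stableProj (L s)‖ ≤ ℓ :=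
  h.isLUB.1 ⟨s, hs, rfl⟩

/-- The trace as a continuous linear functional on the bounded operators. -/
noncomputable def traceCLM (X : Type*) [NormedAddCommGroup X] [NormedSpace ℂ X]
    [FiniteDimensional ℂ X] : (X →L[ℂ] X) →L[ℂ] ℂ :=
  LinearMap.toContinuousLinearMap
    ((LinearMap.trace ℂ X).comp (ContinuousLinearMap.coeLM ℂ : (X →L[ℂ] X) →ₗ[ℂ] X →ₗ[ℂ] X))

theorem traceCLM_apply [FiniteDimensional ℂ X] (A : X →L[ℂ] X) :
    traceCLM X A = LinearMap.trace ℂ X (A : X →ₗ[ℂ] X) := rfl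

namespace IsPeripheralFamily

variable {ι κ : Type*} [Fintype ι] [Fintype κ] {A B : X →L[ℂ] X} {e : ι → ℂ} {w : κ → ℂ}
  {p : ι → X →L[ℂ] X} {q : κ → X →L[ℂ] X}

theorem ne_zero (h : IsPeripheralFamily A e p) (i : ι) : p i ≠ 0 := by
  intro h0
  have := h.trace_eq i
  rw [h0] at this
  simp at this

theorem mul_sum_eq (h : IsPeripheralFamily A e p) : A * ∑ i, p i = ∑ i, e i • p i := by
  rw [Finset.mul_sum]
  exact Finset.sum_congr rfl fun i _ => h.mul_left i

variable [FiniteDimensional ℂ X]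

/-- The trace of `∑ i, p i` is the number of its rank-one terms, and that sum has norm at most one.
-/
theorem card_le (h : IsPeripheralFamily A e p) : (Fintype.card ι : ℝ) ≤ ‖traceCLM X‖ := by
  have h1 : traceCLM X (∑ i, p i) = Fintype.card ι := by
    rw [map_sum]
    simp [traceCLM_apply, h.trace_eq]
  have h2 := (traceCLM X).le_opNorm (∑ i, p i)
  rw [h1] at h2
  simp only [Complex.norm_natCast] at h2
  exact h2.trans (mul_le_of_le_one_right (norm_nonneg _) h.norm_sum_le)

/-- An eigenvalue of `A P` far from the spectrum of `B Q` forces the two operators apart: with `R`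
the resolvent of `B Q` at `e i`, one has `p i = R (A P - B Q) p i` and `p i ≠ 0`. -/
theorem one_le_of_forall_le (hA : IsPeripheralFamily A e p) (hB : IsPeripheralFamily B w q) (i : ι)
    {δ : ℝ} (hδ : 0 < δ) (h : ∀ j, δ ≤ ‖e i - w j‖) :
    1 ≤ (‖traceCLM X‖ / δ + 2) * ‖A * ∑ i, p i - B * ∑ j, q j‖ := by
  set z := e i with hz
  have hz0 : z ≠ 0 := norm_ne_zero_iff.1 (by rw [hz, hA.norm_eig]; exact one_ne_zero)
  have hne : ∀ j, z - w j ≠ 0 := fun j h0 => by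
    have := h j
    rw [h0, norm_zero] at this
    linarith
  set Q := ∑ j, q j with hQ
  -- The resolvent of `B Q` at `z`, written spectrally; on the kernel of `Q` the operator `B Q` is
  -- zero, whence `z⁻¹`.
  set R := ∑ j, (z - w j)⁻¹ • q j + z⁻¹ • (1 - Q) with hR
  have hQQ : Q * Q = Q := by
    simpa using sum_mul_sum_of_orthogonal hB.mul_self hB.mul_of_ne (fun _ => 1) (fun _ => 1)
  have hRinv : R * (z • 1 - B * Q) = 1 := by
    have e1 : (z • 1 - B * Q : X →L[ℂ] X) = ∑ j, (z - w j) • q j + z • (1 - Q) := by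
      rw [hQ, hB.mul_sum_eq]
      simp only [sub_smul, Finset.sum_sub_distrib, smul_sub, Finset.smul_sum]
      abel
    have e2 : (∑ j, (z - w j)⁻¹ • q j) * ∑ j, (z - w j) • q j = Q := by
      rw [sum_mul_sum_of_orthogonal hB.mul_self hB.mul_of_ne]
      exact Finset.sum_congr rfl fun j _ => by rw [inv_mul_cancel₀ (hne j), one_smul]
    have e3 : ∀ c : κ → ℂ, (∑ j, c j • q j) * (1 - Q) = 0 := fun c => by
      have := sum_mul_sum_of_orthogonal hB.mul_self hB.mul_of_ne c (fun _ => 1)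
      simp only [one_smul, mul_one] at this
      rw [mul_sub, mul_one, hQ, this, sub_self]
    have e4 : ∀ c : κ → ℂ, (1 - Q) * (∑ j, c j • q j) = 0 := fun c => by
      have := sum_mul_sum_of_orthogonal hB.mul_self hB.mul_of_ne (fun _ => 1) c
      simp only [one_smul, one_mul] at this
      rw [sub_mul, one_mul, hQ, this, sub_self]
    have e5 : (1 - Q) * (1 - Q) = 1 - Q := by
      simp only [mul_sub, sub_mul, one_mul, mul_one, hQQ]; abel
    rw [e1, hR, add_mul, mul_add, mul_add, e2, mul_smul_comm, e3, smul_mul_assoc, e4,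
      smul_mul_smul_comm, e5, inv_mul_cancel₀ hz0]
    simp
  have hRn : ‖R‖ ≤ ‖traceCLM X‖ / δ + 2 := by
    refine (norm_add_le _ _).trans (add_le_add ?_ ?_)
    · refine (_root_.norm_sum_le _ _).trans ?_
      have : ∀ j ∈ Finset.univ, ‖(z - w j)⁻¹ • q j‖ ≤ δ⁻¹ := fun j _ => by
        rw [norm_smul, norm_inv]
        calc ‖z - w j‖⁻¹ * ‖q j‖ ≤ δ⁻¹ * 1 := by
              gcongr
              · exact h j
              · exact hB.norm_le_one j
          _ = δ⁻¹ := mul_one _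
      refine (Finset.sum_le_card_nsmul _ _ _ this).trans ?_
      rw [nsmul_eq_mul, Finset.card_univ, div_eq_mul_inv]
      gcongr
      exact hB.card_le
    · rw [norm_smul, norm_inv, hz, hA.norm_eig, inv_one, one_mul]
      refine (norm_sub_le _ _).trans ?_
      linarith [norm_one_le (X := X), hB.norm_sum_le]
  have hp : p i = R * (A * ∑ i, p i - B * Q) * p i := by
    have e1 : (A * ∑ i, p i) * p i = z • p i := by
      rw [hA.mul_sum_eq, sum_mul_of_orthogonal hA.mul_self hA.mul_of_ne]
    have e2 : (A * ∑ i, p i - B * Q) * p i = (z • 1 - B * Q) * p i := by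
      rw [sub_mul, e1, sub_mul, smul_mul_assoc, one_mul]
    rw [mul_assoc, e2, ← mul_assoc, hRinv, one_mul]
  have hpos : 0 < ‖p i‖ := norm_pos_iff.2 (hA.ne_zero i)
  have hle : 1 * ‖p i‖ ≤ ((‖traceCLM X‖ / δ + 2) * ‖A * ∑ i, p i - B * Q‖) * ‖p i‖ := by
    rw [one_mul]
    calc ‖p i‖ = ‖R * (A * ∑ i, p i - B * Q) * p i‖ := by rw [← hp]
      _ ≤ ‖R‖ * ‖A * ∑ i, p i - B * Q‖ * ‖p i‖ := norm_mul₃_le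
      _ ≤ _ := by gcongr
  exact le_of_mul_le_mul_right hle hpos

end IsPeripheralFamily

variable [FiniteDimensional ℂ X]

theorem Hypotheses.isPeripheralFamily {L : ℝ → X →L[ℂ] X} {ε ℓ : ℝ} (h : Hypotheses L ε ℓ)
    {s : ℝ} (hs : s ∈ Icc (0 : ℝ) 1) {ι : Type*} [Fintype ι] {e : ι → ℂ}
    (hinj : Function.Injective e) (hr : range e = peripheralSpectrum (L s)) :
    IsPeripheralFamily (L s) e fun i => spectralProj (L s) (e i) :=
  Adiabatic.isPeripheralFamily (h.contraction s hs) (h.simple s hs)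
    ((h.norm_mul_stableProj_le hs).trans_lt h.lt_one) hinj hr

theorem peripheralSpectrum_finite (A : X →L[ℂ] X) : (peripheralSpectrum A).Finite :=
  (spectrum_finite A).subset inter_subset_left

/-- Only `L P` is assumed continuous, so the comparison is between peripheral parts. Compactness of
`[0,1]` makes the modulus uniform. -/
theorem Hypotheses.isSeparatedFamily {L : ℝ → X →L[ℂ] X} {ε ℓ : ℝ} (h : Hypotheses L ε ℓ) :
    IsSeparatedFamily (fun s => peripheralSpectrum (L s)) ε := by
  refine ⟨h.gap_pos, h.gap, fun δ hδ => ?_⟩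
  have hK : 0 < ‖traceCLM X‖ / δ + 2 := by positivity
  have hu := isCompact_Icc.uniformContinuousOn_of_continuous h.contDiffOn.continuousOn
  rw [Metric.uniformContinuousOn_iff] at hu
  obtain ⟨η, hη, hu⟩ := hu (‖traceCLM X‖ / δ + 2)⁻¹ (inv_pos.2 hK)
  refine ⟨η, hη, fun s hs t ht hst z hz => ?_⟩
  by_contra! hne
  have := (peripheralSpectrum_finite (L s)).fintype
  have := (peripheralSpectrum_finite (L t)).fintype
  have hrange : ∀ r, range (Subtype.val : peripheralSpectrum (L r) → ℂ) =
      peripheralSpectrum (L r) := fun r => Subtype.range_coe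
  have h1 := (h.isPeripheralFamily hs Subtype.val_injective (hrange s)).one_le_of_forall_le
    (h.isPeripheralFamily ht Subtype.val_injective (hrange t)) ⟨z, hz⟩ hδ fun j => hne j j.2
  rw [← peripheralProj_eq_sum _ Subtype.val_injective (hrange s),
    ← peripheralProj_eq_sum _ Subtype.val_injective (hrange t)] at h1
  have hd := hu s hs t ht hst
  rw [dist_eq_norm, ← one_div, lt_div_iff₀' hK] at hd
  linarith

theorem Hypotheses.ncard_eq_maxCount {L : ℝ → X →L[ℂ] X} {ε ℓ : ℝ} (h : Hypotheses L ε ℓ)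
    {s : ℝ} (hs : s ∈ Icc (0 : ℝ) 1) : (peripheralSpectrum (L s)).ncard = maxCount L := by
  have hc : ∀ t : Icc (0 : ℝ) 1, (peripheralSpectrum (L t)).ncard =
      (peripheralSpectrum (L s)).ncard := fun t =>
    le_antisymm (h.isSeparatedFamily.ncard_le t.2 hs (peripheralSpectrum_finite _))
      (h.isSeparatedFamily.ncard_le hs t.2 (peripheralSpectrum_finite _))
  have : Nonempty (Icc (0 : ℝ) 1) := ⟨⟨s, hs⟩⟩
  rw [maxCount]
  simp only [hc, ciSup_const]

theorem Hypotheses.exists_isLabelling {L : ℝ → X →L[ℂ] X} {ε ℓ : ℝ} (h : Hypotheses L ε ℓ) :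
    ∃ e : Fin (maxCount L) → ℝ → ℂ, IsLabelling L e := by
  obtain ⟨e, h1, h2, h3⟩ := h.isSeparatedFamily.exists_labelling
    (fun s _ => peripheralSpectrum_finite (L s)) (h.ncard_eq_maxCount ⟨le_rfl, zero_le_one⟩)
  exact ⟨e, h1, h2, h3⟩

end Adiabatic

/-! ### Regularity of eigenvalues and projectors; derivative estimates. -/

namespace Adiabatic

theorem contDiffOn_list_prod {ι R : Type*} [NormedRing R] [NormedAlgebra ℝ R] {n : WithTop ℕ∞}
    {f : ι → ℝ → R} {u : Set ℝ} (l : List ι) (hf : ∀ i ∈ l, ContDiffOn ℝ n (f i) u) :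
    ContDiffOn ℝ n (fun x => (l.map fun i => f i x).prod) u := by
  induction l with
  | nil => simpa using contDiffOn_const
  | cons a l ih =>
    simp only [List.map_cons, List.prod_cons]
    exact (hf a (by simp)).mul (ih fun i hi => hf i (by simp [hi]))

theorem uniqueDiffOn_unitInterval : UniqueDiffOn ℝ (Icc (0 : ℝ) 1) :=
  uniqueDiffOn_Icc zero_lt_one

variable {X : Type*} [NormedAddCommGroup X] [NormedSpace ℂ X]

/-- Lagrange interpolation recovers the projectors `p i` from `∑ i, e i • p i`. -/
theorem IsPeripheralFamily.eq_smul_list_prod {ι : Type*} [Fintype ι] [DecidableEq ι]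
    {A : X →L[ℂ] X} {e : ι → ℂ} {p : ι → X →L[ℂ] X} (h : IsPeripheralFamily A e p)
    (hinj : Function.Injective e) (j : ι) :
    p j = (e j)⁻¹ • ((((Finset.univ.erase j).toList.map fun i =>
      (e j - e i)⁻¹ • ((∑ k, e k • p k) - e i • 1)).prod) * ∑ k, e k • p k) := by
  -- The trailing factor `∑ k, e k • p k` annihilates the complement of the ranges of the `p k`,
  -- where the Lagrange product alone need not vanish; the prefactor `(e j)⁻¹` compensates for it.
  have key : ∀ l : List ι, (l.map fun i => (e j - e i)⁻¹ • ((∑ k, e k • p k) - e i • 1)).prod *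
      ∑ k, e k • p k =
      ∑ k, ((l.map fun i => (e j - e i)⁻¹ * (e k - e i)).prod * e k) • p k := by
    intro l
    induction l with
    | nil => simp
    | cons a l ih =>
      simp only [List.map_cons, List.prod_cons]
      rw [mul_assoc, ih, smul_mul_assoc, sub_mul, smul_mul_assoc, one_mul,
        sum_mul_sum_of_orthogonal h.mul_self h.mul_of_ne, Finset.smul_sum,
        ← Finset.sum_sub_distrib, Finset.smul_sum]
      refine Finset.sum_congr rfl fun k _ => ?_
      rw [smul_smul, ← sub_smul, smul_smul]
      congr 1
      ring
  have hj : e j ≠ 0 := norm_ne_zero_iff.1 (by rw [h.norm_eig]; exact one_ne_zero)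
  rw [key, Finset.sum_eq_single j, smul_smul]
  · have : ((Finset.univ.erase j).toList.map fun i => (e j - e i)⁻¹ * (e j - e i)).prod = 1 := by
      refine List.prod_eq_one fun x hx => ?_
      obtain ⟨i, hi, rfl⟩ := List.mem_map.1 hx
      rw [Finset.mem_toList, Finset.mem_erase] at hi
      exact inv_mul_cancel₀ (sub_ne_zero.2 (hinj.ne hi.1.symm))
    rw [this, one_mul, inv_mul_cancel₀ hj, one_smul]
  · intro k _ hk
    have : ((Finset.univ.erase j).toList.map fun i => (e j - e i)⁻¹ * (e k - e i)).prod = 0 := by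
      refine List.prod_eq_zero (List.mem_map.2 ⟨k, ?_, ?_⟩)
      · simp [hk]
      · simp
    rw [this, zero_mul, zero_smul]
  · simp

variable {L : ℝ → X →L[ℂ] X} {ε ℓ : ℝ} {N : ℕ} {e : Fin N → ℝ → ℂ}

theorem IsLabelling.peripheralProj_eq (he : IsLabelling L e) {s : ℝ} (hs : s ∈ Icc (0 : ℝ) 1) :
    peripheralProj (L s) = ∑ j, eigProj L e j s :=
  peripheralProj_eq_sum _ (he.injective s hs) (he.range_eq s hs)

variable [FiniteDimensional ℂ X]

theorem Hypotheses.family (h : Hypotheses L ε ℓ) (he : IsLabelling L e) {s : ℝ}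
    (hs : s ∈ Icc (0 : ℝ) 1) :
    IsPeripheralFamily (L s) (fun j => e j s) fun j => eigProj L e j s :=
  h.isPeripheralFamily hs (he.injective s hs) (he.range_eq s hs)

theorem Hypotheses.mul_peripheralProj_eq (h : Hypotheses L ε ℓ) (he : IsLabelling L e) {s : ℝ}
    (hs : s ∈ Icc (0 : ℝ) 1) :
    L s * peripheralProj (L s) = ∑ j, e j s • eigProj L e j s := by
  rw [he.peripheralProj_eq hs, (h.family he hs).mul_sum_eq]

theorem Hypotheses.contDiffOn_eigProj (h : Hypotheses L ε ℓ) (he : IsLabelling L e)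
    {n : WithTop ℕ∞} (hn : n ≤ 2) (hc : ∀ j, ContDiffOn ℝ n (e j) (Icc 0 1)) (j : Fin N) :
    ContDiffOn ℝ n (eigProj L e j) (Icc 0 1) := by
  have hM : ContDiffOn ℝ n (fun s => L s * peripheralProj (L s)) (Icc 0 1) :=
    h.contDiffOn.of_le hn
  have heq : ∀ s ∈ Icc (0 : ℝ) 1, eigProj L e j s =
      (e j s)⁻¹ • ((((Finset.univ.erase j).toList.map fun i =>
        (e j s - e i s)⁻¹ • ((L s * peripheralProj (L s)) - e i s • 1)).prod) *
          (L s * peripheralProj (L s))) := fun s hs => by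
    rw [h.mul_peripheralProj_eq he hs]
    exact (h.family he hs).eq_smul_list_prod (he.injective s hs) j
  have hne : ∀ s ∈ Icc (0 : ℝ) 1, e j s ≠ 0 := fun s hs =>
    norm_ne_zero_iff.1 (by rw [(h.family he hs).norm_eig j]; exact one_ne_zero)
  refine ContDiffOn.congr ?_ heq
  refine ((hc j).fun_inv hne).fun_smul (ContDiffOn.mul (contDiffOn_list_prod _ fun i hi => ?_) hM)
  rw [Finset.mem_toList, Finset.mem_erase] at hi
  refine (((hc j).sub (hc i)).fun_inv fun s hs => ?_).fun_smul
    (hM.sub ((hc i).fun_smul contDiffOn_const))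
  exact sub_ne_zero.2 ((he.injective s hs).ne hi.1.symm)

/-- For `M = L P`, sandwiching the increment gives `p s (M t - M s) p t = (e t - e s) p s p t`.
Taking traces and dividing by `tr (p s p t)`, which tends to `tr (p s) = 1`, requires only
continuity of `p`. -/
theorem Hypotheses.hasDerivWithinAt_eig (h : Hypotheses L ε ℓ) (he : IsLabelling L e) (j : Fin N)
    {s : ℝ} (hs : s ∈ Icc (0 : ℝ) 1) :
    HasDerivWithinAt (e j) (traceCLM X (eigProj L e j s *
      derivWithin (fun s => L s * peripheralProj (L s)) (Icc 0 1) s * eigProj L e j s))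
      (Icc 0 1) s := by
  set M := fun s => L s * peripheralProj (L s) with hM
  set p := eigProj L e j with hp
  have hpc : ContinuousOn p (Icc 0 1) := by
    rw [← contDiffOn_zero (𝕜 := ℝ)]
    exact h.contDiffOn_eigProj he zero_le (fun j => contDiffOn_zero.2 (he.continuousOn j)) j
  have hMd : HasDerivWithinAt M (derivWithin M (Icc 0 1) s) (Icc 0 1) s :=
    (h.contDiffOn.differentiableOn (by norm_num) s hs).hasDerivWithinAt
  rw [hasDerivWithinAt_iff_tendsto_slope] at hMd ⊢
  have hpt : Tendsto p (𝓝[Icc 0 1 \ {s}] s) (𝓝 (p s)) :=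
    (hpc s hs).mono_left (nhdsWithin_mono _ sdiff_subset)
  have hτ : Tendsto (fun t => traceCLM X (p s * p t)) (𝓝[Icc 0 1 \ {s}] s) (𝓝 1) := by
    have h1 : traceCLM X (p s * p s) = 1 := by
      rw [(h.family he hs).mul_self j]
      exact (h.family he hs).trace_eq j
    rw [← h1]
    exact ((traceCLM X).continuous.tendsto _).comp (hpt.const_mul _)
  have hnum : Tendsto (fun t => (traceCLM X (p s * p t))⁻¹ *
      traceCLM X (p s * slope M s t * p t)) (𝓝[Icc 0 1 \ {s}] s)
      (𝓝 (1⁻¹ * traceCLM X (p s * derivWithin M (Icc 0 1) s * p s))) :=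
    (hτ.inv₀ one_ne_zero).mul
      (((traceCLM X).continuous.tendsto _).comp ((hMd.const_mul _).mul hpt))
  rw [inv_one, one_mul] at hnum
  refine hnum.congr' ?_
  filter_upwards [hτ.eventually_ne one_ne_zero, self_mem_nhdsWithin] with t ht htI
  have hMs : p s * M s = e j s • p s := by
    simp only [hM]
    rw [h.mul_peripheralProj_eq he hs]
    exact mul_sum_of_orthogonal (h.family he hs).mul_self (h.family he hs).mul_of_ne j
      (fun i => e i s)
  have hMt : M t * p t = e j t • p t := by
    simp only [hM]
    rw [h.mul_peripheralProj_eq he htI.1]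
    exact sum_mul_of_orthogonal (h.family he htI.1).mul_self (h.family he htI.1).mul_of_ne j
      (fun i => e i t)
  have e1 : p s * (M t - M s) * p t = (e j t - e j s) • (p s * p t) := by
    rw [mul_sub, sub_mul, mul_assoc, hMt, hMs, mul_smul_comm, smul_mul_assoc, sub_smul]
  have e2 : p s * slope M s t * p t = (((t - s)⁻¹ : ℝ) : ℂ) • ((e j t - e j s) • (p s * p t)) := by
    rw [slope_def_module, ← e1, ← Complex.coe_smul, mul_smul_comm, smul_mul_assoc]
  rw [e2, map_smul, map_smul, slope_def_module, ← Complex.coe_smul]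
  simp only [smul_eq_mul]
  field_simp

/-- Bootstrap: `C^n` eigenvalues give `C^n` projectors, hence `(e j)' = tr (p M' p)` is `C^n`. -/
theorem Hypotheses.contDiffOn_eig_succ (h : Hypotheses L ε ℓ) (he : IsLabelling L e) {n : ℕ}
    (hn : n + 1 ≤ 2) (hc : ∀ j, ContDiffOn ℝ n (e j) (Icc 0 1)) (j : Fin N) :
    ContDiffOn ℝ (n + 1 : ℕ) (e j) (Icc 0 1) := by
  have hn' : ((n : ℕ) : WithTop ℕ∞) + 1 ≤ 2 := by exact_mod_cast hn
  have hp := h.contDiffOn_eigProj he (le_self_add.trans hn') hc j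
  have hM := h.contDiffOn.derivWithin uniqueDiffOn_unitInterval hn'
  rw [Nat.cast_add, Nat.cast_one, contDiffOn_succ_iff_derivWithin uniqueDiffOn_unitInterval]
  refine ⟨fun s hs => (h.hasDerivWithinAt_eig he j hs).differentiableWithinAt,
    fun h => absurd h (by simp), ?_⟩
  refine ContDiffOn.congr ?_ fun s hs =>
    (h.hasDerivWithinAt_eig he j hs).derivWithin (uniqueDiffOn_unitInterval s hs)
  exact ((traceCLM X).restrictScalars ℝ).contDiff.comp_contDiffOn ((hp.mul hM).mul hp)

theorem Hypotheses.contDiffOn_eig (h : Hypotheses L ε ℓ) (he : IsLabelling L e) (j : Fin N) :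
    ContDiffOn ℝ 2 (e j) (Icc 0 1) := by
  have h0 : ∀ j, ContDiffOn ℝ (0 : ℕ) (e j) (Icc 0 1) := fun j => by
    simpa using contDiffOn_zero (𝕜 := ℝ).2 (he.continuousOn j)
  exact_mod_cast h.contDiffOn_eig_succ he le_rfl (h.contDiffOn_eig_succ he one_le_two h0) j

theorem exists_bound_iteratedDerivWithin {F ι : Type*} [NormedAddCommGroup F] [NormedSpace ℝ F]
    [Finite ι] {f : ι → ℝ → F} (hf : ∀ i, ContDiffOn ℝ 2 (f i) (Icc 0 1)) :
    ∃ c : ℝ, ∀ s ∈ Icc (0 : ℝ) 1, ∀ i, ∀ α ∈ Icc 1 2,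
      ‖iteratedDerivWithin α (f i) (Icc 0 1) s‖ ≤ c := by
  have hb : ∀ x : ι × Icc 1 2, ∃ c : ℝ, ∀ s ∈ Icc (0 : ℝ) 1,
      ‖iteratedDerivWithin x.2 (f x.1) (Icc 0 1) s‖ ≤ c := fun x =>
    isCompact_Icc.exists_bound_of_continuousOn ((hf x.1).continuousOn_iteratedDerivWithin
      (by exact_mod_cast x.2.2.2) uniqueDiffOn_unitInterval)
  choose c hc using hb
  obtain ⟨C, hC⟩ := (finite_range c).bddAbove
  exact ⟨C, fun s hs i α hα => (hc (i, ⟨α, hα⟩) s hs).trans (hC ⟨_, rfl⟩)⟩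

theorem Hypotheses.exists_derivBound (h : Hypotheses L ε ℓ) (he : IsLabelling L e) :
    ∃ c, 0 ≤ c ∧ DerivBound L e c := by
  obtain ⟨a, ha⟩ := exists_bound_iteratedDerivWithin
    fun j => h.contDiffOn_eigProj he le_rfl (h.contDiffOn_eig he) j
  obtain ⟨b, hb⟩ := exists_bound_iteratedDerivWithin fun j => h.contDiffOn_eig he j
  refine ⟨max 0 (max a b), le_max_left _ _, fun s hs j α hα => ⟨?_, ?_⟩⟩
  · exact (ha s hs j α hα).trans ((le_max_left _ _).trans (le_max_right _ _))
  · exact (hb s hs j α hα).trans ((le_max_right _ _).trans (le_max_right _ _))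

section Lipschitz

variable {F : Type*} [NormedAddCommGroup F] [NormedSpace ℝ F] {f : ℝ → F} {c : ℝ}

theorem norm_sub_le_of_iteratedDerivWithin (hf : ContDiffOn ℝ 2 f (Icc 0 1))
    (hb : ∀ s ∈ Icc (0 : ℝ) 1, ‖iteratedDerivWithin 1 f (Icc 0 1) s‖ ≤ c) {s t : ℝ}
    (hs : s ∈ Icc (0 : ℝ) 1) (ht : t ∈ Icc (0 : ℝ) 1) : ‖f t - f s‖ ≤ c * |t - s| := by
  refine Convex.norm_image_sub_le_of_norm_derivWithin_le (𝕜 := ℝ)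
    (hf.differentiableOn (by norm_num)) (fun x hx => ?_) (convex_Icc 0 1) hs ht
  simpa [iteratedDerivWithin_one] using hb x hx

theorem norm_derivWithin_sub_le_of_iteratedDerivWithin (hf : ContDiffOn ℝ 2 f (Icc 0 1))
    (hb : ∀ s ∈ Icc (0 : ℝ) 1, ‖iteratedDerivWithin 2 f (Icc 0 1) s‖ ≤ c) {s t : ℝ}
    (hs : s ∈ Icc (0 : ℝ) 1) (ht : t ∈ Icc (0 : ℝ) 1) :
    ‖derivWithin f (Icc 0 1) t - derivWithin f (Icc 0 1) s‖ ≤ c * |t - s| := by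
  have hd : ContDiffOn ℝ 1 (derivWithin f (Icc 0 1)) (Icc 0 1) :=
    hf.derivWithin uniqueDiffOn_unitInterval (by norm_num [one_add_one_eq_two])
  refine Convex.norm_image_sub_le_of_norm_derivWithin_le (𝕜 := ℝ)
    (hd.differentiableOn (by norm_num)) (fun x hx => ?_) (convex_Icc 0 1) hs ht
  have := hb x hx
  rw [iteratedDerivWithin_succ] at this
  rwa [iteratedDerivWithin_one] at this

/-- The expansion is based at the right endpoint `t`, where the corrector of the new step is
evaluated. The mean value inequality gives `c` instead of the optimal `c / 2`, which suffices. -/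
theorem norm_sub_sub_smul_derivWithin_le (hc : 0 ≤ c) (hf : ContDiffOn ℝ 2 f (Icc 0 1))
    (hb : ∀ s ∈ Icc (0 : ℝ) 1, ‖iteratedDerivWithin 2 f (Icc 0 1) s‖ ≤ c) {s t : ℝ}
    (hs : s ∈ Icc (0 : ℝ) 1) (ht : t ∈ Icc (0 : ℝ) 1) (hst : s ≤ t) :
    ‖f t - f s - (t - s) • derivWithin f (Icc 0 1) t‖ ≤ c * (t - s) ^ 2 := by
  set D := derivWithin f (Icc 0 1) with hD
  have hsub : Icc s t ⊆ Icc 0 1 := Icc_subset_Icc hs.1 ht.2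
  have hder : ∀ u ∈ Icc s t, HasDerivWithinAt (fun u => f u - u • D t) (D u - D t) (Icc s t) u := by
    intro u hu
    have h1 : HasDerivWithinAt f (D u) (Icc s t) u :=
      ((hf.differentiableOn (by norm_num) u (hsub hu)).hasDerivWithinAt).mono hsub
    have h2 : HasDerivWithinAt (fun u : ℝ => u • D t) ((1 : ℝ) • D t) (Icc s t) u :=
      (hasDerivWithinAt_id u _).smul_const (D t)
    rw [one_smul] at h2
    exact h1.sub h2
  have hbd : ∀ u ∈ Icc s t, ‖D u - D t‖ ≤ c * (t - s) := fun u hu => by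
    refine (norm_derivWithin_sub_le_of_iteratedDerivWithin hf hb ht (hsub hu)).trans ?_
    gcongr
    rw [abs_le]; constructor <;> linarith [hu.1, hu.2]
  have := (convex_Icc s t).norm_image_sub_le_of_norm_hasDerivWithin_le hder hbd
    (left_mem_Icc.2 hst) (right_mem_Icc.2 hst)
  rw [Real.norm_of_nonneg (sub_nonneg.2 hst)] at this
  calc ‖f t - f s - (t - s) • D t‖ = ‖(f t - t • D t) - (f s - s • D t)‖ := by
        rw [sub_smul]; congr 1; abel
    _ ≤ c * (t - s) ^ 2 := by rw [pow_two, ← mul_assoc]; exact this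

end Lipschitz

/-- The product rule applied to `P^j P^i = 0`. -/
theorem Hypotheses.mul_derivWithin_eigProj (h : Hypotheses L ε ℓ) (he : IsLabelling L e)
    {i j : Fin N} (hij : j ≠ i) {s : ℝ} (hs : s ∈ Icc (0 : ℝ) 1) :
    eigProj L e j s * derivWithin (eigProj L e i) (Icc 0 1) s =
      -(derivWithin (eigProj L e j) (Icc 0 1) s * eigProj L e i s) := by
  have hd : ∀ k, HasDerivWithinAt (eigProj L e k) (derivWithin (eigProj L e k) (Icc 0 1) s)
      (Icc 0 1) s := fun k =>
    ((h.contDiffOn_eigProj he le_rfl (h.contDiffOn_eig he) k).differentiableOn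
      (by norm_num) s hs).hasDerivWithinAt
  have h1 := (hd j).mul (hd i)
  have h2 : HasDerivWithinAt (eigProj L e j * eigProj L e i) 0 (Icc 0 1) s :=
    (hasDerivWithinAt_const s _ (0 : X →L[ℂ] X)).congr
      (fun t ht => (h.family he ht).mul_of_ne j i hij) ((h.family he hs).mul_of_ne j i hij)
  have h3 := (uniqueDiffOn_unitInterval s hs).eq_deriv _ h1 h2
  exact eq_neg_of_add_eq_zero_right h3

end Adiabatic

/-! ### Kato's maps and the algebra of the adiabatic approximation. -/

namespace Adiabatic

variable {X : Type*} [NormedAddCommGroup X] [NormedSpace ℂ X]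

/-- The Kato map `p q (1 - (p - q)²)^(-1/2)` from the range of `q` to the range of `p`. -/
noncomputable def katoTerm (p q : X →L[ℂ] X) : X →L[ℂ] X :=
  p * q * invSqrtOneSub ((p - q) ^ 2)

theorem commute_sub_sq {p q : X →L[ℂ] X} (hp : p * p = p) (hq : q * q = q) :
    Commute p ((p - q) ^ 2) := by
  show p * _ = _ * p
  simp only [pow_two, mul_sub, sub_mul, hp, hq]
  simp only [mul_assoc, hp]
  simp only [← mul_assoc, hp]
  abel

section KatoTerm

variable {p q : X →L[ℂ] X}

theorem norm_sub_sq_lt_one (h : ‖p - q‖ < 1) : ‖(p - q) ^ 2‖ < 1 :=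
  (norm_pow_le' _ two_pos).trans_lt (pow_lt_one₀ (norm_nonneg _) h two_ne_zero)

theorem norm_katoTerm_le (hp : ‖p‖ ≤ 1) (hq : ‖q‖ ≤ 1) {x : ℝ} (hx : ‖p - q‖ ≤ x) (hx1 : x < 1) :
    ‖katoTerm p q‖ ≤ (1 - x ^ 2) ^ (-(1 / 2) : ℝ) := by
  have hx0 : 0 ≤ x := (norm_nonneg _).trans hx
  have hB : ‖(p - q) ^ 2‖ ≤ x ^ 2 :=
    (norm_pow_le' _ two_pos).trans (pow_le_pow_left₀ (norm_nonneg _) hx 2)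
  have hx2 : x ^ 2 < 1 := pow_lt_one₀ hx0 hx1 two_ne_zero
  have hS : ‖invSqrtOneSub ((p - q) ^ 2)‖ ≤ (1 - x ^ 2) ^ (-(1 / 2) : ℝ) := by
    refine (norm_invSqrtOneSub_le (hB.trans_lt hx2)).trans ?_
    exact Real.rpow_le_rpow_of_nonpos (by linarith) (by linarith) (by norm_num)
  calc ‖katoTerm p q‖ ≤ ‖p‖ * ‖q‖ * ‖invSqrtOneSub ((p - q) ^ 2)‖ := norm_mul₃_le
    _ ≤ 1 * 1 * (1 - x ^ 2) ^ (-(1 / 2) : ℝ) := by gcongr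
    _ = _ := by ring

/-- The normalising factor differs from the identity only at second order in the step, so to first
order the Kato map is `p * q`. -/
theorem norm_katoTerm_sub_le [CompleteSpace X] (hp : ‖p‖ ≤ 1) (hq : ‖q‖ ≤ 1) {x : ℝ}
    (hx : ‖p - q‖ ≤ x) (hx1 : x ≤ 1 / 2) : ‖katoTerm p q - p * q‖ ≤ 2 * x ^ 2 := by
  have hx0 : 0 ≤ x := (norm_nonneg _).trans hx
  have hB : ‖(p - q) ^ 2‖ ≤ x ^ 2 :=
    (norm_pow_le' _ two_pos).trans (pow_le_pow_left₀ (norm_nonneg _) hx 2)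
  have hx2 : x ^ 2 ≤ 1 / 4 := by nlinarith
  have hS : ‖invSqrtOneSub ((p - q) ^ 2) - 1‖ ≤ 2 * x ^ 2 := by
    refine (norm_invSqrtOneSub_sub_one_le (by linarith)).trans ?_
    rw [div_le_iff₀ (by linarith)]
    nlinarith [norm_nonneg ((p - q) ^ 2)]
  calc ‖katoTerm p q - p * q‖ = ‖p * q * (invSqrtOneSub ((p - q) ^ 2) - 1)‖ := by
        rw [katoTerm, mul_sub, mul_one]
    _ ≤ ‖p‖ * ‖q‖ * ‖invSqrtOneSub ((p - q) ^ 2) - 1‖ := norm_mul₃_le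
    _ ≤ 1 * 1 * (2 * x ^ 2) := by gcongr
    _ = _ := by ring

theorem mul_katoTerm (hp : p * p = p) : p * katoTerm p q = katoTerm p q := by
  rw [katoTerm, ← mul_assoc, ← mul_assoc, hp]

variable [CompleteSpace X]

theorem katoTerm_mul (hp : p * p = p) (hq : q * q = q) (h : ‖p - q‖ < 1) :
    katoTerm p q * q = katoTerm p q := by
  have hc : Commute q (invSqrtOneSub ((p - q) ^ 2)) := by
    refine commute_invSqrtOneSub (norm_sub_sq_lt_one h) ?_
    rw [← neg_sub q p, neg_sq]
    exact commute_sub_sq hq hp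
  rw [katoTerm, mul_assoc, ← hc.eq, ← mul_assoc, mul_assoc p q q, hq]

/-- `(p - q)^2` commutes with `p` and `q`, so both inverse roots move to the right of `q p q = q (1
- (p - q)^2)` and cancel the last factor. -/
theorem katoTerm_mul_katoTerm (hp : p * p = p) (hq : q * q = q) (h : ‖p - q‖ < 1) :
    katoTerm q p * katoTerm p q = q := by
  have hB := norm_sub_sq_lt_one h
  set S := invSqrtOneSub ((p - q) ^ 2) with hS
  have hcp : Commute p S := commute_invSqrtOneSub hB (commute_sub_sq hp hq)
  have hcq : Commute q S := by
    refine commute_invSqrtOneSub hB ?_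
    rw [← neg_sub q p, neg_sq]
    exact commute_sub_sq hq hp
  have hqpq : q * p * q = q * (1 - (p - q) ^ 2) := by
    simp only [pow_two, mul_sub, sub_mul, hp, hq, mul_one]
    simp only [← mul_assoc, hq]
    abel
  have hSB : (1 - (p - q) ^ 2) * (S * S) = 1 := by
    have hc : Commute (1 - (p - q) ^ 2) S :=
      commute_invSqrtOneSub hB ((Commute.one_left _).sub_left (Commute.refl _))
    rw [(hc.mul_right hc).eq]
    exact invSqrtOneSub_mul_self_mul hB
  have e1 : katoTerm q p = q * p * S := by
    rw [katoTerm, hS, ← neg_sub p q, neg_sq]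
  calc katoTerm q p * katoTerm p q = q * p * (S * p) * q * S := by
        rw [e1, katoTerm]; simp only [mul_assoc]; rfl
    _ = q * p * p * (S * q) * S := by rw [← hcp.eq]; simp only [mul_assoc]
    _ = q * p * q * (S * S) := by
        rw [← hcq.eq, mul_assoc q p p, hp]; simp only [mul_assoc]
    _ = q := by rw [hqpq, mul_assoc, hSB, mul_one]

end KatoTerm

/-- The product of the Kato maps along `p 0, …, p k`, on the range of `p 0`. -/
noncomputable def transport (p : ℕ → X →L[ℂ] X) : ℕ → X →L[ℂ] X
  | 0 => p 0
  | k + 1 => katoTerm (p (k + 1)) (p k) * transport p k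

/-- The product of the backward Kato maps along `p k, …, p 0`. -/
noncomputable def transportDagger (p : ℕ → X →L[ℂ] X) : ℕ → X →L[ℂ] X
  | 0 => p 0
  | k + 1 => transportDagger p k * katoTerm (p k) (p (k + 1))

/-- The projections `p 0, …, p T` have norm at most one and consecutive ones are at distance at
most `x < 1`. -/
structure IsSlow (p : ℕ → X →L[ℂ] X) (T : ℕ) (x : ℝ) : Prop where
  mul_self : ∀ k ≤ T, p k * p k = p k
  norm_le : ∀ k ≤ T, ‖p k‖ ≤ 1
  norm_sub_le : ∀ k < T, ‖p (k + 1) - p k‖ ≤ x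
  lt_one : x < 1

namespace IsSlow

variable {p : ℕ → X →L[ℂ] X} {T : ℕ} {x : ℝ}

theorem norm_sub_lt (h : IsSlow p T x) {k : ℕ} (hk : k < T) : ‖p (k + 1) - p k‖ < 1 :=
  (h.norm_sub_le k hk).trans_lt h.lt_one

theorem norm_sub_lt_symm (h : IsSlow p T x) {k : ℕ} (hk : k < T) : ‖p k - p (k + 1)‖ < 1 := by
  rw [norm_sub_rev]; exact h.norm_sub_lt hk

theorem mul_transport (h : IsSlow p T x) {k : ℕ} (hk : k ≤ T) :
    p k * transport p k = transport p k := by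
  cases k with
  | zero => exact h.mul_self 0 hk
  | succ k => rw [transport, ← mul_assoc, mul_katoTerm (h.mul_self _ hk)]

theorem transport_mul (h : IsSlow p T x) (k : ℕ) : transport p k * p 0 = transport p k := by
  induction k with
  | zero => exact h.mul_self 0 (Nat.zero_le _)
  | succ k ih => rw [transport, mul_assoc, ih]

theorem mul_transportDagger (h : IsSlow p T x) (k : ℕ) :
    p 0 * transportDagger p k = transportDagger p k := by
  induction k with
  | zero => exact h.mul_self 0 (Nat.zero_le _)
  | succ k ih => rw [transportDagger, ← mul_assoc, ih]

theorem norm_transport_le (h : IsSlow p T x) {k : ℕ} (hk : k ≤ T) :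
    ‖transport p k‖ ≤ ((1 - x ^ 2) ^ (-(1 / 2) : ℝ)) ^ k := by
  induction k with
  | zero => simpa [transport] using h.norm_le 0 hk
  | succ k ih =>
    rw [transport, pow_succ']
    refine (norm_mul_le _ _).trans (mul_le_mul ?_ (ih (by omega)) (norm_nonneg _) ?_)
    · exact norm_katoTerm_le (h.norm_le _ hk) (h.norm_le _ (by omega))
        (h.norm_sub_le k (by omega)) h.lt_one
    · exact (norm_nonneg _).trans (norm_katoTerm_le (h.norm_le _ hk) (h.norm_le _ (by omega))
        (h.norm_sub_le k (by omega)) h.lt_one)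

theorem norm_transportDagger_le (h : IsSlow p T x) {k : ℕ} (hk : k ≤ T) :
    ‖transportDagger p k‖ ≤ ((1 - x ^ 2) ^ (-(1 / 2) : ℝ)) ^ k := by
  induction k with
  | zero => simpa [transportDagger] using h.norm_le 0 hk
  | succ k ih =>
    have hn : ‖katoTerm (p k) (p (k + 1))‖ ≤ (1 - x ^ 2) ^ (-(1 / 2) : ℝ) :=
      norm_katoTerm_le (h.norm_le _ (by omega)) (h.norm_le _ hk)
        (by rw [norm_sub_rev]; exact h.norm_sub_le k (by omega)) h.lt_one
    rw [transportDagger, pow_succ]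
    exact (norm_mul_le _ _).trans (mul_le_mul (ih (by omega)) hn (norm_nonneg _)
      ((norm_nonneg _).trans (ih (by omega))))

variable [CompleteSpace X]

theorem transportDagger_mul (h : IsSlow p T x) {k : ℕ} (hk : k ≤ T) :
    transportDagger p k * p k = transportDagger p k := by
  cases k with
  | zero => exact h.mul_self 0 hk
  | succ k =>
    rw [transportDagger, mul_assoc, katoTerm_mul (h.mul_self _ (by omega)) (h.mul_self _ hk)
      (h.norm_sub_lt_symm (by omega))]

theorem transportDagger_mul_transport (h : IsSlow p T x) {k : ℕ} (hk : k ≤ T) :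
    transportDagger p k * transport p k = p 0 := by
  induction k with
  | zero => exact h.mul_self 0 hk
  | succ k ih =>
    rw [transport, transportDagger, mul_assoc, ← mul_assoc (katoTerm _ _),
      katoTerm_mul_katoTerm (h.mul_self _ hk) (h.mul_self _ (by omega)) (h.norm_sub_lt (by omega)),
      h.mul_transport (by omega), ih (by omega)]

theorem transport_mul_transportDagger (h : IsSlow p T x) {k : ℕ} (hk : k ≤ T) :
    transport p k * transportDagger p k = p k := by
  induction k with
  | zero => exact h.mul_self 0 hk
  | succ k ih =>
    rw [transport, transportDagger, mul_assoc, ← mul_assoc (transport p k), ih (by omega),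
      ← mul_assoc, katoTerm_mul (h.mul_self _ hk) (h.mul_self _ (by omega))
        (h.norm_sub_lt (by omega)),
      katoTerm_mul_katoTerm (h.mul_self _ (by omega)) (h.mul_self _ hk)
        (h.norm_sub_lt_symm (by omega))]

end IsSlow

/-- Bernoulli's inequality with exponent `T / T₀ ≥ 1` gives `1 - c² / T₀² ≤ (1 - (c / T)²) ^ (T /
T₀)`; raising to the power `-T₀ / 2` bounds all `T` Kato factors at once. -/
theorem rpow_pow_le_rpow {c T₀ : ℝ} (hc : 0 ≤ c) (hT₀ : c < T₀) {T k : ℕ} (hT : T₀ ≤ T)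
    (hk : k ≤ T) :
    ((1 - (c / T) ^ 2) ^ (-(1 / 2) : ℝ)) ^ k ≤ (1 - c ^ 2 / T₀ ^ 2) ^ (-T₀ / 2) := by
  have hT₀0 : 0 < T₀ := hc.trans_lt hT₀
  have hT0 : (0 : ℝ) < T := hT₀0.trans_le hT
  have hx1 : c / T < 1 := by rw [div_lt_one hT0]; linarith
  have hx0 : 0 ≤ c / T := by positivity
  have hx : 0 < 1 - (c / T) ^ 2 := by
    have := pow_lt_one₀ hx0 hx1 two_ne_zero
    linarith
  have hy : 0 < 1 - c ^ 2 / T₀ ^ 2 := by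
    rw [← div_pow]
    have := pow_lt_one₀ (by positivity) ((div_lt_one hT₀0).2 hT₀) two_ne_zero
    linarith
  have hb : 1 - c ^ 2 / T₀ ^ 2 ≤ (1 - (c / T) ^ 2) ^ (T / T₀ : ℝ) := by
    have h1 := one_add_mul_self_le_rpow_one_add (s := -(c / T) ^ 2) (by linarith)
      (p := T / T₀) ((one_le_div hT₀0).2 hT)
    rw [← sub_eq_add_neg] at h1
    refine le_trans ?_ h1
    have h2 : (T / T₀ : ℝ) * -(c / T) ^ 2 = -(c ^ 2 / (T₀ * T)) := by field_simp
    rw [h2, ← sub_eq_add_neg, pow_two T₀]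
    gcongr
  have hb2 : (1 - c ^ 2 / T₀ ^ 2) ^ T₀ ≤ (1 - (c / T) ^ 2) ^ (T : ℝ) := by
    calc (1 - c ^ 2 / T₀ ^ 2) ^ T₀ ≤ ((1 - (c / T) ^ 2) ^ (T / T₀ : ℝ)) ^ T₀ :=
          Real.rpow_le_rpow hy.le hb hT₀0.le
      _ = _ := by rw [← Real.rpow_mul hx.le, div_mul_cancel₀ _ hT₀0.ne']
  calc ((1 - (c / T) ^ 2) ^ (-(1 / 2) : ℝ)) ^ k ≤ ((1 - (c / T) ^ 2) ^ (-(1 / 2) : ℝ)) ^ T := by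
        refine pow_le_pow_right₀ ?_ hk
        exact Real.one_le_rpow_of_pos_of_le_one_of_nonpos hx (by nlinarith) (by norm_num)
    _ = ((1 - (c / T) ^ 2) ^ (T : ℝ)) ^ (-(1 / 2) : ℝ) := by
        rw [← Real.rpow_natCast, ← Real.rpow_mul hx.le, ← Real.rpow_mul hx.le, mul_comm]
    _ ≤ ((1 - c ^ 2 / T₀ ^ 2) ^ T₀) ^ (-(1 / 2) : ℝ) :=
        Real.rpow_le_rpow_of_nonpos (Real.rpow_pos_of_pos hy _) hb2 (by norm_num)
    _ = _ := by rw [← Real.rpow_mul hy.le]; congr 1; ring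

section Families

variable {L : ℝ → X →L[ℂ] X} {N : ℕ} {e : Fin N → ℝ → ℂ} {T : ℕ} {x : ℝ}

theorem katoStep_succ (k : ℕ) : katoStep L e T (k + 1) =
    ∑ j, katoTerm (eigProjAt L e T j (k + 1)) (eigProjAt L e T j k) := rfl

theorem katoStepDagger_succ (k : ℕ) : katoStepDagger L e T (k + 1) =
    ∑ j, katoTerm (eigProjAt L e T j k) (eigProjAt L e T j (k + 1)) := by
  refine Finset.sum_congr rfl fun j _ => ?_
  rw [katoTerm, ← neg_sub (eigProjAt L e T j (k + 1)), neg_sq]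
  rfl

/-- Simultaneously slow families that are orthogonal at every step. -/
structure IsSlowFamily (L : ℝ → X →L[ℂ] X) (e : Fin N → ℝ → ℂ) (T : ℕ) (x : ℝ) : Prop where
  slow : ∀ j, IsSlow (eigProjAt L e T j) T x
  mul_of_ne : ∀ k ≤ T, ∀ i j, i ≠ j → eigProjAt L e T i k * eigProjAt L e T j k = 0
  norm_eig : ∀ k ≤ T, ∀ j, ‖e j (k / T : ℝ)‖ = 1

namespace IsSlowFamily

theorem mul_katoStepDagger (h : IsSlowFamily L e T x) {k : ℕ} (hk : k < T) (j : Fin N) :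
    eigProjAt L e T j k * katoStepDagger L e T (k + 1) =
      katoTerm (eigProjAt L e T j k) (eigProjAt L e T j (k + 1)) := by
  have hm : ∀ i, eigProjAt L e T i k * katoTerm (eigProjAt L e T i k) (eigProjAt L e T i (k + 1)) =
      katoTerm (eigProjAt L e T i k) (eigProjAt L e T i (k + 1)) := fun i =>
    mul_katoTerm ((h.slow i).mul_self _ hk.le)
  rw [katoStepDagger_succ, Finset.mul_sum, Finset.sum_eq_single j]
  · exact hm j
  · intro i _ hij
    rw [← hm i, ← mul_assoc, h.mul_of_ne k hk.le j i hij.symm, zero_mul]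
  · simp

theorem norm_prod_eig (h : IsSlowFamily L e T x) {k : ℕ} (hk : k ≤ T) (j : Fin N) :
    ‖∏ n ∈ Finset.Icc 1 k, e j (n / T : ℝ)‖ = 1 := by
  rw [norm_prod]
  exact Finset.prod_eq_one fun n hn => h.norm_eig n ((Finset.mem_Icc.1 hn).2.trans hk) j

theorem prod_conj_mul_prod (h : IsSlowFamily L e T x) {k : ℕ} (hk : k ≤ T) (j : Fin N) :
    (∏ n ∈ Finset.Icc 1 k, (starRingEnd ℂ) (e j (n / T : ℝ))) *
      ∏ n ∈ Finset.Icc 1 k, e j (n / T : ℝ) = 1 := by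
  rw [← map_prod, Complex.conj_mul', h.norm_prod_eig hk]
  simp

variable [CompleteSpace X]

/-- Orthogonality at step `k` isolates one summand of the Kato step, which decouples the total
evolution into the separate transports of the `P^j`. -/
theorem katoStep_mul (h : IsSlowFamily L e T x) {k : ℕ} (hk : k < T) (j : Fin N) :
    katoStep L e T (k + 1) * eigProjAt L e T j k =
      katoTerm (eigProjAt L e T j (k + 1)) (eigProjAt L e T j k) := by
  have hm : ∀ i, katoTerm (eigProjAt L e T i (k + 1)) (eigProjAt L e T i k) *
      eigProjAt L e T i k = katoTerm (eigProjAt L e T i (k + 1)) (eigProjAt L e T i k) := fun i =>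
    katoTerm_mul ((h.slow i).mul_self _ hk) ((h.slow i).mul_self _ hk.le) ((h.slow i).norm_sub_lt hk)
  rw [katoStep_succ, Finset.sum_mul, Finset.sum_eq_single j]
  · exact hm j
  · intro i _ hij
    rw [← hm i, mul_assoc, h.mul_of_ne k hk.le i j hij, mul_zero]
  · simp

theorem orderedProd_mul (h : IsSlowFamily L e T x) {k : ℕ} (hk : k ≤ T) (j : Fin N) :
    orderedProd (katoStep L e T) k * eigProjAt L e T j 0 = transport (eigProjAt L e T j) k := by
  induction k with
  | zero => exact one_mul _
  | succ k ih =>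
    rw [orderedProd, mul_assoc, ih (by omega), ← (h.slow j).mul_transport (k := k) (by omega),
      ← mul_assoc, h.katoStep_mul hk, transport]

theorem mul_revOrderedProd (h : IsSlowFamily L e T x) {k : ℕ} (hk : k ≤ T) (j : Fin N) :
    eigProjAt L e T j 0 * revOrderedProd (katoStepDagger L e T) k =
      transportDagger (eigProjAt L e T j) k := by
  induction k with
  | zero => exact mul_one _
  | succ k ih =>
    rw [revOrderedProd, ← mul_assoc, ih (by omega),
      ← (h.slow j).transportDagger_mul (k := k) (by omega),
      mul_assoc, h.mul_katoStepDagger hk, transportDagger]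

theorem adiabaticMap_eq (h : IsSlowFamily L e T x) {k : ℕ} (hk : k ≤ T) :
    adiabaticMap L e T k =
      ∑ j, (∏ n ∈ Finset.Icc 1 k, e j (n / T : ℝ)) • transport (eigProjAt L e T j) k := by
  rw [adiabaticMap, phase, Finset.mul_sum]
  refine Finset.sum_congr rfl fun j _ => ?_
  rw [mul_smul_comm, h.orderedProd_mul hk]

theorem adiabaticMapDagger_eq (h : IsSlowFamily L e T x) {k : ℕ} (hk : k ≤ T) :
    adiabaticMapDagger L e T k = ∑ j, (∏ n ∈ Finset.Icc 1 k, (starRingEnd ℂ) (e j (n / T : ℝ))) •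
      transportDagger (eigProjAt L e T j) k := by
  rw [adiabaticMapDagger, phaseDagger, Finset.sum_mul]
  refine Finset.sum_congr rfl fun j _ => ?_
  rw [smul_mul_assoc, h.mul_revOrderedProd hk]

theorem norm_adiabaticMap_le (h : IsSlowFamily L e T x) {k : ℕ} (hk : k ≤ T) :
    ‖adiabaticMap L e T k‖ ≤ N * ((1 - x ^ 2) ^ (-(1 / 2) : ℝ)) ^ k := by
  rw [h.adiabaticMap_eq hk]
  refine (norm_sum_le_of_le (f := fun j : Fin N => (∏ n ∈ Finset.Icc 1 k, e j (n / T : ℝ)) •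
    transport (eigProjAt L e T j) k) (Finset.univ) fun j _ => ?_).trans_eq
    (by rw [Finset.sum_const, Finset.card_univ, Fintype.card_fin, nsmul_eq_mul])
  rw [norm_smul, h.norm_prod_eig hk, one_mul]
  exact (h.slow j).norm_transport_le hk

theorem norm_adiabaticMapDagger_le (h : IsSlowFamily L e T x) {k : ℕ} (hk : k ≤ T) :
    ‖adiabaticMapDagger L e T k‖ ≤ N * ((1 - x ^ 2) ^ (-(1 / 2) : ℝ)) ^ k := by
  rw [h.adiabaticMapDagger_eq hk]
  refine (norm_sum_le_of_le (f := fun j : Fin N =>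
    (∏ n ∈ Finset.Icc 1 k, (starRingEnd ℂ) (e j (n / T : ℝ))) •
    transportDagger (eigProjAt L e T j) k) (Finset.univ) fun j _ => ?_).trans_eq
    (by rw [Finset.sum_const, Finset.card_univ, Fintype.card_fin, nsmul_eq_mul])
  rw [norm_smul, ← map_prod, RCLike.norm_conj, h.norm_prod_eig hk, one_mul]
  exact (h.slow j).norm_transportDagger_le hk

theorem adiabaticMap_mul (h : IsSlowFamily L e T x) {k : ℕ} (hk : k ≤ T) (j : Fin N) :
    adiabaticMap L e T k * eigProjAt L e T j 0 =
      (∏ n ∈ Finset.Icc 1 k, e j (n / T : ℝ)) • transport (eigProjAt L e T j) k := by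
  rw [h.adiabaticMap_eq hk, Finset.sum_mul, Finset.sum_eq_single j]
  · rw [smul_mul_assoc, (h.slow j).transport_mul]
  · intro i _ hij
    rw [smul_mul_assoc, ← (h.slow i).transport_mul, mul_assoc,
      h.mul_of_ne 0 (Nat.zero_le _) i j hij, mul_zero, smul_zero]
  · simp

theorem mul_adiabaticMap (h : IsSlowFamily L e T x) {k : ℕ} (hk : k ≤ T) (j : Fin N) :
    eigProjAt L e T j k * adiabaticMap L e T k =
      (∏ n ∈ Finset.Icc 1 k, e j (n / T : ℝ)) • transport (eigProjAt L e T j) k := by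
  rw [h.adiabaticMap_eq hk, Finset.mul_sum, Finset.sum_eq_single j]
  · rw [mul_smul_comm, (h.slow j).mul_transport hk]
  · intro i _ hij
    rw [mul_smul_comm, ← (h.slow i).mul_transport hk, ← mul_assoc,
      h.mul_of_ne k hk j i hij.symm, zero_mul, smul_zero]
  · simp

theorem adiabaticMapDagger_mul (h : IsSlowFamily L e T x) {k : ℕ} (hk : k ≤ T) (j : Fin N) :
    adiabaticMapDagger L e T k * eigProjAt L e T j k =
      (∏ n ∈ Finset.Icc 1 k, (starRingEnd ℂ) (e j (n / T : ℝ))) •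
        transportDagger (eigProjAt L e T j) k := by
  rw [h.adiabaticMapDagger_eq hk, Finset.sum_mul, Finset.sum_eq_single j]
  · rw [smul_mul_assoc, (h.slow j).transportDagger_mul hk]
  · intro i _ hij
    rw [smul_mul_assoc, ← (h.slow i).transportDagger_mul hk, mul_assoc,
      h.mul_of_ne k hk i j hij, mul_zero, smul_zero]
  · simp

theorem mul_adiabaticMapDagger (h : IsSlowFamily L e T x) {k : ℕ} (hk : k ≤ T) (j : Fin N) :
    eigProjAt L e T j 0 * adiabaticMapDagger L e T k =
      (∏ n ∈ Finset.Icc 1 k, (starRingEnd ℂ) (e j (n / T : ℝ))) •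
        transportDagger (eigProjAt L e T j) k := by
  rw [h.adiabaticMapDagger_eq hk, Finset.mul_sum, Finset.sum_eq_single j]
  · rw [mul_smul_comm, (h.slow j).mul_transportDagger]
  · intro i _ hij
    rw [mul_smul_comm, ← (h.slow i).mul_transportDagger, ← mul_assoc,
      h.mul_of_ne 0 (Nat.zero_le _) j i hij.symm, zero_mul, smul_zero]
  · simp

theorem adiabaticMapDagger_mul_adiabaticMap (h : IsSlowFamily L e T x) {k : ℕ} (hk : k ≤ T) :
    adiabaticMapDagger L e T k * adiabaticMap L e T k = ∑ j, eigProjAt L e T j 0 := by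
  conv_lhs => rw [h.adiabaticMapDagger_eq hk, Finset.sum_mul]
  refine Finset.sum_congr rfl fun j _ => ?_
  rw [← (h.slow j).transportDagger_mul hk, smul_mul_assoc, mul_assoc, h.mul_adiabaticMap hk,
    mul_smul_comm, smul_smul, h.prod_conj_mul_prod hk, one_smul,
    (h.slow j).transportDagger_mul_transport hk]

theorem adiabaticMap_mul_adiabaticMapDagger (h : IsSlowFamily L e T x) {k : ℕ} (hk : k ≤ T) :
    adiabaticMap L e T k * adiabaticMapDagger L e T k = ∑ j, eigProjAt L e T j k := by
  conv_lhs => rw [h.adiabaticMap_eq hk, Finset.sum_mul]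
  refine Finset.sum_congr rfl fun j _ => ?_
  rw [← (h.slow j).transport_mul, smul_mul_assoc, mul_assoc, h.mul_adiabaticMapDagger hk,
    mul_smul_comm, smul_smul, mul_comm, h.prod_conj_mul_prod hk, one_smul,
    (h.slow j).transport_mul_transportDagger hk]

theorem adiabaticMap_mul_sum (h : IsSlowFamily L e T x) {k : ℕ} (hk : k ≤ T) :
    adiabaticMap L e T k * ∑ j, eigProjAt L e T j 0 = adiabaticMap L e T k := by
  rw [Finset.mul_sum]
  conv_rhs => rw [h.adiabaticMap_eq hk]
  exact Finset.sum_congr rfl fun j _ => h.adiabaticMap_mul hk j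

theorem sum_mul_adiabaticMap (h : IsSlowFamily L e T x) {k : ℕ} (hk : k ≤ T) :
    (∑ j, eigProjAt L e T j k) * adiabaticMap L e T k = adiabaticMap L e T k := by
  rw [Finset.sum_mul]
  conv_rhs => rw [h.adiabaticMap_eq hk]
  exact Finset.sum_congr rfl fun j _ => h.mul_adiabaticMap hk j

theorem sum_mul_adiabaticMapDagger (h : IsSlowFamily L e T x) {k : ℕ} (hk : k ≤ T) :
    (∑ j, eigProjAt L e T j 0) * adiabaticMapDagger L e T k = adiabaticMapDagger L e T k := by
  rw [Finset.sum_mul]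
  conv_rhs => rw [h.adiabaticMapDagger_eq hk]
  exact Finset.sum_congr rfl fun j _ => h.mul_adiabaticMapDagger hk j

/-- The phases in `adiabaticMap` are applied at time zero. Since the transports intertwine the
projectors, the last phase may instead be applied at step `k + 1`, where it is the operator `L P`,
comparable with the true evolution. -/
theorem adiabaticMap_succ (h : IsSlowFamily L e T x) {k : ℕ} (hk : k < T) :
    adiabaticMap L e T (k + 1) = (∑ j, e j ((k + 1 : ℕ) / T : ℝ) • eigProjAt L e T j (k + 1)) *
      (katoStep L e T (k + 1) * adiabaticMap L e T k) := by
  have h1 : katoStep L e T (k + 1) * adiabaticMap L e T k =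
      ∑ j, (∏ n ∈ Finset.Icc 1 k, e j (n / T : ℝ)) • transport (eigProjAt L e T j) (k + 1) := by
    rw [h.adiabaticMap_eq hk.le, Finset.mul_sum]
    refine Finset.sum_congr rfl fun j _ => ?_
    rw [mul_smul_comm, ← (h.slow j).mul_transport hk.le, ← mul_assoc, h.katoStep_mul hk, transport]
  rw [h1, h.adiabaticMap_eq hk, Finset.mul_sum]
  refine Finset.sum_congr rfl fun j _ => ?_
  rw [mul_smul_comm, ← (h.slow j).mul_transport hk, ← mul_assoc,
    sum_mul_of_orthogonal (p := fun j => eigProjAt L e T j (k + 1))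
      (fun i => (h.slow i).mul_self _ hk) (h.mul_of_ne _ hk) j
      (fun j => e j ((k + 1 : ℕ) / T : ℝ)), smul_mul_assoc, smul_smul,
    ← Finset.prod_Icc_succ_top (by omega)]

end IsSlowFamily

end Families

end Adiabatic

/-! ### Leakage between the peripheral and the contracting parts. -/

namespace Adiabatic

variable {X : Type*} [NormedAddCommGroup X] [NormedSpace ℂ X]

/-- Contractions `A 0, …, A T` that commute with slowly varying projections `P 0, …, P T` and
contract their kernels strictly. -/
structure IsLeaky (A P : ℕ → X →L[ℂ] X) (T : ℕ) (ℓ d : ℝ) : Prop where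
  norm_le : ∀ k ≤ T, ‖A k‖ ≤ 1
  mul_self : ∀ k ≤ T, P k * P k = P k
  commute : ∀ k ≤ T, P k * A k = A k * P k
  norm_proj_le : ∀ k ≤ T, ‖P k‖ ≤ 1
  norm_mul_le : ∀ k ≤ T, ‖A k * (1 - P k)‖ ≤ ℓ
  norm_sub_le : ∀ k < T, ‖P (k + 1) - P k‖ ≤ d
  lt_one : ℓ < 1
  nonneg : 0 ≤ d

theorem norm_orderedProd_le {M : ℕ → X →L[ℂ] X} {T : ℕ} {r : ℝ} (hM : ∀ k ≤ T, ‖M k‖ ≤ r) {k : ℕ}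
    (hk : k ≤ T) : ‖orderedProd M k‖ ≤ r ^ k := by
  induction k with
  | zero => simpa [orderedProd] using norm_one_le (X := X)
  | succ k ih =>
    rw [orderedProd, pow_succ']
    exact (norm_mul_le _ _).trans (mul_le_mul (hM _ hk) (ih (by omega)) (norm_nonneg _)
      ((norm_nonneg _).trans (hM _ hk)))

namespace IsLeaky

variable {A P : ℕ → X →L[ℂ] X} {T : ℕ} {ℓ d : ℝ}

theorem ratio_nonneg (h : IsLeaky A P T ℓ d) : 0 ≤ ℓ :=
  (norm_nonneg _).trans (h.norm_mul_le 0 (Nat.zero_le _))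

theorem norm_compl_le (h : IsLeaky A P T ℓ d) {k : ℕ} (hk : k ≤ T) : ‖1 - P k‖ ≤ 2 := by
  refine (_root_.norm_sub_le _ _).trans ?_
  linarith [norm_one_le (X := X), h.norm_proj_le k hk]

theorem norm_mul_proj_le (h : IsLeaky A P T ℓ d) {k : ℕ} (hk : k ≤ T) : ‖A k * P k‖ ≤ 1 :=
  (_root_.norm_mul_le _ _).trans
    (mul_le_one₀ (h.norm_le k hk) (norm_nonneg _) (h.norm_proj_le k hk))

theorem norm_orderedProd_le_one (h : IsLeaky A P T ℓ d) {k : ℕ} (hk : k ≤ T) :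
    ‖orderedProd A k‖ ≤ 1 := by
  simpa using norm_orderedProd_le h.norm_le hk

theorem compl_mul_compl (h : IsLeaky A P T ℓ d) {k : ℕ} (hk : k ≤ T) :
    (1 - P k) * (1 - P k) = 1 - P k := by
  simp only [mul_sub, sub_mul, one_mul, mul_one, h.mul_self k hk]; abel

theorem proj_mul_compl (h : IsLeaky A P T ℓ d) {k : ℕ} (hk : k ≤ T) : P k * (1 - P k) = 0 := by
  rw [mul_sub, mul_one, h.mul_self k hk, sub_self]

/-- `(1 - P (k + 1)) * P k = (1 - P (k + 1)) * (P k - P (k + 1))`, so a transition between the parts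
costs one increment `d`. -/
theorem norm_mul_compl_mul_proj_le (h : IsLeaky A P T ℓ d) {k : ℕ} (hk : k < T) (V : X →L[ℂ] X) :
    ‖A (k + 1) * (1 - P (k + 1)) * (P k * V)‖ ≤ d * ‖P k * V‖ := by
  have e1 : A (k + 1) * (1 - P (k + 1)) * (P k * V) =
      A (k + 1) * (1 - P (k + 1)) * (P k - P (k + 1)) * (P k * V) := by
    have e2 : (1 - P (k + 1)) * (P k - P (k + 1)) = (1 - P (k + 1)) * P k := by
      rw [mul_sub, sub_mul _ _ (P (k + 1)), one_mul, h.mul_self _ hk, sub_self, sub_zero]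
    rw [mul_assoc (A (k + 1)) _ (P k - P (k + 1)), e2, mul_assoc, mul_assoc, mul_assoc,
      ← mul_assoc (P k) (P k), h.mul_self _ hk.le]
  rw [e1]
  refine norm_mul₃_le.trans ?_
  gcongr
  calc ‖A (k + 1) * (1 - P (k + 1))‖ * ‖P k - P (k + 1)‖ ≤ 1 * d := by
        gcongr
        · exact (h.norm_mul_le _ hk).trans h.lt_one.le
        · rw [norm_sub_rev]; exact h.norm_sub_le k hk
    _ = d := one_mul d

theorem norm_mul_proj_mul_compl_le (h : IsLeaky A P T ℓ d) {k : ℕ} (hk : k < T) (V : X →L[ℂ] X) :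
    ‖A (k + 1) * P (k + 1) * ((1 - P k) * V)‖ ≤ d * ‖(1 - P k) * V‖ := by
  have e1 : A (k + 1) * P (k + 1) * ((1 - P k) * V) =
      A (k + 1) * (P (k + 1) - P k) * ((1 - P k) * V) := by
    rw [mul_sub (A (k + 1)), sub_mul _ (A (k + 1) * P k), mul_assoc (A (k + 1)) (P k),
      ← mul_assoc (P k), h.proj_mul_compl hk.le,
      zero_mul, mul_zero, sub_zero]
  rw [e1]
  refine norm_mul₃_le.trans ?_
  gcongr
  calc ‖A (k + 1)‖ * ‖P (k + 1) - P k‖ ≤ 1 * d := by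
        gcongr
        · exact h.norm_le _ hk
        · exact h.norm_sub_le k hk
    _ = d := one_mul d

theorem proj_mul_orderedProd_succ (h : IsLeaky A P T ℓ d) {k : ℕ} (hk : k < T) (V : X →L[ℂ] X) :
    P (k + 1) * (orderedProd A (k + 1) * V) =
      A (k + 1) * P (k + 1) * (P k * (orderedProd A k * V)) +
        A (k + 1) * P (k + 1) * ((1 - P k) * (orderedProd A k * V)) := by
  rw [← mul_add, ← add_mul, add_sub_cancel, one_mul, orderedProd, ← h.commute _ hk]
  simp only [mul_assoc]

theorem compl_mul_orderedProd_succ (h : IsLeaky A P T ℓ d) {k : ℕ} (hk : k < T) (V : X →L[ℂ] X) :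
    (1 - P (k + 1)) * (orderedProd A (k + 1) * V) =
      A (k + 1) * (1 - P (k + 1)) * ((1 - P k) * (orderedProd A k * V)) +
        A (k + 1) * (1 - P (k + 1)) * (P k * (orderedProd A k * V)) := by
  have : A (k + 1) * (1 - P (k + 1)) = (1 - P (k + 1)) * A (k + 1) := by
    rw [mul_sub, sub_mul, one_mul, mul_one, h.commute _ hk]
  rw [← mul_add, ← add_mul, sub_add_cancel, one_mul, orderedProd, this]
  simp only [mul_assoc]

/-- The leaked part satisfies `x (k + 1) ≤ ℓ * x k + d` with `x 0 = 0`, and `d / (1 - ℓ)` is the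
fixed point of this recursion. -/
theorem norm_compl_mul_orderedProd_mul_proj_le (h : IsLeaky A P T ℓ d) {k : ℕ} (hk : k ≤ T) :
    ‖(1 - P k) * (orderedProd A k * P 0)‖ ≤ d / (1 - ℓ) := by
  have hℓ : 0 < 1 - ℓ := sub_pos.2 h.lt_one
  have hd := h.nonneg
  induction k with
  | zero =>
    have : (1 - P 0) * (orderedProd A 0 * P 0) = 0 := by
      rw [orderedProd, one_mul, sub_mul, one_mul, h.mul_self 0 hk, sub_self]
    rw [this, norm_zero]
    positivity
  | succ k ih =>
    have ih := ih (by omega)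
    rw [h.compl_mul_orderedProd_succ hk]
    have h1 : ‖P k * (orderedProd A k * P 0)‖ ≤ 1 := by
      refine (_root_.norm_mul_le _ _).trans (mul_le_one₀ (h.norm_proj_le k (by omega))
        (norm_nonneg _) ((_root_.norm_mul_le _ _).trans (mul_le_one₀
          (h.norm_orderedProd_le_one (by omega)) (norm_nonneg _) (h.norm_proj_le 0 (by omega)))))
    calc _ ≤ ℓ * (d / (1 - ℓ)) + d * 1 := by
          refine (norm_add_le _ _).trans (add_le_add ((_root_.norm_mul_le _ _).trans ?_)
            ((h.norm_mul_compl_mul_proj_le hk _).trans ?_))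
          · exact mul_le_mul (h.norm_mul_le _ hk) ih (norm_nonneg _) h.ratio_nonneg
          · exact mul_le_mul_of_nonneg_left h1 hd
      _ = d / (1 - ℓ) := by field_simp; ring

/-- Only what has left and comes back contributes: each step returns at most `d` times the leaked
part `d / (1 - ℓ)`, and the peripheral factors do not amplify it. -/
theorem norm_proj_mul_orderedProd_sub_le (h : IsLeaky A P T ℓ d) {k : ℕ} (hk : k ≤ T) :
    ‖P k * (orderedProd A k * P 0) - orderedProd (fun n => A n * P n) k * P 0‖ ≤
      k * (d * (d / (1 - ℓ))) := by
  have hd := h.nonneg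
  induction k with
  | zero =>
    have : P 0 * (orderedProd A 0 * P 0) - orderedProd (fun n => A n * P n) 0 * P 0 = 0 := by
      rw [orderedProd, orderedProd, one_mul, h.mul_self 0 hk, sub_self]
    rw [this, norm_zero]
    simp
  | succ k ih =>
    have ih := ih (by omega)
    have e1 : P (k + 1) * (orderedProd A (k + 1) * P 0) -
        orderedProd (fun n => A n * P n) (k + 1) * P 0 =
        A (k + 1) * P (k + 1) * (P k * (orderedProd A k * P 0) -
          orderedProd (fun n => A n * P n) k * P 0) +
        A (k + 1) * P (k + 1) * ((1 - P k) * (orderedProd A k * P 0)) := by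
      rw [h.proj_mul_orderedProd_succ hk, mul_sub, orderedProd, mul_assoc (A (k + 1) * P (k + 1))
        (orderedProd _ k)]
      abel
    rw [e1]
    calc _ ≤ 1 * (k * (d * (d / (1 - ℓ)))) + d * (d / (1 - ℓ)) := by
          refine (norm_add_le _ _).trans (add_le_add ((_root_.norm_mul_le _ _).trans ?_)
            ((h.norm_mul_proj_mul_compl_le hk _).trans ?_))
          · exact mul_le_mul (h.norm_mul_proj_le hk) ih (norm_nonneg _) zero_le_one
          · exact mul_le_mul_of_nonneg_left
              (h.norm_compl_mul_orderedProd_mul_proj_le (by omega)) hd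
      _ = _ := by push_cast; ring

theorem norm_orderedProd_mul_proj_sub_le (h : IsLeaky A P T ℓ d) {k : ℕ} (hk : k ≤ T) :
    ‖orderedProd A k * P 0 - orderedProd (fun n => A n * P n) k * P 0‖ ≤
      d / (1 - ℓ) + k * (d * (d / (1 - ℓ))) := by
  have e1 : orderedProd A k * P 0 - orderedProd (fun n => A n * P n) k * P 0 =
      (1 - P k) * (orderedProd A k * P 0) +
        (P k * (orderedProd A k * P 0) - orderedProd (fun n => A n * P n) k * P 0) := by
    rw [sub_mul, one_mul]; abel
  rw [e1]
  exact (norm_add_le _ _).trans (add_le_add (h.norm_compl_mul_orderedProd_mul_proj_le hk)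
    (h.norm_proj_mul_orderedProd_sub_le hk))

theorem norm_orderedProd_compl_le (h : IsLeaky A P T ℓ d) {k : ℕ} (hk : k ≤ T) :
    ‖orderedProd (fun n => A n * (1 - P n)) k * (1 - P 0)‖ ≤ 2 * ℓ ^ k := by
  rw [mul_comm (2 : ℝ)]
  exact (_root_.norm_mul_le _ _).trans (mul_le_mul (norm_orderedProd_le h.norm_mul_le hk)
    (h.norm_compl_le (Nat.zero_le _)) (norm_nonneg _) (pow_nonneg h.ratio_nonneg k))

theorem norm_compl_mul_orderedProd_sub_le (h : IsLeaky A P T ℓ d) {k : ℕ} (hk : k ≤ T) :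
    ‖(1 - P k) * (orderedProd A k * (1 - P 0)) -
      orderedProd (fun n => A n * (1 - P n)) k * (1 - P 0)‖ ≤ 2 * (d / (1 - ℓ)) := by
  have hℓ : 0 < 1 - ℓ := sub_pos.2 h.lt_one
  have hd := h.nonneg
  induction k with
  | zero =>
    have : (1 - P 0) * (orderedProd A 0 * (1 - P 0)) -
        orderedProd (fun n => A n * (1 - P n)) 0 * (1 - P 0) = 0 := by
      rw [orderedProd, orderedProd, one_mul, h.compl_mul_compl hk, sub_self]
    rw [this, norm_zero]
    positivity
  | succ k ih =>
    have ih := ih (by omega)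
    have e1 : (1 - P (k + 1)) * (orderedProd A (k + 1) * (1 - P 0)) -
        orderedProd (fun n => A n * (1 - P n)) (k + 1) * (1 - P 0) =
        A (k + 1) * (1 - P (k + 1)) * ((1 - P k) * (orderedProd A k * (1 - P 0)) -
          orderedProd (fun n => A n * (1 - P n)) k * (1 - P 0)) +
        A (k + 1) * (1 - P (k + 1)) * (P k * (orderedProd A k * (1 - P 0))) := by
      rw [h.compl_mul_orderedProd_succ hk, mul_sub _ _ (orderedProd (fun n => A n * (1 - P n)) k *
        (1 - P 0)), orderedProd, mul_assoc (A (k + 1) * (1 - P (k + 1))) (orderedProd _ k)]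
      abel
    have h1 : ‖P k * (orderedProd A k * (1 - P 0))‖ ≤ 1 * (1 * 2) := by
      refine (_root_.norm_mul_le _ _).trans (mul_le_mul (h.norm_proj_le k (by omega)) ?_
        (norm_nonneg _) zero_le_one)
      exact (_root_.norm_mul_le _ _).trans (mul_le_mul (h.norm_orderedProd_le_one (by omega))
        (h.norm_compl_le (Nat.zero_le _)) (norm_nonneg _) zero_le_one)
    rw [e1]
    calc _ ≤ ℓ * (2 * (d / (1 - ℓ))) + d * (1 * (1 * 2)) := by
          refine (norm_add_le _ _).trans (add_le_add ((_root_.norm_mul_le _ _).trans ?_)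
            ((h.norm_mul_compl_mul_proj_le hk _).trans ?_))
          · exact mul_le_mul (h.norm_mul_le _ hk) ih (norm_nonneg _) h.ratio_nonneg
          · exact mul_le_mul_of_nonneg_left h1 hd
      _ = 2 * (d / (1 - ℓ)) := by field_simp; ring

theorem norm_compl_mul_orderedProd_mul_compl_le (h : IsLeaky A P T ℓ d) {k : ℕ} (hk : k ≤ T) :
    ‖(1 - P k) * (orderedProd A k * (1 - P 0))‖ ≤ 2 * ℓ ^ k + 2 * (d / (1 - ℓ)) := by
  have e1 := sub_add_cancel ((1 - P k) * (orderedProd A k * (1 - P 0)))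
    (orderedProd (fun n => A n * (1 - P n)) k * (1 - P 0))
  rw [← e1]
  refine (norm_add_le _ _).trans ?_
  linarith [h.norm_orderedProd_compl_le hk, h.norm_compl_mul_orderedProd_sub_le hk]

/-- Step `k` feeds in `d` times the size of the stable component, `2 * ℓ ^ k + 2 * d / (1 - ℓ)`. The
quotient `(1 - ℓ ^ k) / (1 - ℓ)` is the partial geometric sum, kept exact so that the induction
closes. -/
theorem norm_proj_mul_orderedProd_mul_compl_le (h : IsLeaky A P T ℓ d) {k : ℕ} (hk : k ≤ T) :
    ‖P k * (orderedProd A k * (1 - P 0))‖ ≤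
      2 * d * ((1 - ℓ ^ k) / (1 - ℓ)) + k * (2 * (d * (d / (1 - ℓ)))) := by
  have hℓ : 0 < 1 - ℓ := sub_pos.2 h.lt_one
  have hd := h.nonneg
  induction k with
  | zero =>
    have : P 0 * (orderedProd A 0 * (1 - P 0)) = 0 := by
      rw [orderedProd, one_mul, h.proj_mul_compl hk]
    rw [this, norm_zero]
    simp
  | succ k ih =>
    have ih := ih (by omega)
    rw [h.proj_mul_orderedProd_succ hk]
    calc _ ≤ 1 * (2 * d * ((1 - ℓ ^ k) / (1 - ℓ)) + k * (2 * (d * (d / (1 - ℓ))))) +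
          d * (2 * ℓ ^ k + 2 * (d / (1 - ℓ))) := by
          refine (norm_add_le _ _).trans (add_le_add ((_root_.norm_mul_le _ _).trans ?_)
            ((h.norm_mul_proj_mul_compl_le hk _).trans ?_))
          · exact mul_le_mul (h.norm_mul_proj_le hk) ih (norm_nonneg _) zero_le_one
          · exact mul_le_mul_of_nonneg_left
              (h.norm_compl_mul_orderedProd_mul_compl_le (by omega)) hd
      _ = _ := by
          push_cast
          field_simp
          ring

theorem norm_proj_mul_orderedProd_mul_compl_le' (h : IsLeaky A P T ℓ d) {k : ℕ} (hk : k ≤ T) :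
    ‖P k * (orderedProd A k * (1 - P 0))‖ ≤
      2 * (d / (1 - ℓ)) + k * (2 * (d * (d / (1 - ℓ)))) := by
  refine (h.norm_proj_mul_orderedProd_mul_compl_le hk).trans ?_
  have hℓ : 0 < 1 - ℓ := sub_pos.2 h.lt_one
  have hd := h.nonneg
  rw [mul_assoc 2 d, mul_div_assoc']
  gcongr
  exact mul_le_of_le_one_right hd (by linarith [pow_nonneg h.ratio_nonneg k])

theorem norm_orderedProd_mul_compl_le (h : IsLeaky A P T ℓ d) {k : ℕ} (hk : k ≤ T) :
    ‖orderedProd A k * (1 - P 0)‖ ≤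
      4 * (d / (1 - ℓ)) + k * (2 * (d * (d / (1 - ℓ)))) + 2 * ℓ ^ k := by
  have e1 : orderedProd A k * (1 - P 0) = (1 - P k) * (orderedProd A k * (1 - P 0)) +
      P k * (orderedProd A k * (1 - P 0)) := by
    rw [← add_mul, sub_add_cancel, one_mul]
  rw [e1]
  refine (norm_add_le _ _).trans ?_
  linarith [h.norm_compl_mul_orderedProd_mul_compl_le hk,
    h.norm_proj_mul_orderedProd_mul_compl_le' hk]

/-- Of the four blocks, the `P → P` one contributes only to the `k`-term. The constants add up as `5
= 1 + 2 + 2` (from `P → Q`, `Q → Q`, `Q → P`) and `3 = 1 + 2` (from `P → P`, `Q → P`). -/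
theorem norm_orderedProd_sub_sub_le (h : IsLeaky A P T ℓ d) {k : ℕ} (hk : k ≤ T) :
    ‖orderedProd A k - orderedProd (fun n => A n * P n) k * P 0 -
      orderedProd (fun n => A n * (1 - P n)) k * (1 - P 0)‖ ≤
      5 * (d / (1 - ℓ)) + k * (3 * (d * (d / (1 - ℓ)))) := by
  have e1 : orderedProd A k - orderedProd (fun n => A n * P n) k * P 0 -
      orderedProd (fun n => A n * (1 - P n)) k * (1 - P 0) =
      (orderedProd A k * P 0 - orderedProd (fun n => A n * P n) k * P 0) +
      (((1 - P k) * (orderedProd A k * (1 - P 0)) -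
        orderedProd (fun n => A n * (1 - P n)) k * (1 - P 0)) +
        P k * (orderedProd A k * (1 - P 0))) := by
    rw [sub_mul (1 : X →L[ℂ] X) (P k), one_mul, mul_sub (orderedProd A k), mul_one]; abel
  rw [e1]
  refine (norm_add_le _ _).trans ((add_le_add_right (norm_add_le _ _) _).trans ?_)
  linarith [h.norm_orderedProd_mul_proj_sub_le hk, h.norm_compl_mul_orderedProd_sub_le hk,
    h.norm_proj_mul_orderedProd_mul_compl_le' hk]

end IsLeaky

end Adiabatic

/-! ### The first order corrector. -/

namespace Adiabatic

variable {X : Type*} [NormedAddCommGroup X] [NormedSpace ℂ X] {N : ℕ}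

/-- The first order corrector `∑_{i ≠ j} e_j / (e_i - e_j) P_j P_j' P_i`; its diagonal terms vanish
by the convention `x / 0 = 0`. -/
noncomputable def corrector (e : Fin N → ℂ) (p D : Fin N → X →L[ℂ] X) : X →L[ℂ] X :=
  ∑ j, ∑ i, (e j / (e i - e j)) • (p j * D j * p i)

theorem norm_sum_fin_le {f : Fin N → X →L[ℂ] X} {b : ℝ} (h : ∀ i, ‖f i‖ ≤ b) :
    ‖∑ i, f i‖ ≤ N * b := by
  refine (norm_sum_le_of_le Finset.univ fun i _ => h i).trans_eq ?_
  rw [Finset.sum_const, Finset.card_univ, Fintype.card_fin, nsmul_eq_mul]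

theorem norm_div_sub_le {e : Fin N → ℂ} (he : ∀ i, ‖e i‖ = 1) {ε : ℝ} (hε : 0 < ε)
    (hgap : ∀ i j, i ≠ j → 2 * ε < ‖e i - e j‖) (i j : Fin N) :
    ‖e j / (e i - e j)‖ ≤ 1 / (2 * ε) := by
  by_cases hij : i = j
  · subst hij
    simp only [sub_self, div_zero, norm_zero]
    positivity
  · rw [norm_div, he]
    have := hgap i j hij
    gcongr

theorem norm_corrector_le {e : Fin N → ℂ} {p D : Fin N → X →L[ℂ] X} (he : ∀ i, ‖e i‖ = 1)
    (hp : ∀ i, ‖p i‖ ≤ 1) {c ε : ℝ} (hD : ∀ i, ‖D i‖ ≤ c) (hε : 0 < ε)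
    (hgap : ∀ i j, i ≠ j → 2 * ε < ‖e i - e j‖) :
    ‖corrector e p D‖ ≤ N * (N * (1 / (2 * ε) * c)) := by
  refine norm_sum_fin_le fun j => norm_sum_fin_le fun i => ?_
  rw [norm_smul]
  have h1 := norm_div_sub_le he hε hgap i j
  have h2 : ‖p j * D j * p i‖ ≤ 1 * c * 1 := by
    have hc : 0 ≤ c := (norm_nonneg _).trans (hD j)
    refine norm_mul₃_le.trans ?_
    gcongr
    · exact hp j
    · exact hD j
    · exact hp i
  rw [one_mul, mul_one] at h2
  gcongr

theorem norm_div_sub_sub_le {e e' : Fin N → ℂ} (he : ∀ i, ‖e i‖ = 1)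
    {ε δ : ℝ} (hε : 0 < ε) (hgap : ∀ i j, i ≠ j → 2 * ε < ‖e i - e j‖)
    (hgap' : ∀ i j, i ≠ j → 2 * ε < ‖e' i - e' j‖) (hd : ∀ i, ‖e i - e' i‖ ≤ δ) (i j : Fin N) :
    ‖e j / (e i - e j) - e' j / (e' i - e' j)‖ ≤ 2 * δ * (1 / (2 * ε)) ^ 2 := by
  have hδ : 0 ≤ δ := (norm_nonneg _).trans (hd j)
  by_cases hij : i = j
  · subst hij
    simp only [sub_self, div_zero, norm_zero]
    positivity
  · have g1 := hgap i j hij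
    have g2 := hgap' i j hij
    have h1 : e i - e j ≠ 0 := norm_pos_iff.1 (by linarith)
    have h2 : e' i - e' j ≠ 0 := norm_pos_iff.1 (by linarith)
    have e1 : e j / (e i - e j) - e' j / (e' i - e' j) =
        (e i * (e j - e' j) - e j * (e i - e' i)) * ((e i - e j)⁻¹ * (e' i - e' j)⁻¹) := by
      field_simp
      ring
    have h3 : ‖e i * (e j - e' j) - e j * (e i - e' i)‖ ≤ 2 * δ := by
      refine (norm_sub_le _ _).trans ?_
      rw [norm_mul, norm_mul, he, he]
      linarith [hd i, hd j]
    rw [e1, norm_mul, norm_mul, norm_inv, norm_inv, one_div, pow_two]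
    gcongr

theorem norm_corrector_sub_le {e e' : Fin N → ℂ} {p p' D D' : Fin N → X →L[ℂ] X}
    (he : ∀ i, ‖e i‖ = 1) (he' : ∀ i, ‖e' i‖ = 1) (hp : ∀ i, ‖p i‖ ≤ 1) (hp' : ∀ i, ‖p' i‖ ≤ 1)
    {c ε δ : ℝ} (hD : ∀ i, ‖D i‖ ≤ c) (hD' : ∀ i, ‖D' i‖ ≤ c) (hε : 0 < ε)
    (hgap : ∀ i j, i ≠ j → 2 * ε < ‖e i - e j‖) (hgap' : ∀ i j, i ≠ j → 2 * ε < ‖e' i - e' j‖)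
    (hde : ∀ i, ‖e i - e' i‖ ≤ δ) (hdp : ∀ i, ‖p i - p' i‖ ≤ δ) (hdD : ∀ i, ‖D i - D' i‖ ≤ δ) :
    ‖corrector e p D - corrector e' p' D'‖ ≤
      N * (N * ((2 * (1 / (2 * ε)) ^ 2 * c + 1 / (2 * ε) * (2 * c + 1)) * δ)) := by
  have hsplit : corrector e p D - corrector e' p' D' =
      ∑ j, ∑ i, ((e j / (e i - e j)) • (p j * D j * p i) -
        (e' j / (e' i - e' j)) • (p' j * D' j * p' i)) := by
    simp only [corrector, Finset.sum_sub_distrib]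
  rw [hsplit]
  refine norm_sum_fin_le fun j => norm_sum_fin_le fun i => ?_
  have hc : 0 ≤ c := (norm_nonneg _).trans (hD j)
  have hδ : 0 ≤ δ := (norm_nonneg _).trans (hde j)
  have e1 : (e j / (e i - e j)) • (p j * D j * p i) -
      (e' j / (e' i - e' j)) • (p' j * D' j * p' i) =
      (e j / (e i - e j) - e' j / (e' i - e' j)) • (p j * D j * p i) +
      (e' j / (e' i - e' j)) • ((p j - p' j) * D j * p i + p' j * (D j - D' j) * p i +
        p' j * D' j * (p i - p' i)) := by
    simp only [sub_smul, mul_sub, sub_mul, smul_sub, smul_add]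
    abel
  have h3 : ∀ {a b d : X →L[ℂ] X} {x y z : ℝ}, ‖a‖ ≤ x → ‖b‖ ≤ y → ‖d‖ ≤ z →
      ‖a * b * d‖ ≤ x * y * z := fun {a b d x y z} ha hb hd => by
    have hx : 0 ≤ x := (norm_nonneg _).trans ha
    have hy : 0 ≤ y := (norm_nonneg _).trans hb
    refine norm_mul₃_le.trans ?_
    gcongr
  have h4 : ‖(p j - p' j) * D j * p i + p' j * (D j - D' j) * p i + p' j * D' j * (p i - p' i)‖ ≤
      δ * c * 1 + 1 * δ * 1 + 1 * c * δ :=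
    (norm_add_le _ _).trans (add_le_add ((norm_add_le _ _).trans
      (add_le_add (h3 (hdp j) (hD j) (hp i)) (h3 (hp' j) (hdD j) (hp i))))
      (h3 (hp' j) (hD' j) (hdp i)))
  rw [e1]
  calc _ ≤ 2 * δ * (1 / (2 * ε)) ^ 2 * (1 * c * 1) +
        1 / (2 * ε) * (δ * c * 1 + 1 * δ * 1 + 1 * c * δ) := by
        refine (norm_add_le _ _).trans (add_le_add ?_ ?_)
        · rw [norm_smul]
          exact mul_le_mul (norm_div_sub_sub_le he hε hgap hgap' hde i j)
            (h3 (hp j) (hD j) (hp i)) (norm_nonneg _) (by positivity)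
        · rw [norm_smul]
          exact mul_le_mul (norm_div_sub_le he' hε hgap' i j) h4 (norm_nonneg _) (by positivity)
    _ = _ := by ring

/-- With `M = ∑ k, e k • p k`, the block `p j * D j * p i` is an eigenvector of the commutator with
eigenvalue `e i - e j`, which cancels the denominator of the corrector. -/
theorem corrector_mul_sub {e : Fin N → ℂ} {p D : Fin N → X →L[ℂ] X} (hinj : Function.Injective e)
    (h1 : ∀ i, p i * p i = p i) (h2 : ∀ i j, i ≠ j → p i * p j = 0) :
    corrector e p D * (∑ k, e k • p k) - (∑ k, e k • p k) * corrector e p D =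
      ∑ j, ∑ i, if i = j then 0 else e j • (p j * D j * p i) := by
  have hpM : ∀ i, p i * (∑ k, e k • p k) = e i • p i := fun i => mul_sum_of_orthogonal h1 h2 i e
  have hMp : ∀ i, (∑ k, e k • p k) * p i = e i • p i := fun i => sum_mul_of_orthogonal h1 h2 i e
  set M := ∑ k, e k • p k
  simp only [corrector, Finset.sum_mul, Finset.mul_sum, ← Finset.sum_sub_distrib]
  refine Finset.sum_congr rfl fun j _ => Finset.sum_congr rfl fun i _ => ?_
  have e1 : (e j / (e i - e j)) • (p j * D j * p i) * M =
      (e j / (e i - e j) * e i) • (p j * D j * p i) := by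
    rw [smul_mul_assoc, mul_assoc (p j * D j), hpM, mul_smul_comm, smul_smul]
  have e2 : M * (e j / (e i - e j)) • (p j * D j * p i) =
      (e j / (e i - e j) * e j) • (p j * D j * p i) := by
    rw [mul_smul_comm, mul_assoc (p j), ← mul_assoc _ (p j), hMp, smul_mul_assoc, smul_smul]
  rw [e1, e2, ← sub_smul]
  by_cases hij : i = j
  · rw [if_pos hij, hij]; simp
  · rw [if_neg hij, ← mul_sub, div_mul_cancel₀ _ (sub_ne_zero.2 (hinj.ne hij))]

/-- The defect of the corrected one-step map is of second order in the step `h`. -/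
theorem norm_defect_le {e : Fin N → ℂ} {p q D : Fin N → X →L[ℂ] X} {κ Z' : X →L[ℂ] X}
    {c h z w : ℝ} (hinj : Function.Injective e) (he : ∀ i, ‖e i‖ = 1) (h1 : ∀ i, p i * p i = p i)
    (h2 : ∀ i j, i ≠ j → p i * p j = 0) (hp : ∀ i, ‖p i‖ ≤ 1) (hP : ‖∑ k, e k • p k‖ ≤ 1)
    (hD : ∀ i j, j ≠ i → p j * D i = -(D j * p i)) (hh : 0 ≤ h) (hc : 0 ≤ c)
    (hch : c * h ≤ 1 / 2) (hpq : ∀ i, ‖p i - q i‖ ≤ c * h)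
    (hρ : ∀ i, ‖p i - q i - (h : ℂ) • D i‖ ≤ c * h ^ 2)
    (hκ : ‖κ - ∑ i, p i * q i‖ ≤ N * (2 * (c * h) ^ 2)) (hz : ‖corrector e p D‖ ≤ z)
    (hw : ‖corrector e p D - Z'‖ ≤ w * h) :
    ‖(∑ k, e k • p k) * (κ - ∑ i, q i) + (h : ℂ) • (corrector e p D * (∑ k, e k • p k) * κ) -
      (h : ℂ) • ((∑ k, e k • p k) * Z')‖ ≤
      (N * (N * c) + 2 * N * c ^ 2 + 2 * z * N * c + w) * h ^ 2 := by
  set M := ∑ k, e k • p k with hM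
  set Z := corrector e p D with hZ
  have hz0 : 0 ≤ z := (norm_nonneg _).trans hz
  have hnh : ‖(h : ℂ)‖ = h := by rw [Complex.norm_real, Real.norm_of_nonneg hh]
  have hMP : M * ∑ k, p k = M := by
    simpa using sum_mul_sum_of_orthogonal h1 h2 e (fun _ => 1)
  have hMp : ∀ j, M * p j = e j • p j := fun j => sum_mul_of_orthogonal h1 h2 j e
  -- First order cancellation: for `i ≠ j`, `-p j * q i = p j * (p i - q i)` is `h • (p j * D i)` up
  -- to second order, and this equals `-h • (p j * D j * p i)`, the negative of the corresponding
  -- block of `h • [Z, M]`, up to the factor `e j`.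
  have hlead : M * (∑ i, p i * q i - ∑ i, q i) + (h : ℂ) • (Z * M - M * Z) =
      ∑ j, ∑ i, if i = j then 0 else e j • (p j * (p i - q i - (h : ℂ) • D i)) := by
    have e1 : M * ∑ i, p i * q i = ∑ j, ∑ i, if i = j then e j • (p j * q i) else 0 := by
      rw [Finset.mul_sum]
      refine Finset.sum_congr rfl fun j _ => ?_
      rw [Finset.sum_ite_eq' Finset.univ j, if_pos (Finset.mem_univ _), ← mul_assoc, hMp,
        smul_mul_assoc]
    have e2 : M * ∑ i, q i = ∑ j, ∑ i, e j • (p j * q i) := by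
      rw [hM, Finset.sum_mul]
      refine Finset.sum_congr rfl fun j _ => ?_
      rw [smul_mul_assoc, Finset.mul_sum, Finset.smul_sum]
    rw [mul_sub, e1, e2, corrector_mul_sub hinj h1 h2]
    simp only [Finset.smul_sum, ← Finset.sum_sub_distrib, ← Finset.sum_add_distrib]
    refine Finset.sum_congr rfl fun j _ => Finset.sum_congr rfl fun i _ => ?_
    by_cases hij : i = j
    · simp [hij]
    · simp only [if_neg hij]
      have e3 : p j * D i = -(p j * D j * p i) := by
        rw [mul_assoc, ← neg_eq_iff_eq_neg.2 (hD i j (Ne.symm hij)), mul_neg, neg_neg, ← mul_assoc,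
          h1]
      rw [mul_sub, mul_sub, h2 j i (Ne.symm hij), mul_smul_comm, e3]
      simp only [smul_neg, zero_sub, sub_neg_eq_add]
      rw [smul_add, smul_neg, smul_comm (e j)]
  -- Besides the Taylor remainders, three second order errors remain: the normalisation of `κ`, the
  -- replacement of `κ` by `∑ k, p k` next to `h • Z`, and the variation of the corrector.
  have hsplit : M * (κ - ∑ i, q i) + (h : ℂ) • (Z * M * κ) - (h : ℂ) • (M * Z') =
      (∑ j, ∑ i, if i = j then 0 else e j • (p j * (p i - q i - (h : ℂ) • D i))) +
      M * (κ - ∑ i, p i * q i) + (h : ℂ) • (Z * M * (κ - ∑ k, p k)) +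
      (h : ℂ) • (M * (Z - Z')) := by
    rw [← hlead, mul_sub (Z * M), mul_assoc Z M (∑ k, p k), hMP]
    simp only [mul_sub, smul_sub]
    abel
  have b1 : ‖∑ j, ∑ i, if i = j then 0 else e j • (p j * (p i - q i - (h : ℂ) • D i))‖ ≤
      N * (N * (c * h ^ 2)) := by
    refine norm_sum_fin_le fun j => norm_sum_fin_le fun i => ?_
    by_cases hij : i = j
    · rw [if_pos hij, norm_zero]; positivity
    · rw [if_neg hij, norm_smul, he, one_mul]
      exact (norm_mul_le _ _).trans
        ((mul_le_mul (hp j) (hρ i) (norm_nonneg _) zero_le_one).trans_eq (one_mul _))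
  have b2 : ‖M * (κ - ∑ i, p i * q i)‖ ≤ N * (2 * (c * h) ^ 2) :=
    (norm_mul_le _ _).trans
      ((mul_le_mul hP hκ (norm_nonneg _) zero_le_one).trans_eq (one_mul _))
  have b3 : ‖κ - ∑ k, p k‖ ≤ 2 * N * (c * h) := by
    have e1 : κ - ∑ k, p k = (κ - ∑ i, p i * q i) - ∑ i, p i * (p i - q i) := by
      simp only [mul_sub, h1, Finset.sum_sub_distrib]; abel
    have b4 : ‖∑ i, p i * (p i - q i)‖ ≤ N * (c * h) := norm_sum_fin_le fun i =>
      (norm_mul_le _ _).trans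
        ((mul_le_mul (hp i) (hpq i) (norm_nonneg _) zero_le_one).trans_eq (one_mul _))
    rw [e1]
    refine (norm_sub_le _ _).trans ((add_le_add hκ b4).trans ?_)
    have hch0 : 0 ≤ c * h := by positivity
    have h5 : 2 * (c * h) ^ 2 ≤ c * h := by nlinarith
    have := mul_le_mul_of_nonneg_left h5 (Nat.cast_nonneg (α := ℝ) N)
    linarith
  have b5 : ‖Z * M * (κ - ∑ k, p k)‖ ≤ z * 1 * (2 * N * (c * h)) := by
    refine norm_mul₃_le.trans ?_
    gcongr
  have b6 : ‖M * (Z - Z')‖ ≤ w * h :=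
    (norm_mul_le _ _).trans
      ((mul_le_mul hP hw (norm_nonneg _) zero_le_one).trans_eq (one_mul _))
  rw [hsplit]
  calc _ ≤ N * (N * (c * h ^ 2)) + N * (2 * (c * h) ^ 2) + h * (z * 1 * (2 * N * (c * h))) +
        h * (w * h) := by
        refine norm_add₄_le.trans (add_le_add (add_le_add (add_le_add b1 b2) ?_) ?_)
        · rw [norm_smul, hnh]; gcongr
        · rw [norm_smul, hnh]; gcongr
    _ = _ := by ring

end Adiabatic

/-! ### Explicit constants and estimates along the time grid. -/

namespace Adiabatic

theorem natCast_div_mem_Icc {k T : ℕ} (hk : k ≤ T) : (k / T : ℝ) ∈ Icc (0 : ℝ) 1 :=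
  ⟨by positivity, div_le_one_of_le₀ (by exact_mod_cast hk) (Nat.cast_nonneg T)⟩

theorem succ_div_sub_div (k T : ℕ) : ((k + 1 : ℕ) / T : ℝ) - k / T = 1 / T := by
  push_cast; ring

/-- A bound of the adiabatic maps. -/
noncomputable def mapBound (c : ℝ) (N : ℕ) : ℝ :=
  N * (1 - c ^ 2 / (2 * c + 1) ^ 2) ^ (-(2 * c + 1) / 2)

/-- A bound of the corrector. -/
noncomputable def correctorBound (c : ℝ) (N : ℕ) (ε : ℝ) : ℝ :=
  N * (N * (1 / (2 * ε) * c))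

/-- A Lipschitz constant of the corrector. -/
noncomputable def correctorLip (c : ℝ) (N : ℕ) (ε : ℝ) : ℝ :=
  N * (N * ((2 * (1 / (2 * ε)) ^ 2 * c + 1 / (2 * ε) * (2 * c + 1)) * c))

/-- The constant of the second order defect of the corrected one-step map. -/
noncomputable def defectBound (c : ℝ) (N : ℕ) (ε : ℝ) : ℝ :=
  N * (N * c) + 2 * N * c ^ 2 + 2 * correctorBound c N ε * N * c + correctorLip c N ε

/-- The constant for the transitions between the peripheral and the stable subspaces. -/
noncomputable def leakConst (c : ℝ) (N : ℕ) : ℝ :=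
  5 * (N * c) + 3 * (N * c) ^ 2 + 1

/-- The constant of the adiabatic approximation. -/
noncomputable def adiabaticConst (c : ℝ) (N : ℕ) (ε : ℝ) : ℝ :=
  leakConst c N + (2 * correctorBound c N ε + defectBound c N ε) * mapBound c N

/-- The summand `1` in `leakConst` keeps it positive when `N * c = 0`. -/
theorem leakConst_pos {c : ℝ} (hc : 0 ≤ c) (N : ℕ) : 0 < leakConst c N := by
  unfold leakConst; positivity

theorem mapBound_nonneg {c : ℝ} (hc : 0 ≤ c) (N : ℕ) : 0 ≤ mapBound c N := by
  refine mul_nonneg (Nat.cast_nonneg N) (Real.rpow_nonneg ?_ _)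
  rw [← div_pow, sub_nonneg]
  exact pow_le_one₀ (by positivity) (div_le_one_of_le₀ (by linarith) (by linarith))

theorem correctorBound_nonneg {c : ℝ} (hc : 0 ≤ c) (N : ℕ) {ε : ℝ} (hε : 0 < ε) :
    0 ≤ correctorBound c N ε := by
  unfold correctorBound; positivity

theorem defectBound_nonneg {c : ℝ} (hc : 0 ≤ c) (N : ℕ) {ε : ℝ} (hε : 0 < ε) :
    0 ≤ defectBound c N ε := by
  unfold defectBound correctorBound correctorLip; positivity

theorem leakConst_le_adiabaticConst {c : ℝ} (hc : 0 ≤ c) (N : ℕ) {ε : ℝ} (hε : 0 < ε) :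
    leakConst c N ≤ adiabaticConst c N ε :=
  le_add_of_nonneg_right (mul_nonneg (add_nonneg (mul_nonneg two_pos.le
    (correctorBound_nonneg hc N hε)) (defectBound_nonneg hc N hε)) (mapBound_nonneg hc N))

/-- At most `T` second order contributions `(D / T)²` add up to first order. -/
theorem leak_le {a b D ℓ : ℝ} (hb : 0 ≤ b) {k T : ℕ} (hT : 0 < T) (hk : k ≤ T) (hℓ : ℓ < 1) :
    a * (D / T / (1 - ℓ)) + k * (b * (D / T * (D / T / (1 - ℓ)))) ≤
      (a * D + b * D ^ 2) / (T * (1 - ℓ)) := by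
  have hT' : (0 : ℝ) < T := by exact_mod_cast hT
  have hℓ' : 0 < 1 - ℓ := sub_pos.2 hℓ
  have hk' : (k : ℝ) ≤ T := by exact_mod_cast hk
  have h1 : 0 ≤ b * (D / T * (D / T / (1 - ℓ))) := by
    have : D / T * (D / T / (1 - ℓ)) = (D / T) ^ 2 / (1 - ℓ) := by ring
    rw [this]; positivity
  calc _ ≤ a * (D / T / (1 - ℓ)) + T * (b * (D / T * (D / T / (1 - ℓ)))) := by gcongr
    _ = _ := by field_simp

variable {X : Type*} [NormedAddCommGroup X] [NormedSpace ℂ X]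
  {L : ℝ → X →L[ℂ] X} {ε ℓ c : ℝ} {N : ℕ} {e : Fin N → ℝ → ℂ} {T : ℕ}

theorem IsLabelling.projAt_eq (he : IsLabelling L e) {k : ℕ} (hk : k ≤ T) :
    projAt L T k = ∑ j, eigProjAt L e T j k :=
  he.peripheralProj_eq (natCast_div_mem_Icc hk)

theorem DerivBound.norm_derivWithin_le (hb : DerivBound L e c) {s : ℝ} (hs : s ∈ Icc (0 : ℝ) 1)
    (j : Fin N) : ‖derivWithin (eigProj L e j) (Icc 0 1) s‖ ≤ c := by
  rw [← iteratedDerivWithin_one]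
  exact (hb s hs j 1 ⟨le_rfl, one_le_two⟩).1

theorem Hypotheses.gapAt (h : Hypotheses L ε ℓ) (he : IsLabelling L e) {k : ℕ} (hk : k ≤ T)
    (i j : Fin N) (hij : i ≠ j) : 2 * ε < ‖e i (k / T : ℝ) - e j (k / T : ℝ)‖ := by
  have hs := natCast_div_mem_Icc hk
  have hmem : ∀ i, e i (k / T : ℝ) ∈ peripheralSpectrum (L (k / T : ℝ)) := fun i =>
    he.range_eq _ hs ▸ mem_range_self i
  exact h.gap _ hs _ (hmem i) _ (hmem j) ((he.injective _ hs).ne hij)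

/-- The corrector at step `k`. -/
noncomputable def correctorAt (L : ℝ → X →L[ℂ] X) (e : Fin N → ℝ → ℂ) (T k : ℕ) : X →L[ℂ] X :=
  corrector (fun j => e j (k / T : ℝ)) (fun j => eigProjAt L e T j k)
    fun j => derivWithin (eigProj L e j) (Icc 0 1) (k / T : ℝ)

variable [FiniteDimensional ℂ X]

theorem Hypotheses.familyAt (h : Hypotheses L ε ℓ) (he : IsLabelling L e) {k : ℕ} (hk : k ≤ T) :
    IsPeripheralFamily (mapAt L T k) (fun j => e j (k / T : ℝ)) fun j => eigProjAt L e T j k :=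
  h.family he (natCast_div_mem_Icc hk)

theorem Hypotheses.norm_eigProjAt_sub_le (h : Hypotheses L ε ℓ) (he : IsLabelling L e)
    (hb : DerivBound L e c) {k : ℕ} (hk : k < T) (j : Fin N) :
    ‖eigProjAt L e T j (k + 1) - eigProjAt L e T j k‖ ≤ c / T := by
  have := norm_sub_le_of_iteratedDerivWithin
    (h.contDiffOn_eigProj he le_rfl (h.contDiffOn_eig he) j)
    (fun s hs => (hb s hs j 1 ⟨le_rfl, one_le_two⟩).1)
    (natCast_div_mem_Icc hk.le) (natCast_div_mem_Icc hk)
  rw [succ_div_sub_div, abs_of_nonneg (by positivity), mul_one_div] at this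
  exact this

theorem Hypotheses.isSlowFamily (h : Hypotheses L ε ℓ) (he : IsLabelling L e)
    (hb : DerivBound L e c) (hcT : c / T < 1) : IsSlowFamily L e T (c / T) where
  slow j :=
    { mul_self := fun _ hk => (h.familyAt he hk).mul_self j
      norm_le := fun _ hk => (h.familyAt he hk).norm_le_one j
      norm_sub_le := fun _ hk => h.norm_eigProjAt_sub_le he hb hk j
      lt_one := hcT }
  mul_of_ne _ hk := (h.familyAt he hk).mul_of_ne
  norm_eig _ hk := (h.familyAt he hk).norm_eig

theorem Hypotheses.isLeaky (h : Hypotheses L ε ℓ) (he : IsLabelling L e) (hc : 0 ≤ c)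
    (hb : DerivBound L e c) : IsLeaky (mapAt L T) (projAt L T) T ℓ (N * c / T) where
  norm_le _ hk := h.contraction _ (natCast_div_mem_Icc hk)
  mul_self k hk := by
    rw [he.projAt_eq hk]
    simpa using sum_mul_sum_of_orthogonal (h.familyAt he hk).mul_self (h.familyAt he hk).mul_of_ne
      (fun _ => 1) (fun _ => 1)
  commute k hk := by
    rw [he.projAt_eq hk, Finset.sum_mul, Finset.mul_sum]
    exact Finset.sum_congr rfl fun j _ => by
      rw [(h.familyAt he hk).mul_left j, (h.familyAt he hk).mul_right j]
  norm_proj_le k hk := by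
    rw [he.projAt_eq hk]
    exact (h.familyAt he hk).norm_sum_le
  norm_mul_le _ hk := h.norm_mul_stableProj_le (natCast_div_mem_Icc hk)
  norm_sub_le k hk := by
    rw [he.projAt_eq hk, he.projAt_eq hk.le, ← Finset.sum_sub_distrib, mul_div_assoc]
    exact norm_sum_fin_le fun j => h.norm_eigProjAt_sub_le he hb hk j
  lt_one := h.lt_one
  nonneg := by positivity

theorem Hypotheses.norm_correctorAt_le (h : Hypotheses L ε ℓ) (he : IsLabelling L e)
    (hb : DerivBound L e c) {k : ℕ} (hk : k ≤ T) :
    ‖correctorAt L e T k‖ ≤ correctorBound c N ε :=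
  norm_corrector_le (h.familyAt he hk).norm_eig (h.familyAt he hk).norm_le_one
    (hb.norm_derivWithin_le (natCast_div_mem_Icc hk)) h.gap_pos (h.gapAt he hk)

theorem Hypotheses.norm_correctorAt_sub_le (h : Hypotheses L ε ℓ) (he : IsLabelling L e)
    (hb : DerivBound L e c) {k : ℕ} (hk : k < T) :
    ‖correctorAt L e T (k + 1) - correctorAt L e T k‖ ≤ correctorLip c N ε * (1 / T) := by
  have hs := natCast_div_mem_Icc hk.le
  have ht := natCast_div_mem_Icc (Nat.succ_le_of_lt hk)
  have habs : |((k + 1 : ℕ) / T : ℝ) - k / T| = 1 / T := by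
    rw [succ_div_sub_div, abs_of_nonneg (by positivity)]
  refine (norm_corrector_sub_le (h.familyAt he hk).norm_eig (h.familyAt he hk.le).norm_eig
    (h.familyAt he hk).norm_le_one (h.familyAt he hk.le).norm_le_one
    (hb.norm_derivWithin_le ht) (hb.norm_derivWithin_le hs) h.gap_pos (h.gapAt he hk)
    (h.gapAt he hk.le) (δ := c * (1 / T)) (fun j => ?_) (fun j => ?_) (fun j => ?_)).trans_eq ?_
  · rw [← habs]
    exact norm_sub_le_of_iteratedDerivWithin (h.contDiffOn_eig he j)
      (fun s hs => (hb s hs j 1 ⟨le_rfl, one_le_two⟩).2) hs ht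
  · rw [mul_one_div]
    exact h.norm_eigProjAt_sub_le he hb hk j
  · rw [← habs]
    exact norm_derivWithin_sub_le_of_iteratedDerivWithin
      (h.contDiffOn_eigProj he le_rfl (h.contDiffOn_eig he) j)
      (fun s hs => (hb s hs j 2 ⟨one_le_two, le_rfl⟩).1) hs ht
  · unfold correctorLip; ring

theorem Hypotheses.mapAt_mul_projAt (h : Hypotheses L ε ℓ) (he : IsLabelling L e) {k : ℕ}
    (hk : k ≤ T) :
    mapAt L T k * projAt L T k = ∑ j, e j (k / T : ℝ) • eigProjAt L e T j k :=
  h.mul_peripheralProj_eq he (natCast_div_mem_Icc hk)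

/-- Because `∑ i, P^i_k` fixes `A_k`, the difference factors as the operator of `norm_defect_le`
times `A_k`. -/
theorem Hypotheses.norm_corrected_step_le (h : Hypotheses L ε ℓ) (he : IsLabelling L e)
    (hc : 0 ≤ c) (hb : DerivBound L e c) (hcT : c / T ≤ 1 / 2) {k : ℕ} (hk : k < T) :
    ‖(1 + ((1 / T : ℝ) : ℂ) • correctorAt L e T (k + 1)) * adiabaticMap L e T (k + 1) -
      mapAt L T (k + 1) * projAt L T (k + 1) *
        ((1 + ((1 / T : ℝ) : ℂ) • correctorAt L e T k) * adiabaticMap L e T k)‖ ≤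
      defectBound c N ε * (1 / T : ℝ) ^ 2 * ‖adiabaticMap L e T k‖ := by
  have : CompleteSpace X := FiniteDimensional.complete ℂ X
  have hslow := h.isSlowFamily he hb (hcT.trans_lt (by norm_num))
  have hs := natCast_div_mem_Icc hk.le
  have ht := natCast_div_mem_Icc (Nat.succ_le_of_lt hk)
  have hfam := h.familyAt he (Nat.succ_le_of_lt hk)
  have hκ : ‖katoStep L e T (k + 1) - ∑ i, eigProjAt L e T i (k + 1) * eigProjAt L e T i k‖ ≤
      N * (2 * (c * (1 / T)) ^ 2) := by
    rw [katoStep_succ, ← Finset.sum_sub_distrib, mul_one_div]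
    exact norm_sum_fin_le fun j => norm_katoTerm_sub_le (hfam.norm_le_one j)
      ((h.familyAt he hk.le).norm_le_one j) (h.norm_eigProjAt_sub_le he hb hk j) hcT
  have hM : ‖∑ j, e j ((k + 1 : ℕ) / T : ℝ) • eigProjAt L e T j (k + 1)‖ ≤ 1 := by
    rw [← h.mapAt_mul_projAt he (Nat.succ_le_of_lt hk)]
    exact (h.isLeaky he hc hb).norm_mul_proj_le hk
  have hdef := norm_defect_le (D := fun j => derivWithin (eigProj L e j) (Icc 0 1)
      ((k + 1 : ℕ) / T : ℝ)) (κ := katoStep L e T (k + 1)) (he.injective _ ht) hfam.norm_eig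
    hfam.mul_self hfam.mul_of_ne hfam.norm_le_one hM
    (fun i j hij => h.mul_derivWithin_eigProj he hij ht) (h := 1 / T) (by positivity) hc
    (by rwa [mul_one_div])
    (fun j => by rw [mul_one_div]; exact h.norm_eigProjAt_sub_le he hb hk j)
    (fun j => by
      have := norm_sub_sub_smul_derivWithin_le hc
        (h.contDiffOn_eigProj he le_rfl (h.contDiffOn_eig he) j)
        (fun s hs => (hb s hs j 2 ⟨one_le_two, le_rfl⟩).1) hs ht
        (by rw [← sub_nonneg, succ_div_sub_div]; positivity)
      rw [succ_div_sub_div, ← Complex.coe_smul] at this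
      exact this) hκ (h.norm_correctorAt_le he hb hk) (h.norm_correctorAt_sub_le he hb hk)
  rw [hslow.adiabaticMap_succ hk, h.mapAt_mul_projAt he (Nat.succ_le_of_lt hk)]
  refine le_trans (le_of_eq ?_)
    ((norm_mul_le _ (adiabaticMap L e T k)).trans (mul_le_mul_of_nonneg_right hdef (norm_nonneg _)))
  congr 1
  set M := ∑ j, e j ((k + 1 : ℕ) / T : ℝ) • eigProjAt L e T j (k + 1)
  have hA := hslow.sum_mul_adiabaticMap hk.le
  have hMA : M * (∑ i, eigProjAt L e T i k) * adiabaticMap L e T k =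
      M * adiabaticMap L e T k := by rw [mul_assoc, hA]
  change (1 + _ • correctorAt L e T (k + 1)) * _ - _ = (M * _ + _ • (correctorAt L e T (k + 1) *
    M * _) - _) * _
  simp only [sub_mul, mul_sub, add_mul, mul_add, one_mul, hMA, smul_mul_assoc, mul_smul_comm]
  simp only [mul_assoc]
  abel

/-- The comparison is made with the corrected map, whose defects sum to `O(1 / T)`. The corrector
itself is paid for twice, in the initial value and when it is removed at the end, hence `2 *
correctorBound`. -/
theorem Hypotheses.norm_evolutionP_sub_le (h : Hypotheses L ε ℓ) (he : IsLabelling L e)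
    (hc : 0 ≤ c) (hb : DerivBound L e c) (hT : 0 < T) (hcT : c / T ≤ 1 / 2) {B : ℝ}
    (hB : ∀ k ≤ T, ‖adiabaticMap L e T k‖ ≤ B) {k : ℕ} (hk : k ≤ T) :
    ‖evolutionP L T k * projAt L T 0 - adiabaticMap L e T k‖ ≤
      (2 * correctorBound c N ε + defectBound c N ε) * B / T := by
  have : CompleteSpace X := FiniteDimensional.complete ℂ X
  have hslow := h.isSlowFamily he hb (hcT.trans_lt (by norm_num))
  have hT' : (0 : ℝ) < T := by exact_mod_cast hT
  have hB0 : 0 ≤ B := (norm_nonneg _).trans (hB 0 (Nat.zero_le _))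
  have hd0 := defectBound_nonneg hc N h.gap_pos
  have hz0 := correctorBound_nonneg hc N h.gap_pos
  have hcorr : ∀ k ≤ T, ‖((1 / T : ℝ) : ℂ) • correctorAt L e T k * adiabaticMap L e T k‖ ≤
      1 / T * correctorBound c N ε * B := fun k hk => by
    refine (norm_mul_le _ _).trans ?_
    rw [norm_smul, Complex.norm_real, Real.norm_of_nonneg (by positivity)]
    gcongr
    · exact h.norm_correctorAt_le he hb hk
    · exact hB k hk
  have key : ∀ k ≤ T, ‖evolutionP L T k * projAt L T 0 -
      (1 + ((1 / T : ℝ) : ℂ) • correctorAt L e T k) * adiabaticMap L e T k‖ ≤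
      1 / T * correctorBound c N ε * B + k * (defectBound c N ε * (1 / T : ℝ) ^ 2 * B) := by
    intro k
    induction k with
    | zero =>
      intro hk
      have h0 : adiabaticMap L e T 0 = projAt L T 0 := by
        rw [hslow.adiabaticMap_eq hk, he.projAt_eq hk]
        simp [transport]
      have e1 : evolutionP L T 0 * projAt L T 0 -
          (1 + ((1 / T : ℝ) : ℂ) • correctorAt L e T 0) * adiabaticMap L e T 0 =
          -(((1 / T : ℝ) : ℂ) • correctorAt L e T 0 * adiabaticMap L e T 0) := by
        rw [h0, evolutionP, orderedProd, add_mul]; abel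
      rw [e1, norm_neg]
      simpa using hcorr 0 hk
    | succ k ih =>
      intro hk
      have ih := ih (by omega)
      have hstep := h.norm_corrected_step_le he hc hb hcT hk
      have hM := (h.isLeaky he hc hb).norm_mul_proj_le hk
      have e1 : evolutionP L T (k + 1) * projAt L T 0 -
          (1 + ((1 / T : ℝ) : ℂ) • correctorAt L e T (k + 1)) * adiabaticMap L e T (k + 1) =
          mapAt L T (k + 1) * projAt L T (k + 1) * (evolutionP L T k * projAt L T 0 -
            (1 + ((1 / T : ℝ) : ℂ) • correctorAt L e T k) * adiabaticMap L e T k) -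
          ((1 + ((1 / T : ℝ) : ℂ) • correctorAt L e T (k + 1)) * adiabaticMap L e T (k + 1) -
            mapAt L T (k + 1) * projAt L T (k + 1) *
              ((1 + ((1 / T : ℝ) : ℂ) • correctorAt L e T k) * adiabaticMap L e T k)) := by
        have : evolutionP L T (k + 1) =
          mapAt L T (k + 1) * projAt L T (k + 1) * evolutionP L T k := rfl
        rw [this, mul_sub (mapAt L T (k + 1) * projAt L T (k + 1)), mul_assoc _ (evolutionP L T k)]
        abel
      rw [e1]
      calc _ ≤ 1 * (1 / T * correctorBound c N ε * B +
            k * (defectBound c N ε * (1 / T : ℝ) ^ 2 * B)) +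
            defectBound c N ε * (1 / T : ℝ) ^ 2 * B := by
            refine (norm_sub_le _ _).trans (add_le_add ((norm_mul_le _ _).trans ?_)
              (hstep.trans ?_))
            · exact mul_le_mul hM ih (norm_nonneg _) zero_le_one
            · exact mul_le_mul_of_nonneg_left (hB k (by omega)) (by positivity)
        _ = _ := by push_cast; ring
  have e1 : evolutionP L T k * projAt L T 0 - adiabaticMap L e T k =
      (evolutionP L T k * projAt L T 0 -
        (1 + ((1 / T : ℝ) : ℂ) • correctorAt L e T k) * adiabaticMap L e T k) +
      ((1 / T : ℝ) : ℂ) • correctorAt L e T k * adiabaticMap L e T k := by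
    rw [add_mul, one_mul]; abel
  have hk' : (k : ℝ) ≤ T := by exact_mod_cast hk
  rw [e1]
  calc _ ≤ (1 / T * correctorBound c N ε * B + k * (defectBound c N ε * (1 / T : ℝ) ^ 2 * B)) +
        1 / T * correctorBound c N ε * B :=
        (norm_add_le _ _).trans (add_le_add (key k hk) (hcorr k hk))
    _ ≤ (1 / T * correctorBound c N ε * B + T * (defectBound c N ε * (1 / T : ℝ) ^ 2 * B)) +
        1 / T * correctorBound c N ε * B := by gcongr
    _ = _ := by field_simp; ring

end Adiabatic

end AdiabaticTheory

theorem theorem4p5 :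
    ∃ (T₀ : ℝ → ℕ → ℝ) (C₀ : ℝ → ℕ → ℝ) (C : ℝ → ℕ → ℝ → ℝ),
      (∀ c N, 0 ≤ c → 0 < T₀ c N ∧ c < T₀ c N ∧ 0 < C₀ c N) ∧
      (∀ c N ε, 0 ≤ c → 0 < ε → 0 < C c N ε) ∧
      ∀ (X : Type*) [NormedAddCommGroup X] [NormedSpace ℂ X] [FiniteDimensional ℂ X]
        (L : ℝ → X →L[ℂ] X) (ε ℓ : ℝ), Adiabatic.Hypotheses L ε ℓ →
        (∃ e : Fin (Adiabatic.maxCount L) → ℝ → ℂ, Adiabatic.IsLabelling L e) ∧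
        ∀ e : Fin (Adiabatic.maxCount L) → ℝ → ℂ, Adiabatic.IsLabelling L e →
          (∀ j, ContDiffOn ℝ 2 (e j) (Set.Icc 0 1) ∧
            ContDiffOn ℝ 2 (Adiabatic.eigProj L e j) (Set.Icc 0 1)) ∧
          (∃ c, 0 ≤ c ∧ Adiabatic.DerivBound L e c) ∧
          ∀ c, 0 ≤ c → Adiabatic.DerivBound L e c →
          ∀ T : ℕ, T₀ c (Adiabatic.maxCount L) ≤ T →
            -- the Kato maps are well defined
            (∀ k < T, ∀ j,
              ‖Adiabatic.eigProjAt L e T j (k + 1) - Adiabatic.eigProjAt L e T j k‖ < 1) ∧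
            ∀ k ≤ T,
              -- uniform bounds
              max ‖Adiabatic.adiabaticMap L e T k‖ ‖Adiabatic.adiabaticMapDagger L e T k‖ ≤
                Adiabatic.maxCount L *
                  (1 - c ^ 2 / T₀ c (Adiabatic.maxCount L) ^ 2) ^
                    (-(T₀ c (Adiabatic.maxCount L)) / 2) ∧
              -- pseudo-inverse and intertwining relations
              Adiabatic.adiabaticMapDagger L e T k * Adiabatic.adiabaticMap L e T k =
                Adiabatic.projAt L T 0 ∧
              Adiabatic.adiabaticMap L e T k * Adiabatic.adiabaticMapDagger L e T k =
                Adiabatic.projAt L T k ∧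
              (∀ j, Adiabatic.adiabaticMap L e T k * Adiabatic.eigProjAt L e T j 0 =
                Adiabatic.eigProjAt L e T j k * Adiabatic.adiabaticMap L e T k) ∧
              (∀ j, Adiabatic.adiabaticMapDagger L e T k * Adiabatic.eigProjAt L e T j k =
                Adiabatic.eigProjAt L e T j 0 * Adiabatic.adiabaticMapDagger L e T k) ∧
              Adiabatic.adiabaticMap L e T k * Adiabatic.stableAt L T 0 = 0 ∧
              Adiabatic.stableAt L T 0 * Adiabatic.adiabaticMapDagger L e T k = 0 ∧
              -- the adiabatic approximation
              ‖Adiabatic.evolution L T k - Adiabatic.adiabaticMap L e T k‖ ≤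
                C c (Adiabatic.maxCount L) ε / (T * (1 - ℓ)) + 2 * ℓ ^ k ∧
              -- approximation of the peripheral dynamics
              ‖Adiabatic.evolutionP L T k * Adiabatic.projAt L T 0 -
                  Adiabatic.adiabaticMap L e T k‖ ≤ C c (Adiabatic.maxCount L) ε / T ∧
              -- the strictly contracting parts are negligible
              ‖Adiabatic.evolution L T k -
                  Adiabatic.evolutionP L T k * Adiabatic.projAt L T 0 -
                  Adiabatic.evolutionQ L T k * Adiabatic.stableAt L T 0‖ ≤
                C₀ c (Adiabatic.maxCount L) / (T * (1 - ℓ)) ∧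
              ‖Adiabatic.evolution L T k * Adiabatic.projAt L T 0 -
                  Adiabatic.evolutionP L T k * Adiabatic.projAt L T 0‖ ≤
                C₀ c (Adiabatic.maxCount L) / (T * (1 - ℓ)) ∧
              ‖Adiabatic.evolution L T k * Adiabatic.stableAt L T 0‖ ≤
                C₀ c (Adiabatic.maxCount L) / (T * (1 - ℓ)) + 2 * ℓ ^ k ∧
              ‖Adiabatic.evolutionQ L T k * Adiabatic.stableAt L T 0‖ ≤ 2 * ℓ ^ k := by
  -- `T₀ = 2 * c + 1` exceeds `c` and gives `c / T ≤ 1 / 2` for `T ≥ T₀`, the range in which the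
  -- Kato factor has the second order expansion.
  refine ⟨fun c _ => 2 * c + 1, Adiabatic.leakConst, Adiabatic.adiabaticConst,
    fun c N hc => ⟨by linarith, by linarith, Adiabatic.leakConst_pos hc N⟩,
    fun c N ε hc hε => (Adiabatic.leakConst_pos hc N).trans_le
      (Adiabatic.leakConst_le_adiabaticConst hc N hε), ?_⟩
  intro X _ _ _ L ε ℓ h
  refine ⟨h.exists_isLabelling, fun e he => ⟨fun j => ⟨h.contDiffOn_eig he j,
    h.contDiffOn_eigProj he le_rfl (h.contDiffOn_eig he) j⟩, h.exists_derivBound he, ?_⟩⟩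
  intro c hc hb T hT
  have : CompleteSpace X := FiniteDimensional.complete ℂ X
  have hT' : (0 : ℝ) < T := by linarith
  have hT0 : 0 < T := by exact_mod_cast hT'
  have hcT : c / T ≤ 1 / 2 := by rw [div_le_iff₀ hT']; linarith
  have hslow := h.isSlowFamily he hb (hcT.trans_lt (by norm_num))
  have hleak := h.isLeaky (T := T) he hc hb
  have hℓ : 0 < 1 - ℓ := sub_pos.2 h.lt_one
  have hpow : ∀ k ≤ T, Adiabatic.maxCount L * ((1 - (c / T) ^ 2) ^ (-(1 / 2) : ℝ)) ^ k ≤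
      Adiabatic.mapBound c (Adiabatic.maxCount L) := fun k hk =>
    mul_le_mul_of_nonneg_left (Adiabatic.rpow_pow_le_rpow hc (by linarith) hT hk)
      (Nat.cast_nonneg _)
  have hB : ∀ k ≤ T, ‖Adiabatic.adiabaticMap L e T k‖ ≤
      Adiabatic.mapBound c (Adiabatic.maxCount L) := fun k hk =>
    (hslow.norm_adiabaticMap_le hk).trans (hpow k hk)
  have hC : ∀ a b : ℝ, 0 ≤ b → a ≤ 5 → b ≤ 3 → ∀ k ≤ T,
      a * (Adiabatic.maxCount L * c / T / (1 - ℓ)) + k * (b * (Adiabatic.maxCount L * c / T *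
        (Adiabatic.maxCount L * c / T / (1 - ℓ)))) ≤
      Adiabatic.leakConst c (Adiabatic.maxCount L) / (T * (1 - ℓ)) := fun a b hb0 ha hb3 k hk => by
    refine (Adiabatic.leak_le hb0 hT0 hk h.lt_one).trans ?_
    refine div_le_div_of_nonneg_right ?_ (by positivity)
    unfold Adiabatic.leakConst
    have h1 : a * (Adiabatic.maxCount L * c) ≤ 5 * (Adiabatic.maxCount L * c) := by gcongr
    have h2 : b * (Adiabatic.maxCount L * c) ^ 2 ≤ 3 * (Adiabatic.maxCount L * c) ^ 2 := by gcongr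
    linarith
  refine ⟨fun k hk j => (hslow.slow j).norm_sub_lt hk, fun k hk => ?_⟩
  have hP := h.norm_evolutionP_sub_le he hc hb hT0 hcT hB hk
  have hdec := (hleak.norm_orderedProd_sub_sub_le hk).trans
    (hC 5 3 (by norm_num) le_rfl le_rfl k hk)
  have hQ := hleak.norm_orderedProd_compl_le hk
  have hb0 := Adiabatic.correctorBound_nonneg hc (Adiabatic.maxCount L) h.gap_pos
  have hd0 := Adiabatic.defectBound_nonneg hc (Adiabatic.maxCount L) h.gap_pos
  have hm0 := Adiabatic.mapBound_nonneg hc (Adiabatic.maxCount L)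
  refine ⟨max_le (hB k hk) ((hslow.norm_adiabaticMapDagger_le hk).trans (hpow k hk)),
    ?_, ?_, ?_, ?_, ?_, ?_, ?_, ?_, hdec, ?_, ?_, hQ⟩
  · rw [hslow.adiabaticMapDagger_mul_adiabaticMap hk, he.projAt_eq (Nat.zero_le _)]
  · rw [hslow.adiabaticMap_mul_adiabaticMapDagger hk, he.projAt_eq hk]
  · exact fun j => (hslow.adiabaticMap_mul hk j).trans (hslow.mul_adiabaticMap hk j).symm
  · exact fun j => (hslow.adiabaticMapDagger_mul hk j).trans
      (hslow.mul_adiabaticMapDagger hk j).symm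
  · change _ * (1 - Adiabatic.projAt L T 0) = 0
    rw [mul_sub, mul_one, he.projAt_eq (Nat.zero_le _), hslow.adiabaticMap_mul_sum hk, sub_self]
  · change (1 - Adiabatic.projAt L T 0) * _ = 0
    rw [sub_mul, one_mul, he.projAt_eq (Nat.zero_le _), hslow.sum_mul_adiabaticMapDagger hk,
      sub_self]
  -- The total error is the block decomposition error, the peripheral approximation error and the
  -- decaying stable part. The second is weakened by the factor `1 / (1 - ℓ) ≥ 1` to share a
  -- denominator with the first.
  · have e1 : Adiabatic.evolution L T k - Adiabatic.adiabaticMap L e T k =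
        (Adiabatic.evolution L T k - Adiabatic.evolutionP L T k * Adiabatic.projAt L T 0 -
          Adiabatic.evolutionQ L T k * Adiabatic.stableAt L T 0) +
        (Adiabatic.evolutionP L T k * Adiabatic.projAt L T 0 - Adiabatic.adiabaticMap L e T k) +
        Adiabatic.evolutionQ L T k * Adiabatic.stableAt L T 0 := by abel
    rw [e1]
    refine norm_add₃_le.trans (add_le_add ((add_le_add hdec hP).trans ?_) hQ)
    have h1 : (2 * Adiabatic.correctorBound c (Adiabatic.maxCount L) ε +
        Adiabatic.defectBound c (Adiabatic.maxCount L) ε) *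
          Adiabatic.mapBound c (Adiabatic.maxCount L) / T ≤
        (2 * Adiabatic.correctorBound c (Adiabatic.maxCount L) ε +
        Adiabatic.defectBound c (Adiabatic.maxCount L) ε) *
          Adiabatic.mapBound c (Adiabatic.maxCount L) / (T * (1 - ℓ)) := by
      gcongr
      exact mul_le_of_le_one_right hT'.le (by linarith [hleak.ratio_nonneg])
    refine (add_le_add_right h1 _).trans_eq ?_
    rw [← add_div]
    rfl
  · refine hP.trans ?_
    gcongr
    exact le_add_of_nonneg_left (Adiabatic.leakConst_pos hc _).le
  · refine (hleak.norm_orderedProd_mul_proj_sub_le hk).trans ?_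
    have := hC 1 1 zero_le_one (by norm_num) (by norm_num) k hk
    rwa [one_mul, one_mul] at this
  · refine (hleak.norm_orderedProd_mul_compl_le hk).trans ?_
    have := hC 4 2 (by norm_num) (by norm_num) (by norm_num) k hk
    linarith
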